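/- **Setting.** Let $\kappa>0$, let $\mathbb R^{3,1}$ have coordinates $\mathbf X=(x_1,x_2,x_3,t)$ and Lorentz product $\mathbf X\cdot\mathbf X=x_1^2+x_2^2+x_3^2-t^2$, and let $\mathbb H^3_{-\kappa^2}=\{\mathbf X\cdot\mathbf X=-\kappa^{-2},\ t>0\}$. Let $\Sigma$ be a compact connected smooth surface without boundary and $F_0:\Sigma\to\mathbb H^3_{-\kappa^2}$ a smooth embedding with outward unit normal $\mathbf N$ (tangent to $\mathbb H^3_{-\kappa^2}$), whose second fundamental form with respect to $\mathbf N$ is positive definite. Let $\Sigma_r$, $r\ge 0$, be the surface at distance $r$ outside $F_0(\Sigma)$, parametrized by $$F(p,r)=\cosh(\kappa r)\,F_0(p)+\tfrac{\sinh(\kappa r)}{\kappa}\,\mathbf N(p),\qquad p\in\Sigma ,$$ and let $H_0$, $R^r$, $\Delta_r$ be the mean curvature with respect to the outward normal of $\mathbb H^3_{-\kappa^2}$, the scalar curvature and the Laplace operator of $\Sigma_r$, all regarded as defined on $\Sigma$. Let $\mathcal H(\cdot,0)$ be a positive function on $\Sigma$ and let $u$ be a solution on $\Sigma\times[0,\infty)$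 of $$2H_0\,\frac{\partial u}{\partial r}=2u^2\Delta_r u+(u-u^3)(R^r+6\kappa^2),\qquad u(p,0)=\frac{H_0(p,0)}{\mathcal H(p,0)} ,$$ and put $\mathcal H=H_0/u$, the mean curvature of $\Sigma_r$ in the metric $g''=u^2dr^2+g_{ab}(r)$, where $g_{ab}(r)$ is the induced metric of $\Sigma_r$. Put $$\gamma_0(p)=\lim_{r\to\infty}e^{-\kappa r}\kappa F(p,r)=\tfrac12\big(\kappa F_0(p)+\mathbf N(p)\big),$$ and for $a=(a_1,a_2)\in\mathbb C^2$ $$\zeta(a)=\big(-(|a_1|^2-|a_2|^2),\,-(a_1\bar a_2+\bar a_1a_2),\,-\sqrt{-1}(a_1\bar a_2-\bar a_1a_2),\,|a_1|^2+|a_2|^2\big).$$ Let $\phi'_{0,a}$ be the Killing spinor of $\mathbb H^3_{-\kappa^2}$ which at the point $$\tfrac1\kappa(\sinh\kappa\rho\cos\theta,\ \sinh\kappa\rho\sin\theta\cos\psi,\ \sinh\kappa\rho\sin\theta\sin\psi,\ \cosh\kappa\rho)$$ has, in the spin frame of these polar coordinates, the components $$\begin{bmatrix} e^{\frac{\kappa\rho}2+\frac{i\psi}2}\cos\frac\theta2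 & e^{\frac{\kappa\rho}2-\frac{i\psi}2}\sin\frac\theta2\\ -e^{-\frac{\kappa\rho}2+\frac{i\psi}2}\sin\frac\theta2 & e^{-\frac{\kappa\rho}2-\frac{i\psi}2}\cos\frac\theta2\end{bmatrix}\begin{bmatrix}a_1\\a_2\end{bmatrix},$$ and let $\phi_{0,a}=A\phi'_{0,a}$, where $A$ is the fibrewise isometry of spinor bundles induced by $\partial_r\mapsto u^{-1}\partial_r$, $X\mapsto X$ for $X\in T\Sigma_r$; thus $|\phi_{0,a}|^2_{g''}$ is the square norm in $\mathbb C^2$ of these components. **Proposition.** Let $a\in\mathbb C^2$. (1) Let $W$ be any solution on $\Sigma\times[0,\infty)$ of $$\frac{H_0}{u}\frac{\partial W}{\partial r}=-\Delta_rW+2\kappa^2W,\qquad \lim_{r\to\infty}e^{-\kappa r}W(p,r)=-\gamma_0(p)\cdot\zeta(a)\ \text{ uniformly in } p\in\Sigma .$$ Then $m_W(r)=\int_{\Sigma_r}(H_0-\mathcal H)W$ is monotone non-increasing in $r\in[0,\infty)$, and the following two limits exist, are finite, and are equal: $$\lim_{r\to\infty}\int_{\Sigma_r}(H_0-\mathcal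 H)W=\lim_{r\to\infty}\int_{\Sigma_r}(H_0-\mathcal H)|\phi_{0,a}|^2 .$$ (2) Let $\mathbf W:\Sigma\times[0,\infty)\to\mathbb R^{3,1}$ be any solution of $$\frac{H_0}{u}\frac{\partial \mathbf W}{\partial r}=-\Delta_r\mathbf W+2\kappa^2\mathbf W,\qquad \lim_{r\to\infty}e^{-\kappa r}\mathbf W(p,r)=-\gamma_0(p)\ \text{ uniformly in } p\in\Sigma .$$ Then $\int_{\Sigma_r}(H_0-\mathcal H)\,\mathbf W\cdot\zeta(a)$ is monotone non-increasing in $r\in[0,\infty)$, and its limit as $r\to\infty$ exists, is finite, and equals that of $\int_{\Sigma_r}(H_0-\mathcal H)|\phi_{0,a}|^2$. Solutions are classical: $u$, $W$, $\mathbf W$ are continuous on $\Sigma\times[0,\infty)$ and $C^2$ on $\Sigma\times(0,\infty)$, where the equations hold. -/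

import Mathlib

open Set Filter Topology MeasureTheory
open scoped ContDiff Manifold

noncomputable section

namespace QuasiLocal

/-! ### Minkowski space and the hyperboloid -/

/-- The Minkowski space `ℝ^{3,1}` with coordinates `(x₁, x₂, x₃, t)`. -/
abbrev Mink : Type := Fin 4 → ℝ

/-- The Lorentz inner product `dx₁² + dx₂² + dx₃² - dt²`. -/
def lorentz (X Y : Mink) : ℝ := X 0 * Y 0 + X 1 * Y 1 + X 2 * Y 2 - X 3 * Y 3

/-- The hyperbolic space of constant sectional curvature `-κ²`, as a hyperboloid. -/
def hyperboloid (κ : ℝ) : Set Mink := {X | lorentz X X = -(1 / κ ^ 2) ∧ 0 < X 3}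

/-- The region of hyperbolic space enclosed by `T`: the union of the bounded connected components
of the complement of `T`. (A subset of the hyperboloid is bounded for the hyperbolic distance
exactly if it is bounded in `ℝ⁴`.) -/
def enclosedRegion (κ : ℝ) (T : Set Mink) : Set Mink :=
  {X | X ∈ hyperboloid κ \ T ∧
    Bornology.IsBounded (connectedComponentIn (hyperboloid κ \ T) X)}

/-! ### Riemannian geometry of a metric given in coordinates on a domain of the plane -/

/-- The model space of surfaces. -/
abbrev Plane : Type := EuclideanSpace ℝ (Fin 2)

/-- The coordinate derivative `∂f/∂xᵃ`. -/
def pd {V : Type*} [NormedAddCommGroup V] [NormedSpace ℝ V] (a : Fin 2) (f : Plane → V)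
    (x : Plane) : V := fderiv ℝ f x (EuclideanSpace.single a 1)

/-- The Christoffel symbol `Γᶜ_{ab}` of the metric `G`. -/
def christoffel (G : Plane → Matrix (Fin 2) (Fin 2) ℝ) (c a b : Fin 2) (x : Plane) : ℝ :=
  (1 / 2) * ∑ d, (G x)⁻¹ c d *
    (pd a (fun y => G y b d) x + pd b (fun y => G y a d) x - pd d (fun y => G y a b) x)

/-- The Ricci tensor `R_{ab}` of the metric `G`. -/
def ricci (G : Plane → Matrix (Fin 2) (Fin 2) ℝ) (a b : Fin 2) (x : Plane) : ℝ :=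
  ∑ c, (pd c (christoffel G c a b) x - pd b (christoffel G c a c) x
    + ∑ d, (christoffel G c c d x * christoffel G d a b x
      - christoffel G c b d x * christoffel G d a c x))

/-- The scalar curvature of the metric `G` (twice the Gaussian curvature). -/
def scalarCurv (G : Plane → Matrix (Fin 2) (Fin 2) ℝ) (x : Plane) : ℝ :=
  ∑ a, ∑ b, (G x)⁻¹ a b * ricci G a b x

/-- The Laplace-Beltrami operator `(det G)^{-1/2} ∂_a ((det G)^{1/2} G^{ab} ∂_b f)`. -/
def laplaceBeltrami (G : Plane → Matrix (Fin 2) (Fin 2) ℝ) (f : Plane → ℝ) (x : Plane) : ℝ :=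
  (1 / √(G x).det) *
    ∑ a, pd a (fun y => √(G y).det * ∑ b, (G y)⁻¹ a b * pd b f y) x

/-! ### The foliation by parallel surfaces

`F₀ : S → ℝ^{3,1}` is a surface in the hyperboloid and `N` its unit normal in the hyperboloid. -/

section Foliation

variable {S : Type*} [TopologicalSpace S] [ChartedSpace Plane S]

/-- `F(p, r)`: the point at distance `r` along the unit speed geodesic of hyperbolic space which
starts at `F₀ p` with velocity `N p`. -/
def leaf (κ : ℝ) (F₀ N : S → Mink) (r : ℝ) (p : S) : Mink :=
  Real.cosh (κ * r) • F₀ p + (Real.sinh (κ * r) / κ) • N p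

/-- The unit normal `∂F/∂r` of the leaf `Σ_r` in hyperbolic space. -/
def leafNormal (κ : ℝ) (F₀ N : S → Mink) (r : ℝ) (p : S) : Mink :=
  (κ * Real.sinh (κ * r)) • F₀ p + Real.cosh (κ * r) • N p

/-- The induced metric `g_{ab}(r)` of the leaf `Σ_r`, in the preferred chart at `p`. -/
def metric (κ : ℝ) (F₀ N : S → Mink) (r : ℝ) (p : S) (x : Plane) : Matrix (Fin 2) (Fin 2) ℝ :=
  Matrix.of fun a b => lorentz (pd a (leaf κ F₀ N r ∘ (chartAt Plane p).symm) x)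
    (pd b (leaf κ F₀ N r ∘ (chartAt Plane p).symm) x)

/-- The second fundamental form `h_{ab} = ⟨∇_{∂_a F} N_r, ∂_b F⟩` of the leaf `Σ_r`, in the
preferred chart at `p`. (The hyperbolic covariant derivative is the tangential part of the
derivative in `ℝ^{3,1}`.) -/
def secondForm (κ : ℝ) (F₀ N : S → Mink) (r : ℝ) (p : S) (x : Plane) :
    Matrix (Fin 2) (Fin 2) ℝ :=
  Matrix.of fun a b => lorentz (pd a (leafNormal κ F₀ N r ∘ (chartAt Plane p).symm) x)
    (pd b (leaf κ F₀ N r ∘ (chartAt Plane p).symm) x)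

/-- The mean curvature `H₀(p, r) = g^{ab} h_{ab}` of `Σ_r` in hyperbolic space. -/
def meanCurv (κ : ℝ) (F₀ N : S → Mink) (r : ℝ) (p : S) : ℝ :=
  ∑ a, ∑ b, (metric κ F₀ N r p (chartAt Plane p p))⁻¹ a b *
    secondForm κ F₀ N r p (chartAt Plane p p) a b

/-- The scalar curvature `R^r` of the leaf `Σ_r`. -/
def leafScalarCurv (κ : ℝ) (F₀ N : S → Mink) (r : ℝ) (p : S) : ℝ :=
  scalarCurv (metric κ F₀ N r p) (chartAt Plane p p)

/-- The Laplace operator `Δ_r` of the leaf `Σ_r`. -/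
def leafLaplacian (κ : ℝ) (F₀ N : S → Mink) (r : ℝ) (f : S → ℝ) (p : S) : ℝ :=
  laplaceBeltrami (metric κ F₀ N r p) (f ∘ (chartAt Plane p).symm) (chartAt Plane p p)

/-- The area measure of `Σ_r` on the domain of the preferred chart at `p`: the image of
`√(det g_{ab}) dx` under the inverse of the chart. -/
def chartArea [MeasurableSpace S] (κ : ℝ) (F₀ N : S → Mink) (r : ℝ) (p : S) : Measure S :=
  (((volume : Measure Plane).restrict (chartAt Plane p).target).withDensity
    fun x => ENNReal.ofReal √(metric κ F₀ N r p x).det).map (chartAt Plane p).symm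

variable (S) in
/-- A smooth partition of unity subordinate to the domains of the preferred charts. -/
def chartPartition [IsManifold (𝓡 2) ∞ S] [T2Space S] [SigmaCompactSpace S] :
    SmoothPartitionOfUnity S (𝓡 2) S univ :=
  (SmoothPartitionOfUnity.exists_isSubordinate_chartAt_source (𝓡 2) S).choose

variable (S) in
theorem chartPartition_isSubordinate [IsManifold (𝓡 2) ∞ S] [T2Space S] [SigmaCompactSpace S] :
    (chartPartition S).IsSubordinate fun p => (chartAt Plane p).source :=
  (SmoothPartitionOfUnity.exists_isSubordinate_chartAt_source (𝓡 2) S).choose_spec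

/-- The area measure of the leaf `Σ_r`, on the parameter surface `S`: the chart area measures
glued by a partition of unity. -/
def areaMeasure [IsManifold (𝓡 2) ∞ S] [T2Space S] [SigmaCompactSpace S] [MeasurableSpace S]
    (κ : ℝ) (F₀ N : S → Mink) (r : ℝ) : Measure S :=
  Measure.sum fun p : S =>
    (chartArea κ F₀ N r p).withDensity fun q => ENNReal.ofReal (chartPartition S p q)

/-- `F₀` is a smooth embedding of `S` onto a convex surface of hyperbolic space, with outward unit
normal `N`. -/
structure IsConvexSurface (κ : ℝ) (F₀ N : S → Mink) : Prop where
  mem_hyperboloid : ∀ p, F₀ p ∈ hyperboloid κ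
  smooth : ContMDiff (𝓡 2) 𝓘(ℝ, Mink) ∞ F₀
  injective : Function.Injective F₀
  immersion : ∀ p, Function.Injective (mfderiv (𝓡 2) 𝓘(ℝ, Mink) F₀ p)
  normal_smooth : ContMDiff (𝓡 2) 𝓘(ℝ, Mink) ∞ N
  normal_unit : ∀ p, lorentz (N p) (N p) = 1
  /-- `N` is tangent to the hyperboloid -/
  normal_tangent : ∀ p, lorentz (N p) (F₀ p) = 0
  normal_orthogonal : ∀ p v, lorentz (N p) (mfderiv (𝓡 2) 𝓘(ℝ, Mink) F₀ p v) = 0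
  /-- `N` points out of the region enclosed by the surface -/
  normal_outward : ∀ p, ∀ᶠ s in 𝓝[>] (0 : ℝ),
    leaf κ F₀ N s p ∉ enclosedRegion κ (range F₀)
  /-- the second fundamental form with respect to the outward normal is positive definite -/
  convex : ∀ p, (secondForm κ F₀ N 0 p (chartAt Plane p p)).PosDef

/-- `u` is a (classical) solution for all `r ≥ 0` of
`2 H₀ ∂u/∂r = 2 u² Δ_r u + (u - u³)(R^r + 6κ²)`, `u(·, 0) = H₀(·, 0) / Hin`. -/
structure IsLapse (κ : ℝ) (F₀ N : S → Mink) (Hin : S → ℝ) (u : S → ℝ → ℝ) : Prop where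
  continuousOn : ContinuousOn (fun q : S × ℝ => u q.1 q.2) (univ ×ˢ Ici 0)
  contMDiffOn : ContMDiffOn ((𝓡 2).prod 𝓘(ℝ, ℝ)) 𝓘(ℝ, ℝ) 2
    (fun q : S × ℝ => u q.1 q.2) (univ ×ˢ Ioi 0)
  equation : ∀ p, ∀ r > 0, 2 * meanCurv κ F₀ N r p * deriv (u p) r =
    2 * u p r ^ 2 * leafLaplacian κ F₀ N r (fun q => u q r) p +
      (u p r - u p r ^ 3) * (leafScalarCurv κ F₀ N r p + 6 * κ ^ 2)
  initial : ∀ p, u p 0 = meanCurv κ F₀ N 0 p / Hin p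

/-- The mean curvature `H₀ / u` of `Σ_r` in the metric `u² dr² + g_{ab}(r)`. -/
def perturbedMeanCurv (κ : ℝ) (F₀ N : S → Mink) (u : S → ℝ → ℝ) (r : ℝ) (p : S) : ℝ :=
  meanCurv κ F₀ N r p / u p r

/-- `W` is a (classical) solution for all `r ≥ 0` of the backward parabolic equation
`(H₀ / u) ∂W/∂r = -Δ_r W + 2κ² W` with prescribed value `data` of `e^{-κ r} W` at infinity. -/
structure IsBackwardSolution (κ : ℝ) (F₀ N : S → Mink) (u : S → ℝ → ℝ) (data : S → ℝ)
    (W : S → ℝ → ℝ) : Prop where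
  continuousOn : ContinuousOn (fun q : S × ℝ => W q.1 q.2) (univ ×ˢ Ici 0)
  contMDiffOn : ContMDiffOn ((𝓡 2).prod 𝓘(ℝ, ℝ)) 𝓘(ℝ, ℝ) 2
    (fun q : S × ℝ => W q.1 q.2) (univ ×ˢ Ioi 0)
  equation : ∀ p, ∀ r > 0, meanCurv κ F₀ N r p / u p r * deriv (W p) r =
    -leafLaplacian κ F₀ N r (fun q => W q r) p + 2 * κ ^ 2 * W p r
  limit : TendstoUniformly (fun r p => Real.exp (-(κ * r)) * W p r) data atTop

/-- The map `γ₀ : S → C₀` into the light cone, the limit of `e^{-κ r} κ X(F(p, r))`. -/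
def lightConeMap (κ : ℝ) (F₀ N : S → Mink) (p : S) : Mink :=
  (1 / 2 : ℝ) • (κ • F₀ p + N p)

/-- The mass density `(H₀ - 𝓗) w` on the leaf `Σ_r`, as a function on `S`, where `𝓗 = H₀ / u`. -/
def massDensity (κ : ℝ) (F₀ N : S → Mink) (u w : S → ℝ → ℝ) (r : ℝ) (p : S) : ℝ :=
  (meanCurv κ F₀ N r p - perturbedMeanCurv κ F₀ N u r p) * w p r

/-- The integral of the mass density `(H₀ - 𝓗) w` over the leaf `Σ_r`. -/
def mass [IsManifold (𝓡 2) ∞ S] [T2Space S] [SigmaCompactSpace S] [MeasurableSpace S]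
    (κ : ℝ) (F₀ N : S → Mink) (u w : S → ℝ → ℝ) (r : ℝ) : ℝ :=
  ∫ p, massDensity κ F₀ N u w r p ∂areaMeasure κ F₀ N r

end Foliation

/-- `leafNormal` is the velocity of the normal geodesics. -/
theorem hasDerivAt_leaf {κ : ℝ} (hκ : κ ≠ 0) {S : Type*} (F₀ N : S → Mink) (r : ℝ) (p : S) :
    HasDerivAt (fun s => leaf κ F₀ N s p) (leafNormal κ F₀ N r p) r := by
  have h : HasDerivAt (fun s : ℝ => κ * s) κ r := by simpa using (hasDerivAt_id r).const_mul κ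
  have h1 := (h.cosh.smul_const (F₀ p)).add ((h.sinh.div_const κ).smul_const (N p))
  refine h1.congr_deriv ?_
  rw [leafNormal, mul_div_cancel_right₀ _ hκ, mul_comm (Real.sinh _)]

/-- `lightConeMap` is the limit of the rescaled position vector. -/
theorem tendsto_lightConeMap {κ : ℝ} (hκ : 0 < κ) {S : Type*} (F₀ N : S → Mink) (p : S) :
    Tendsto (fun r => (Real.exp (-(κ * r)) * κ) • leaf κ F₀ N r p) atTop
      (𝓝 (lightConeMap κ F₀ N p)) := by
  have h0 : Tendsto (fun r : ℝ => Real.exp (-(2 * κ * r))) atTop (𝓝 0) := by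
    refine Real.tendsto_exp_neg_atTop_nhds_zero.comp ?_
    exact tendsto_id.const_mul_atTop (by positivity)
  have h1 : Tendsto (fun r : ℝ => ((1 + Real.exp (-(2 * κ * r))) / 2 * κ) • F₀ p +
      ((1 - Real.exp (-(2 * κ * r))) / 2) • N p) atTop
      (𝓝 (((1 + 0) / 2 * κ) • F₀ p + ((1 - 0) / 2 : ℝ) • N p)) :=
    ((((h0.const_add 1).div_const 2).mul_const κ).smul_const _).add
      (((h0.const_sub 1).div_const 2).smul_const _)
  have e : (((1 + 0) / 2 * κ) • F₀ p + ((1 - 0) / 2 : ℝ) • N p) = lightConeMap κ F₀ N p := by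
    simp only [lightConeMap, smul_add, smul_smul, add_zero, sub_zero]
  rw [← e]
  refine h1.congr fun r => ?_
  have e2 : Real.exp (-(2 * κ * r)) = Real.exp (-(κ * r)) * Real.exp (-(κ * r)) := by
    rw [← Real.exp_add]; ring_nf
  have e3 : Real.exp (-(κ * r)) * Real.exp (κ * r) = 1 := by
    rw [← Real.exp_add]; simp
  rw [leaf, smul_add, smul_smul, smul_smul]
  congr 2
  · rw [Real.cosh_eq, e2]; linear_combination (-κ / 2) * e3
  · rw [Real.sinh_eq, e2]; field_simp; linear_combination -e3

/-! ### Killing spinors -/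

/-- The future light-like vector `ζ(a)` of the constant spinor `a ∈ ℂ²`. -/
def zeta (a : Fin 2 → ℂ) : Mink :=
  ![-(‖a 0‖ ^ 2 - ‖a 1‖ ^ 2),
    -(a 0 * star (a 1) + star (a 0) * a 1).re,
    -(Complex.I * (a 0 * star (a 1) - star (a 0) * a 1)).re,
    ‖a 0‖ ^ 2 + ‖a 1‖ ^ 2]

/-- The Killing spinor `φ_{0,a}` of hyperbolic space with constant spinor `a`, as a `ℂ²`-valued
function of the geodesic polar coordinates `(ρ, θ, ψ)`, that is, by its components in the spin
frame over the polar orthonormal frame `e`. The gauge transformation `A` between the hyperbolic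
metric and `u² dr² + g_{ab}(r)` maps `e` to the orthonormal frame `A e` and is the corresponding
fibrewise isometry of spinor bundles, so these are also the components of the transformed spinor in
the spin frame over `A e`, and its pointwise norm for `u² dr² + g_{ab}(r)` is the norm in `ℂ²`. -/
def killingSpinor (κ : ℝ) (a : Fin 2 → ℂ) (ρ θ ψ : ℝ) : Fin 2 → ℂ :=
  Matrix.mulVec
    !![Complex.exp (κ * ρ / 2 + Complex.I * ψ / 2) * Complex.cos (θ / 2),
        Complex.exp (κ * ρ / 2 - Complex.I * ψ / 2) * Complex.sin (θ / 2);
      -(Complex.exp (-(κ * ρ / 2) + Complex.I * ψ / 2) * Complex.sin (θ / 2)),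
        Complex.exp (-(κ * ρ / 2) - Complex.I * ψ / 2) * Complex.cos (θ / 2)] a

/-- The geodesic polar coordinates of hyperbolic space:
`(x₁, x₂, x₃, t) = κ⁻¹ (sinh κρ cos θ, sinh κρ sin θ cos ψ, sinh κρ sin θ sin ψ, cosh κρ)`. -/
def polar (κ ρ θ ψ : ℝ) : Mink :=
  ![Real.sinh (κ * ρ) * Real.cos θ / κ, Real.sinh (κ * ρ) * Real.sin θ * Real.cos ψ / κ,
    Real.sinh (κ * ρ) * Real.sin θ * Real.sin ψ / κ, Real.cosh (κ * ρ) / κ]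

/-- The polar coordinate `ρ` of a point of the hyperboloid (its distance to the origin). -/
def polarRadius (κ : ℝ) (X : Mink) : ℝ :=
  Real.arsinh (κ * √(X 0 ^ 2 + X 1 ^ 2 + X 2 ^ 2)) / κ

/-- The polar coordinate `θ` of a point of the hyperboloid. -/
def polarTheta (X : Mink) : ℝ := Real.arccos (X 0 / √(X 0 ^ 2 + X 1 ^ 2 + X 2 ^ 2))

/-- The polar coordinate `ψ` of a point of the hyperboloid. -/
def polarPsi (X : Mink) : ℝ := Complex.arg ⟨X 1, X 2⟩

/-- `polarRadius`, `polarTheta`, `polarPsi` are polar coordinates. -/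
theorem polar_eq {κ : ℝ} (hκ : 0 < κ) {X : Mink} (hX : X ∈ hyperboloid κ) :
    polar κ (polarRadius κ X) (polarTheta X) (polarPsi X) = X := by
  obtain ⟨h1, h2⟩ := hX
  have hq : lorentz X X = -(1 / κ ^ 2) := h1
  unfold lorentz at hq
  set R := √(X 0 ^ 2 + X 1 ^ 2 + X 2 ^ 2) with hR
  have hR2 : R^2 = X 0 ^ 2 + X 1 ^ 2 + X 2 ^ 2 := Real.sq_sqrt (by positivity)
  have hR0 : 0 ≤ R := Real.sqrt_nonneg _
  have hkr : κ * polarRadius κ X = Real.arsinh (κ * R) := by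
    unfold polarRadius; field_simp; rw [← hR]
  have hc : Real.cosh (κ * polarRadius κ X) = κ * X 3 := by
    rw [hkr, Real.cosh_arsinh]
    rw [Real.sqrt_eq_iff_mul_self_eq (by positivity) (by positivity)]
    have : X 3 ^2 = R^2 + 1/κ^2 := by rw [hR2]; linarith
    have h3 : κ^2 * X 3 ^2 = κ^2 * R^2 + 1 := by rw [this]; field_simp
    linarith
  set n : ℂ := ⟨X 1, X 2⟩
  have hn : ‖n‖^2 = X 1^2 + X 2^2 := by rw [← Complex.normSq_eq_norm_sq, Complex.normSq_apply]; ring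
  have hct : R * Real.cos (polarTheta X) = X 0 := by
    unfold polarTheta; rw [← hR]
    by_cases h : R = 0
    · have : X 0 = 0 := by rw [h] at hR2; nlinarith [sq_nonneg (X 0), sq_nonneg (X 1), sq_nonneg (X 2)]
      simp [h, this]
    · have hp : 0 < R := lt_of_le_of_ne hR0 (Ne.symm h)
      have ha : |X 0| ≤ R := abs_le_of_sq_le_sq (by nlinarith [sq_nonneg (X 1), sq_nonneg (X 2)]) hR0
      rw [Real.cos_arccos]
      · field_simp
      · rw [le_div_iff₀ hp]; linarith [neg_abs_le (X 0)]
      · rw [div_le_iff₀ hp]; linarith [le_abs_self (X 0)]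
  have hst : R * Real.sin (polarTheta X) = ‖n‖ := by
    have hs0 : 0 ≤ Real.sin (polarTheta X) := Real.sin_nonneg_of_mem_Icc ⟨Real.arccos_nonneg _, Real.arccos_le_pi _⟩
    have : (R * Real.sin (polarTheta X))^2 = ‖n‖^2 := by
      rw [hn, mul_pow, Real.sin_sq, mul_sub, ← mul_pow, hct]; linarith
    exact (pow_left_inj₀ (by positivity) (norm_nonneg n) two_ne_zero).1 this
  have hp1 : ‖n‖ * Real.cos (polarPsi X) = X 1 := Complex.norm_mul_cos_arg n
  have hp2 : ‖n‖ * Real.sin (polarPsi X) = X 2 := Complex.norm_mul_sin_arg n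
  have hk : κ ≠ 0 := hκ.ne'
  funext i
  fin_cases i <;> simp only [polar, hkr, Real.sinh_arsinh] <;> simp [mul_assoc]
  · rw [hct]; field_simp
  · rw [← mul_assoc R, hst, hp1]; field_simp
  · rw [← mul_assoc R, hst, hp2]; field_simp
  · rw [hkr, Real.cosh_arsinh] at hc; rw [hc]; field_simp

/-- `|φ_{0,a}|²` at the point `X` of the hyperboloid. It does not depend on the choice of the polar
coordinates of `X`. -/
def killingNormSq (κ : ℝ) (a : Fin 2 → ℂ) (X : Mink) : ℝ :=
  ∑ i, ‖killingSpinor κ a (polarRadius κ X) (polarTheta X) (polarPsi X) i‖ ^ 2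

/-- `|φ_{0,a}|²` along the foliation. -/
def leafKillingNormSq {S : Type*} (κ : ℝ) (F₀ N : S → Mink) (a : Fin 2 → ℂ) (p : S) (r : ℝ) : ℝ :=
  killingNormSq κ a (leaf κ F₀ N r p)

end QuasiLocal

end

open QuasiLocal

/-!
# Monotonicity of a quasi-local mass along a foliation by parallel surfaces

Write `dσ_r = D dσ_0` for the area element of the leaf `Σ_r`. For a surface with mean curvature `H`
and extrinsic curvature `K` in hyperbolic space, `D` is the explicit function `expansion κ H K r`;
its logarithmic derivative is the mean curvature `H₀` of `Σ_r`, and by the Gauss equation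
(`IsParamSurface.scalarCurv_eq`) `D (R^r + 6κ²) = D'' + 2κ² D`. Hence the mass is the integral
`∫ D' (1 - 1/u) W dσ_0` over a fixed surface, where it can be differentiated under the integral. The
equations for `u` and `W` turn the derivative into
`∫ (W Δu - (u - 1) ΔW) dσ_r - ∫ (u - 1)² / (2u) (R^r + 2κ²) W dσ_r`. The first integral vanishes by
Green's identity on the closed surface (`integral_green`), and the second one is nonnegative, since
`R^r + 2κ²` is twice the extrinsic curvature of a convex surface and `W ≥ 0`
(`hasDerivAt_mass`, `antitoneOn_mass`).

Positivity of `W` is a maximum principle backwards in time (`IsBackwardSolution.nonneg`): at a point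
where `W + δ ψ` first vanishes, going backwards from infinity, the equation contradicts the growth
rate of the barrier `ψ = exp (κr + b e^{-2κr})`. The data at infinity are nonnegative because
`|φ_{0,a}|² = -κ ⟨X, ζ(a)⟩` at every point `X` of the hyperboloid (`sum_norm_killingSpinor_sq`), so
that `-⟨γ₀, ζ(a)⟩` is the limit of the nonnegative functions `e^{-κr} |φ_{0,a}|²`.

For the limits, the maximum principle applied to `u - 1` and `u⁻² - 1` gives
`|1 - 1/u| ≤ B e^{-3κr}` (`IsLapse.exists_bound`). As `D'` grows like `e^{2κr}`, the mass with weight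
`w` is bounded by a constant times the supremum of `e^{-κr} |w|` (`IsLapse.exists_abs_mass_le`). So
the monotone function `m_W` is bounded and converges, and as `e^{-κr} (W - |φ_{0,a}|²)` tends to zero
uniformly, the mass of the spinor has the same limit (`exists_tendsto_mass`).

The vector-valued equation reduces to the scalar one: `⟨V, ζ(a)⟩` is a linear combination of the
components of `V` (`IsBackwardSolution.sum`).
-/

namespace QuasiLocal

/-! ### Minkowski algebra and adapted frames -/

theorem lorentz_comm (X Y : Mink) : lorentz X Y = lorentz Y X := by
  simp only [lorentz]; ring

theorem lorentz_add_left (X Y Z : Mink) : lorentz (X + Y) Z = lorentz X Z + lorentz Y Z := by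
  simp only [lorentz, Pi.add_apply]; ring

theorem lorentz_add_right (X Y Z : Mink) : lorentz Z (X + Y) = lorentz Z X + lorentz Z Y := by
  simp only [lorentz, Pi.add_apply]; ring

theorem lorentz_smul_left (c : ℝ) (X Y : Mink) : lorentz (c • X) Y = c * lorentz X Y := by
  simp only [lorentz, Pi.smul_apply, smul_eq_mul]; ring

theorem lorentz_smul_right (c : ℝ) (X Y : Mink) : lorentz X (c • Y) = c * lorentz X Y := by
  simp only [lorentz, Pi.smul_apply, smul_eq_mul]; ring

theorem lorentz_sub_left (X Y Z : Mink) : lorentz (X - Y) Z = lorentz X Z - lorentz Y Z := by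
  simp only [lorentz, Pi.sub_apply]; ring

/-- A nonzero vector tangent to the hyperboloid is spacelike. -/
theorem lorentz_self_pos {κ : ℝ} (hκ : 0 < κ) {X v : Mink} (hX : X ∈ hyperboloid κ)
    (hv : lorentz v X = 0) (h0 : v ≠ 0) : 0 < lorentz v v := by
  obtain ⟨h1, h2⟩ := hX
  have hk : 0 < 1 / κ ^ 2 := by positivity
  simp only [lorentz] at *
  by_contra! hneg
  have hcs : (v 3 * X 3) ^ 2 ≤ (v 0 ^ 2 + v 1 ^ 2 + v 2 ^ 2) * (X 0 ^ 2 + X 1 ^ 2 + X 2 ^ 2) := by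
    have : v 3 * X 3 = v 0 * X 0 + v 1 * X 1 + v 2 * X 2 := by linarith
    rw [this]
    nlinarith [sq_nonneg (v 0 * X 1 - v 1 * X 0), sq_nonneg (v 0 * X 2 - v 2 * X 0),
      sq_nonneg (v 1 * X 2 - v 2 * X 1)]
  set V := v 0 ^ 2 + v 1 ^ 2 + v 2 ^ 2 with hV
  have hX2 : X 0 ^ 2 + X 1 ^ 2 + X 2 ^ 2 = X 3 ^ 2 - 1 / κ ^ 2 := by linarith
  rw [hX2] at hcs
  have hVle : V ≤ v 3 ^ 2 := by rw [hV]; linarith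
  have hV0 : V * (1 / κ ^ 2) ≤ 0 := by nlinarith [mul_nonneg (sub_nonneg.2 hVle) (sq_nonneg (X 3))]
  have hVz : V ≤ 0 := by
    by_contra! h
    linarith [mul_pos h hk]
  have e0 : v 0 = 0 := by nlinarith [sq_nonneg (v 0), sq_nonneg (v 1), sq_nonneg (v 2)]
  have e1 : v 1 = 0 := by nlinarith [sq_nonneg (v 0), sq_nonneg (v 1), sq_nonneg (v 2)]
  have e2 : v 2 = 0 := by nlinarith [sq_nonneg (v 0), sq_nonneg (v 1), sq_nonneg (v 2)]
  have e3 : v 3 = 0 := by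
    have : v 3 * X 3 = 0 := by rw [e0, e1, e2] at hv; linarith
    exact (mul_eq_zero.1 this).resolve_right h2.ne'
  apply h0
  funext i
  fin_cases i <;> simp [e0, e1, e2, e3]

/-- The matrix of Lorentz products of two pairs of vectors. -/
def gramMatrix (E E' : Fin 2 → Mink) : Matrix (Fin 2) (Fin 2) ℝ :=
  Matrix.of fun a b => lorentz (E a) (E' b)

/-- `X` is a point of the hyperboloid, `N` a unit vector tangent to it, and `E` a pair of tangent
vectors that is orthogonal to `N` and has nondegenerate Gram matrix. Together these are a basis of
Minkowski space, adapted to a surface with position `X`, normal `N` and coordinate vectors `E`. -/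
structure IsAdaptedFrame (κ : ℝ) (X N : Mink) (E : Fin 2 → Mink) : Prop where
  pos : 0 < κ
  mem : X ∈ hyperboloid κ
  unit : lorentz N N = 1
  tangent : lorentz N X = 0
  tangent_frame : ∀ a, lorentz (E a) X = 0
  orthogonal : ∀ a, lorentz N (E a) = 0
  det_ne : (gramMatrix E E).det ≠ 0

theorem IsAdaptedFrame.eq_zero {κ : ℝ} {X N : Mink} {E : Fin 2 → Mink}
    (h : IsAdaptedFrame κ X N E) {v : Mink} (hX : lorentz v X = 0) (hN : lorentz v N = 0)
    (hE : ∀ a, lorentz v (E a) = 0) : v = 0 := by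
  by_contra hv
  have hvv := lorentz_self_pos h.pos h.mem hX hv
  -- `X, N, E 0, E 1, v` would be five linearly independent vectors
  have hli : LinearIndependent ℝ ![X, N, E 0, E 1, v] := by
    rw [Fintype.linearIndependent_iff]
    intro g hg
    simp only [Fin.sum_univ_five, Matrix.cons_val] at hg
    have key : ∀ w, g 0 * lorentz X w + g 1 * lorentz N w + g 2 * lorentz (E 0) w
        + g 3 * lorentz (E 1) w + g 4 * lorentz v w = 0 := by
      intro w
      have := congrArg (fun z => lorentz z w) hg
      simp only [lorentz_add_left, lorentz_smul_left] at this
      rw [this]; simp [lorentz]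
    have hXX : lorentz X X = -(1 / κ ^ 2) := h.mem.1
    have hk : 1 / κ ^ 2 ≠ 0 := by have := h.pos; positivity
    have g4 : g 4 = 0 := by
      have := key v
      rw [lorentz_comm X, hX, lorentz_comm N, hN, lorentz_comm (E 0), hE, lorentz_comm (E 1),
        hE] at this
      simpa [hvv.ne'] using this
    have g0 : g 0 = 0 := by
      have := key X
      rw [hXX, h.tangent, h.tangent_frame, h.tangent_frame, hX] at this
      simpa [h.pos.ne'] using this
    have g1 : g 1 = 0 := by
      have := key N
      rw [lorentz_comm X, h.tangent, h.unit, lorentz_comm (E 0), h.orthogonal,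
        lorentz_comm (E 1), h.orthogonal, hN] at this
      simpa using this
    have k2 := key (E 0)
    have k3 := key (E 1)
    simp only [g0, g1, g4, zero_mul, zero_add, add_zero] at k2 k3
    have hd := h.det_ne
    simp only [Matrix.det_fin_two, gramMatrix, Matrix.of_apply] at hd
    have g2 : g 2 = 0 := by
      refine (mul_eq_zero.1 ?_).resolve_right hd
      linear_combination lorentz (E 1) (E 1) * k2 - lorentz (E 1) (E 0) * k3
    have g3 : g 3 = 0 := by
      refine (mul_eq_zero.1 ?_).resolve_right hd
      linear_combination lorentz (E 0) (E 0) * k3 - lorentz (E 0) (E 1) * k2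
    intro i
    fin_cases i <;> assumption
  have := hli.fintype_card_le_finrank
  simp at this

/-- Expansion of a vector in an adapted frame. -/
theorem IsAdaptedFrame.expand {κ : ℝ} {X N : Mink} {E : Fin 2 → Mink}
    (h : IsAdaptedFrame κ X N E) (v : Mink) :
    v = (-(κ ^ 2) * lorentz v X) • X + lorentz v N • N
      + ∑ b, (∑ a, lorentz v (E a) * (gramMatrix E E)⁻¹ a b) • E b := by
  rw [← sub_eq_zero]
  have hXX : lorentz X X = -(1 / κ ^ 2) := h.mem.1
  have hκ := h.pos.ne'
  have hd := h.det_ne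
  have hd' := hd
  simp only [Matrix.det_fin_two, gramMatrix, Matrix.of_apply] at hd'
  refine h.eq_zero ?_ ?_ fun c => ?_
  · simp only [Fin.sum_univ_two, lorentz_sub_left, lorentz_add_left, lorentz_smul_left, hXX,
      h.tangent, h.tangent_frame]
    field_simp; ring
  · simp only [Fin.sum_univ_two, lorentz_sub_left, lorentz_add_left, lorentz_smul_left,
      lorentz_comm X N, h.unit, lorentz_comm (E _) N, h.orthogonal, h.tangent]
    ring
  · simp only [Fin.sum_univ_two, lorentz_sub_left, lorentz_add_left, lorentz_smul_left,
      lorentz_comm X (E _), h.orthogonal, h.tangent_frame, Matrix.inv_def, Matrix.adjugate_fin_two,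
      Matrix.smul_apply, Matrix.det_fin_two, gramMatrix, Ring.inverse_eq_inv', Matrix.of_apply,
      smul_eq_mul, Matrix.cons_val', Matrix.cons_val_zero, Matrix.cons_val_one,
      Matrix.cons_val_fin_one]
    have hi := mul_inv_cancel₀ hd'
    rw [lorentz_comm (E 1) (E 0)] at hi ⊢
    fin_cases c <;> simp only [Fin.zero_eta, Fin.mk_one]
    · rw [lorentz_comm (E 1) (E 0)]
      linear_combination (-lorentz v (E 0)) * hi
    · linear_combination (-lorentz v (E 1)) * hi

theorem IsAdaptedFrame.lorentz_eq {κ : ℝ} {X N : Mink} {E : Fin 2 → Mink}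
    (h : IsAdaptedFrame κ X N E) (v w : Mink) :
    lorentz v w = -(κ ^ 2) * (lorentz v X * lorentz w X) + lorentz v N * lorentz w N
      + ∑ b, ∑ a, lorentz v (E a) * (gramMatrix E E)⁻¹ a b * lorentz w (E b) := by
  conv_lhs => rw [h.expand v]
  simp only [Fin.sum_univ_two, lorentz_add_left, lorentz_smul_left, lorentz_comm w]
  ring

/-! ### Coordinate derivatives -/

section pd
variable {V : Type*} [NormedAddCommGroup V] [NormedSpace ℝ V]

theorem pd_congr {a : Fin 2} {f g : Plane → V} {x : Plane} (h : f =ᶠ[𝓝 x] g) :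
    pd a f x = pd a g x := by
  rw [pd, pd, h.fderiv_eq]

theorem pd_add {a : Fin 2} {f g : Plane → V} {x : Plane} (hf : DifferentiableAt ℝ f x)
    (hg : DifferentiableAt ℝ g x) : pd a (fun y => f y + g y) x = pd a f x + pd a g x := by
  simp only [pd, fderiv_fun_add hf hg, add_apply]

theorem pd_sub {a : Fin 2} {f g : Plane → V} {x : Plane} (hf : DifferentiableAt ℝ f x)
    (hg : DifferentiableAt ℝ g x) : pd a (fun y => f y - g y) x = pd a f x - pd a g x := by
  simp only [pd, fderiv_fun_sub hf hg, sub_apply]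

theorem pd_mul {a : Fin 2} {f g : Plane → ℝ} {x : Plane} (hf : DifferentiableAt ℝ f x)
    (hg : DifferentiableAt ℝ g x) :
    pd a (fun y => f y * g y) x = pd a f x * g x + f x * pd a g x := by
  simp only [pd, fderiv_fun_mul hf hg, add_apply,
    smul_apply, smul_eq_mul]
  ring

theorem pd_const_smul {a : Fin 2} {f : Plane → V} {x : Plane} (c : ℝ)
    (hf : DifferentiableAt ℝ f x) : pd a (fun y => c • f y) x = c • pd a f x := by
  simp only [pd, fderiv_fun_const_smul hf, smul_apply]

theorem pd_sum {ι : Type*} {s : Finset ι} {a : Fin 2} {f : ι → Plane → V} {x : Plane}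
    (hf : ∀ i ∈ s, DifferentiableAt ℝ (f i) x) :
    pd a (fun y => ∑ i ∈ s, f i y) x = ∑ i ∈ s, pd a (f i) x := by
  simp only [pd, fderiv_fun_sum hf, sum_apply]

theorem pd_apply {a : Fin 2} {f : Plane → Mink} {x : Plane} (hf : DifferentiableAt ℝ f x)
    (i : Fin 4) : pd a (fun y => f y i) x = pd a f x i := by
  rw [pd, (hasFDerivAt_pi'.1 hf.hasFDerivAt i).fderiv]
  rfl

theorem pd_lorentz {a : Fin 2} {f g : Plane → Mink} {x : Plane} (hf : DifferentiableAt ℝ f x)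
    (hg : DifferentiableAt ℝ g x) :
    pd a (fun y => lorentz (f y) (g y)) x =
      lorentz (pd a f x) (g x) + lorentz (f x) (pd a g x) := by
  have hf' := fun i => differentiableAt_pi.1 hf i
  have hg' := fun i => differentiableAt_pi.1 hg i
  simp only [lorentz]
  rw [pd_sub (by fun_prop) (by fun_prop), pd_add (by fun_prop) (by fun_prop),
    pd_add (by fun_prop) (by fun_prop), pd_mul (hf' _) (hg' _), pd_mul (hf' _) (hg' _),
    pd_mul (hf' _) (hg' _), pd_mul (hf' _) (hg' _)]
  simp only [pd_apply hf, pd_apply hg]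
  ring

theorem plane_eq_sum (v : Plane) : v = ∑ a, v a • EuclideanSpace.single a (1 : ℝ) := by
  ext i
  fin_cases i <;> simp [Fin.sum_univ_two]

theorem fderiv_eq_sum_pd (f : Plane → V) (x v : Plane) :
    fderiv ℝ f x v = ∑ a, v a • pd a f x := by
  conv_lhs => rw [plane_eq_sum v]
  simp [pd]

/-- The chain rule in coordinates. -/
theorem pd_comp {a : Fin 2} {f : Plane → V} {τ : Plane → Plane} {y : Plane}
    (hf : DifferentiableAt ℝ f (τ y)) (hτ : DifferentiableAt ℝ τ y) :
    pd a (fun z => f (τ z)) y = ∑ b, (pd a τ y) b • pd b f (τ y) := by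
  have : (fun z => f (τ z)) = f ∘ τ := rfl
  rw [pd, this, fderiv_comp y hf hτ, ContinuousLinearMap.comp_apply, fderiv_eq_sum_pd f]
  rfl

theorem contDiffAt_pd {n m : ℕ∞ω} {a : Fin 2} {f : Plane → V} {x : Plane}
    (hf : ContDiffAt ℝ n f x) (h : m + 1 ≤ n) : ContDiffAt ℝ m (pd a f) x :=
  (hf.fderiv_right h).clm_apply contDiffAt_const

theorem contDiffAt_lorentz {n : ℕ∞ω} {f g : Plane → Mink} {x : Plane} (hf : ContDiffAt ℝ n f x)
    (hg : ContDiffAt ℝ n g x) : ContDiffAt ℝ n (fun y => lorentz (f y) (g y)) x := by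
  have hf' := fun i => contDiffAt_pi.1 hf i
  have hg' := fun i => contDiffAt_pi.1 hg i
  simp only [lorentz]
  fun_prop

theorem pd_comm {a b : Fin 2} {f : Plane → V} {x : Plane} (hf : ContDiffAt ℝ 2 f x) :
    pd a (pd b f) x = pd b (pd a f) x := by
  have h1 : DifferentiableAt ℝ (fderiv ℝ f) x :=
    (hf.fderiv_right (m := 1) (by norm_num)).differentiableAt (by norm_num)
  have h2 := hf.isSymmSndFDerivAt (by simp)
  have e : ∀ c d : Fin 2, pd c (pd d f) x =
      fderiv ℝ (fderiv ℝ f) x (EuclideanSpace.single c 1) (EuclideanSpace.single d 1) := by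
    intro c d
    unfold pd
    rw [fderiv_clm_apply h1 (by fun_prop)]
    simp
  rw [e, e, h2]

end pd

/-! ### Parametrized surfaces in hyperbolic space -/

/-- The matrix of Lorentz products of the coordinate vectors of `X` and `Y`. For a surface `X` with
unit normal `N`, `gram X X` is the first and `gram N X` the second fundamental form. -/
noncomputable def gram (X Y : Plane → Mink) (x : Plane) : Matrix (Fin 2) (Fin 2) ℝ :=
  gramMatrix (fun a => pd a X x) (fun b => pd b Y x)

theorem two_le_infty : (2 : ℕ∞ω) ≤ ∞ := by
  have : ((2 : ℕ∞) : ℕ∞ω) ≤ ((⊤ : ℕ∞) : ℕ∞ω) := WithTop.coe_le_coe.2 le_top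
  exact this

theorem gram_apply (X Y : Plane → Mink) (x : Plane) (a b : Fin 2) :
    gram X Y x a b = lorentz (pd a X x) (pd b Y x) := rfl

theorem gramMatrix_sum_smul (E E' : Fin 2 → Mink) (M M' : Matrix (Fin 2) (Fin 2) ℝ) :
    gramMatrix (fun a => ∑ b, M a b • E b) (fun a => ∑ b, M' a b • E' b) =
      M * gramMatrix E E' * M'.transpose := by
  ext a b
  simp only [gramMatrix, Matrix.mul_apply, Fin.sum_univ_two, Matrix.of_apply, lorentz_add_left,
    lorentz_smul_left, lorentz_add_right, lorentz_smul_right, Matrix.transpose_apply]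
  ring

/-- `X : U → ℝ^{3,1}` is a smooth immersed spacelike surface in the hyperboloid, with unit
normal `N` tangent to the hyperboloid. -/
structure IsParamSurface (κ : ℝ) (U : Set Plane) (X N : Plane → Mink) : Prop where
  pos : 0 < κ
  isOpen : IsOpen U
  smooth : ∀ x ∈ U, ContDiffAt ℝ ∞ X x
  normal_smooth : ∀ x ∈ U, ContDiffAt ℝ ∞ N x
  mem : ∀ x ∈ U, X x ∈ hyperboloid κ
  unit : ∀ x ∈ U, lorentz (N x) (N x) = 1
  tangent : ∀ x ∈ U, lorentz (N x) (X x) = 0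
  orthogonal : ∀ x ∈ U, ∀ a, lorentz (N x) (pd a X x) = 0
  det_pos : ∀ x ∈ U, 0 < (gram X X x).det

namespace IsParamSurface

variable {κ : ℝ} {U : Set Plane} {X N : Plane → Mink} (h : IsParamSurface κ U X N) {x : Plane}
include h

theorem diff (hx : x ∈ U) : DifferentiableAt ℝ X x := (h.smooth x hx).differentiableAt (by simp)

theorem normal_diff (hx : x ∈ U) : DifferentiableAt ℝ N x :=
  (h.normal_smooth x hx).differentiableAt (by simp)

theorem smooth_pd (hx : x ∈ U) (a : Fin 2) : ContDiffAt ℝ ∞ (pd a X) x :=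
  contDiffAt_pd (h.smooth x hx) (by simp)

theorem smooth_pd_pd (hx : x ∈ U) (a b : Fin 2) : ContDiffAt ℝ ∞ (pd a (pd b X)) x :=
  contDiffAt_pd (h.smooth_pd hx b) (by simp)

theorem lorentz_pd (hx : x ∈ U) (a : Fin 2) : lorentz (pd a X x) (X x) = 0 := by
  have e : (fun y => lorentz (X y) (X y)) =ᶠ[𝓝 x] fun _ => -(1 / κ ^ 2) := by
    filter_upwards [h.isOpen.mem_nhds hx] with y hy using (h.mem y hy).1
  have := pd_congr (a := a) e
  rw [pd_lorentz (h.diff hx) (h.diff hx), lorentz_comm (X x)] at this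
  simp [pd] at this
  simp only [pd]
  linarith

theorem frame (hx : x ∈ U) : IsAdaptedFrame κ (X x) (N x) fun a => pd a X x where
  pos := h.pos
  mem := h.mem x hx
  unit := h.unit x hx
  tangent := h.tangent x hx
  tangent_frame a := h.lorentz_pd hx a
  orthogonal a := h.orthogonal x hx a
  det_ne := (h.det_pos x hx).ne'

theorem lorentz_pd_normal (hx : x ∈ U) (a : Fin 2) : lorentz (pd a N x) (N x) = 0 := by
  have e : (fun y => lorentz (N y) (N y)) =ᶠ[𝓝 x] fun _ => 1 := by
    filter_upwards [h.isOpen.mem_nhds hx] with y hy using h.unit y hy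
  have := pd_congr (a := a) e
  rw [pd_lorentz (h.normal_diff hx) (h.normal_diff hx), lorentz_comm (N x)] at this
  simp [pd] at this
  simp only [pd]
  linarith

theorem lorentz_pd_normal_pos (hx : x ∈ U) (a : Fin 2) : lorentz (pd a N x) (X x) = 0 := by
  have e : (fun y => lorentz (N y) (X y)) =ᶠ[𝓝 x] fun _ => 0 := by
    filter_upwards [h.isOpen.mem_nhds hx] with y hy using h.tangent y hy
  have := pd_congr (a := a) e
  rw [pd_lorentz (h.normal_diff hx) (h.diff hx), h.orthogonal x hx] at this
  simpa [pd] using this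

/-- The second fundamental form is minus the normal component of the second derivatives. -/
theorem lorentz_pd_pd_normal (hx : x ∈ U) (a b : Fin 2) :
    lorentz (pd a (pd b X) x) (N x) = -gram N X x a b := by
  have e : (fun y => lorentz (N y) (pd b X y)) =ᶠ[𝓝 x] fun _ => 0 := by
    filter_upwards [h.isOpen.mem_nhds hx] with y hy using h.orthogonal y hy b
  have := pd_congr (a := a) e
  rw [pd_lorentz (h.normal_diff hx) ((h.smooth_pd hx b).differentiableAt (by simp))] at this
  rw [lorentz_comm, gram_apply]
  simp [pd] at this ⊢
  linarith

theorem lorentz_pd_pd_pos (hx : x ∈ U) (a b : Fin 2) :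
    lorentz (pd a (pd b X) x) (X x) = -gram X X x a b := by
  have e : (fun y => lorentz (pd b X y) (X y)) =ᶠ[𝓝 x] fun _ => 0 := by
    filter_upwards [h.isOpen.mem_nhds hx] with y hy using h.lorentz_pd hy b
  have := pd_congr (a := a) e
  rw [pd_lorentz ((h.smooth_pd hx b).differentiableAt (by simp)) (h.diff hx)] at this
  rw [gram_apply, lorentz_comm (pd a X x)]
  simp [pd] at this ⊢
  linarith

theorem pd_pd_comm (hx : x ∈ U) (a b : Fin 2) : pd a (pd b X) x = pd b (pd a X) x :=
  pd_comm ((h.smooth x hx).of_le (two_le_infty))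

omit h in
theorem gram_comm (a b : Fin 2) : gram X X x a b = gram X X x b a := lorentz_comm _ _

theorem second_comm (hx : x ∈ U) (a b : Fin 2) : gram N X x a b = gram N X x b a := by
  rw [← neg_inj, ← h.lorentz_pd_pd_normal hx, ← h.lorentz_pd_pd_normal hx, h.pd_pd_comm hx]

theorem gram_contDiffAt (hx : x ∈ U) (a b : Fin 2) :
    ContDiffAt ℝ ∞ (fun y => gram X X y a b) x :=
  contDiffAt_lorentz (h.smooth_pd hx a) (h.smooth_pd hx b)

theorem gram_inv_contDiffAt (hx : x ∈ U) (a b : Fin 2) :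
    ContDiffAt ℝ ∞ (fun y => (gram X X y)⁻¹ a b) x := by
  have h1 := h.gram_contDiffAt hx
  have h2 : ContDiffAt ℝ ∞ (fun y => (gram X X y).det) x := by
    simp only [Matrix.det_fin_two]
    exact ((h1 0 0).mul (h1 1 1)).sub ((h1 0 1).mul (h1 1 0))
  have h3 : ContDiffAt ℝ ∞ (fun y => (gram X X y).det⁻¹) x := h2.inv (h.det_pos x hx).ne'
  simp only [Matrix.inv_def, Matrix.smul_apply, Ring.inverse_eq_inv', smul_eq_mul,
    Matrix.adjugate_fin_two]
  refine h3.mul ?_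
  fin_cases a <;> fin_cases b <;> simp
  · exact h1 1 1
  · exact (h1 0 1).neg
  · exact (h1 1 0).neg
  · exact h1 0 0

/-! ### The Gauss equation -/

theorem pd_gram (hx : x ∈ U) (a b c : Fin 2) : pd c (fun y => gram X X y a b) x =
    lorentz (pd c (pd a X) x) (pd b X x) + lorentz (pd c (pd b X) x) (pd a X x) := by
  have hd := fun a => (h.smooth_pd hx a).differentiableAt (by simp)
  simp only [gram_apply]
  rw [pd_lorentz (hd a) (hd b), lorentz_comm (pd a X x)]

/-- The Christoffel symbols give the tangential part of the second derivatives. -/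
theorem christoffel_eq (hx : x ∈ U) (c a b : Fin 2) : christoffel (gram X X) c a b x =
    ∑ d, (gram X X x)⁻¹ c d * lorentz (pd a (pd b X) x) (pd d X x) := by
  rw [christoffel, Finset.mul_sum]
  refine Finset.sum_congr rfl fun d _ => ?_
  rw [h.pd_gram hx, h.pd_gram hx, h.pd_gram hx, h.pd_pd_comm hx a d, h.pd_pd_comm hx b d,
    h.pd_pd_comm hx b a]
  ring

theorem gram_mul_christoffel (hx : x ∈ U) (e a b : Fin 2) :
    ∑ c, gram X X x e c * christoffel (gram X X) c a b x =
      lorentz (pd a (pd b X) x) (pd e X x) := by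
  have hG : gram X X x * (gram X X x)⁻¹ = 1 :=
    Matrix.mul_nonsing_inv _ (h.det_pos x hx).ne'.isUnit
  have e1 : (gram X X x).mulVec ((gram X X x)⁻¹.mulVec
      fun d => lorentz (pd a (pd b X) x) (pd d X x)) e = lorentz (pd a (pd b X) x) (pd e X x) := by
    rw [Matrix.mulVec_mulVec, hG, Matrix.one_mulVec]
  rw [← e1]
  simp only [h.christoffel_eq hx, Matrix.mulVec, dotProduct]

theorem christoffel_diff (hx : x ∈ U) (c a b : Fin 2) :
    DifferentiableAt ℝ (christoffel (gram X X) c a b) x := by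
  have e : christoffel (gram X X) c a b =ᶠ[𝓝 x]
      fun y => ∑ d, (gram X X y)⁻¹ c d * lorentz (pd a (pd b X) y) (pd d X y) := by
    filter_upwards [h.isOpen.mem_nhds hx] with y hy using h.christoffel_eq hy c a b
  refine DifferentiableAt.congr_of_eventuallyEq ?_ e
  refine ContDiffAt.differentiableAt (n := ∞) (ContDiffAt.sum fun d _ => ?_) (by simp)
  exact (h.gram_inv_contDiffAt hx c d).mul
    (contDiffAt_lorentz (h.smooth_pd_pd hx a b) (h.smooth_pd hx d))

/-- The products of the second derivatives: the components along the surface, the normal and the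
position vector. -/
theorem lorentz_pd_pd_pd_pd (hx : x ∈ U) (a b e f : Fin 2) :
    lorentz (pd a (pd b X) x) (pd f (pd e X) x) =
      -(κ ^ 2) * (gram X X x a b * gram X X x f e) + gram N X x a b * gram N X x f e
      + ∑ c, christoffel (gram X X) c a b x * lorentz (pd f (pd e X) x) (pd c X x) := by
  rw [(h.frame hx).lorentz_eq, h.lorentz_pd_pd_normal hx, h.lorentz_pd_pd_normal hx,
    h.lorentz_pd_pd_pos hx, h.lorentz_pd_pd_pos hx]
  have hs : ∀ c d, (gramMatrix (fun a => pd a X x) (fun a => pd a X x))⁻¹ c d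
      = (gram X X x)⁻¹ d c := by
    intro c d
    have : (gram X X x).transpose = gram X X x := by
      ext i j; exact gram_comm j i
    conv_rhs => rw [← this, ← Matrix.transpose_nonsing_inv, Matrix.transpose_apply]
    rfl
  simp only [h.christoffel_eq hx, Finset.sum_mul, hs]
  congr 1
  · ring
  · refine Finset.sum_congr rfl fun c _ => Finset.sum_congr rfl fun d _ => ?_
    ring

/-- The covariant second derivative of the coordinate vectors, from which the curvature tensor is
obtained by antisymmetrization in the derivatives. -/
theorem pd_christoffel (hx : x ∈ U) (f a b d : Fin 2) :
    pd f (christoffel (gram X X) d a b) x +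
        ∑ c, christoffel (gram X X) d f c x * christoffel (gram X X) c a b x =
      ∑ e, (gram X X x)⁻¹ d e * (lorentz (pd f (pd a (pd b X)) x) (pd e X x)
        - κ ^ 2 * (gram X X x a b * gram X X x f e) + gram N X x a b * gram N X x f e) := by
  have key : ∀ e, ∑ d, gram X X x e d * (pd f (christoffel (gram X X) d a b) x +
        ∑ c, christoffel (gram X X) d f c x * christoffel (gram X X) c a b x) =
      lorentz (pd f (pd a (pd b X)) x) (pd e X x)
        - κ ^ 2 * (gram X X x a b * gram X X x f e) + gram N X x a b * gram N X x f e := by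
    intro e
    have ev : (fun y => ∑ c, gram X X y e c * christoffel (gram X X) c a b y) =ᶠ[𝓝 x]
        fun y => lorentz (pd a (pd b X) y) (pd e X y) := by
      filter_upwards [h.isOpen.mem_nhds hx] with y hy using h.gram_mul_christoffel hy e a b
    have hg := fun c => (h.gram_contDiffAt hx e c).differentiableAt (by simp)
    have hc := fun c => h.christoffel_diff hx c a b
    have E := pd_congr (a := f) ev
    rw [pd_sum (f := fun c y => gram X X y e c * christoffel (gram X X) c a b y)
      fun c _ => (hg c).mul (hc c), pd_lorentz
      ((h.smooth_pd_pd hx a b).differentiableAt (by simp))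
      ((h.smooth_pd hx e).differentiableAt (by simp)), h.lorentz_pd_pd_pd_pd hx] at E
    have G := fun c => h.gram_mul_christoffel hx e f c
    simp only [Fin.sum_univ_two, pd_mul (hg _) (hc _), h.pd_gram hx] at E G ⊢
    linear_combination E + christoffel (gram X X) 0 a b x * G 0 +
      christoffel (gram X X) 1 a b x * G 1
  have hG : (gram X X x)⁻¹ * gram X X x = 1 :=
    Matrix.nonsing_inv_mul _ (h.det_pos x hx).ne'.isUnit
  have e1 : (gram X X x)⁻¹.mulVec ((gram X X x).mulVec
      fun d => pd f (christoffel (gram X X) d a b) x +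
        ∑ c, christoffel (gram X X) d f c x * christoffel (gram X X) c a b x) d =
      pd f (christoffel (gram X X) d a b) x +
        ∑ c, christoffel (gram X X) d f c x * christoffel (gram X X) c a b x := by
    rw [Matrix.mulVec_mulVec, hG, Matrix.one_mulVec]
  rw [← e1]
  simp only [Matrix.mulVec, dotProduct, key]

theorem pd_pd_pd_comm (hx : x ∈ U) (a b c : Fin 2) :
    pd c (pd a (pd b X)) x = pd b (pd a (pd c X)) x := by
  have e1 : pd a (pd b X) =ᶠ[𝓝 x] pd b (pd a X) := by
    filter_upwards [h.isOpen.mem_nhds hx] with y hy using h.pd_pd_comm hy a b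
  have e2 : pd c (pd a X) =ᶠ[𝓝 x] pd a (pd c X) := by
    filter_upwards [h.isOpen.mem_nhds hx] with y hy using h.pd_pd_comm hy c a
  rw [pd_congr e1, pd_comm ((h.smooth_pd hx a).of_le (two_le_infty)), pd_congr e2]

theorem ricci_eq (hx : x ∈ U) (a b : Fin 2) : ricci (gram X X) a b x =
    ∑ c, ∑ e, (gram X X x)⁻¹ c e *
      (-(κ ^ 2) * (gram X X x a b * gram X X x c e - gram X X x a c * gram X X x b e)
        + (gram N X x a b * gram N X x c e - gram N X x a c * gram N X x b e)) := by
  rw [ricci]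
  refine Finset.sum_congr rfl fun c _ => ?_
  have h1 := h.pd_christoffel hx c a b c
  have h2 := h.pd_christoffel hx b a c c
  simp only [h.pd_pd_pd_comm hx a c b] at h2
  rw [Finset.sum_sub_distrib]
  simp only [Fin.sum_univ_two] at h1 h2 ⊢
  linear_combination h1 - h2

/-- **The Gauss equation** (Theorema egregium) for surfaces in hyperbolic space. -/
theorem scalarCurv_eq (hx : x ∈ U) : scalarCurv (gram X X) x =
    -(2 * κ ^ 2) + 2 * ((gram N X x).det / (gram X X x).det) := by
  have hd := (h.det_pos x hx).ne'
  simp only [scalarCurv, h.ricci_eq hx]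
  have c1 := gram_comm (X := X) (x := x) 1 0
  have c2 := h.second_comm hx 1 0
  generalize gram N X x = B at *
  generalize gram X X x = G at *
  simp only [Fin.sum_univ_two, Matrix.inv_def, Matrix.smul_apply, Ring.inverse_eq_inv',
    smul_eq_mul, Matrix.adjugate_fin_two, Matrix.of_apply, Matrix.cons_val', Matrix.cons_val_zero,
    Matrix.cons_val_one, Matrix.cons_val_fin_one]
  rw [Matrix.det_fin_two] at hd
  simp only [Matrix.det_fin_two]
  rw [c1, ← sq] at hd
  rw [c1, c2]
  field_simp
  ring

end IsParamSurface

/-! ### Parallel surfaces -/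

/-- The factor by which the area element grows at distance `r` from a surface with mean
curvature `H` and extrinsic curvature `K` (the sum and the product of the principal curvatures). -/
noncomputable def expansion (κ H K r : ℝ) : ℝ :=
  Real.cosh (κ * r) ^ 2 + Real.cosh (κ * r) * Real.sinh (κ * r) / κ * H
    + Real.sinh (κ * r) ^ 2 / κ ^ 2 * K

/-- The derivative of `expansion` with respect to the distance. -/
noncomputable def expansionDeriv (κ H K r : ℝ) : ℝ :=
  2 * κ * (Real.cosh (κ * r) * Real.sinh (κ * r))
    + (Real.cosh (κ * r) ^ 2 + Real.sinh (κ * r) ^ 2) * H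
    + 2 * (Real.cosh (κ * r) * Real.sinh (κ * r)) / κ * K

/-- The determinant of the map `κ s + c A`, where `A` is the shape operator, `c = cosh κr` and
`s = sinh κr`: the extrinsic curvature of the parallel surface times `expansion`. -/
noncomputable def extrinsicFactor (κ H K r : ℝ) : ℝ :=
  κ ^ 2 * Real.sinh (κ * r) ^ 2 + κ * (Real.cosh (κ * r) * Real.sinh (κ * r)) * H
    + Real.cosh (κ * r) ^ 2 * K

theorem leaf_mem_hyperboloid {κ : ℝ} (hκ : 0 < κ) {S : Type*} {X N : S → Mink} {x : S}
    (h1 : X x ∈ hyperboloid κ) (h2 : lorentz (N x) (N x) = 1) (h3 : lorentz (N x) (X x) = 0)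
    (r : ℝ) : leaf κ X N r x ∈ hyperboloid κ := by
  have hcs := Real.cosh_sq (κ * r)
  have hXX : lorentz (X x) (X x) = -(1 / κ ^ 2) := h1.1
  refine ⟨?_, ?_⟩
  · simp only [leaf, lorentz_add_left, lorentz_add_right, lorentz_smul_left, lorentz_smul_right,
      hXX, h2, h3, lorentz_comm (X x) (N x)]
    field_simp
    linear_combination -hcs
  · -- the time component of the unit normal is smaller than that of the unit timelike vector `κ X`
    have ht : N x 3 ^ 2 < (κ * X x 3) ^ 2 := by
      have ht0 := h1.2
      simp only [lorentz] at hXX h2 h3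
      have hk : κ ^ 2 * (1 / κ ^ 2) = 1 := by field_simp
      have hcs : (N x 3 * X x 3) ^ 2 ≤ (N x 0 ^ 2 + N x 1 ^ 2 + N x 2 ^ 2) *
          (X x 0 ^ 2 + X x 1 ^ 2 + X x 2 ^ 2) := by
        have : N x 3 * X x 3 = N x 0 * X x 0 + N x 1 * X x 1 + N x 2 * X x 2 := by linarith
        rw [this]
        nlinarith [sq_nonneg (N x 0 * X x 1 - N x 1 * X x 0),
          sq_nonneg (N x 0 * X x 2 - N x 2 * X x 0), sq_nonneg (N x 1 * X x 2 - N x 2 * X x 1)]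
      have e1 : N x 0 ^ 2 + N x 1 ^ 2 + N x 2 ^ 2 = 1 + N x 3 ^ 2 := by linarith
      have e2 : X x 0 ^ 2 + X x 1 ^ 2 + X x 2 ^ 2 = X x 3 ^ 2 - 1 / κ ^ 2 := by linarith
      rw [e1, e2] at hcs
      have h4 := mul_le_mul_of_nonneg_left hcs (sq_nonneg κ)
      have e3 : κ ^ 2 * ((1 + N x 3 ^ 2) * (X x 3 ^ 2 - 1 / κ ^ 2)) =
          (1 + N x 3 ^ 2) * (κ ^ 2 * X x 3 ^ 2 - 1) := by
        linear_combination (-(1 + N x 3 ^ 2)) * hk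
      rw [e3] at h4
      nlinarith
    have ha : |N x 3| < κ * X x 3 := abs_lt_of_sq_lt_sq ht (mul_pos hκ h1.2).le
    have hs : |Real.sinh (κ * r)| < Real.cosh (κ * r) :=
      abs_lt_of_sq_lt_sq (by rw [hcs]; linarith) (Real.cosh_pos _).le
    simp only [leaf, Pi.add_apply, Pi.smul_apply, smul_eq_mul]
    have h5 : |Real.sinh (κ * r) * N x 3| ≤ Real.cosh (κ * r) * |N x 3| := by
      rw [abs_mul]; exact mul_le_mul_of_nonneg_right hs.le (abs_nonneg _)
    have h6 : 0 < κ * (Real.cosh (κ * r) * X x 3 + Real.sinh (κ * r) / κ * N x 3) := by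
      have : κ * (Real.cosh (κ * r) * X x 3 + Real.sinh (κ * r) / κ * N x 3) =
          Real.cosh (κ * r) * (κ * X x 3) + Real.sinh (κ * r) * N x 3 := by field_simp
      rw [this]
      have := mul_lt_mul_of_pos_left ha (Real.cosh_pos (κ * r))
      linarith [neg_abs_le (Real.sinh (κ * r) * N x 3)]
    exact (mul_pos_iff_of_pos_left hκ).1 h6

namespace IsParamSurface

variable {κ : ℝ} {U : Set Plane} {X N : Plane → Mink} (h : IsParamSurface κ U X N) {x : Plane}
include h

/-- The Weingarten equation. -/
theorem pd_normal (hx : x ∈ U) (a : Fin 2) :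
    pd a N x = ∑ b, (gram N X x * (gram X X x)⁻¹) a b • pd b X x := by
  rw [(h.frame hx).expand (pd a N x), h.lorentz_pd_normal hx, h.lorentz_pd_normal_pos hx]
  simp only [mul_zero, zero_smul, zero_add, Matrix.mul_apply]
  rfl

theorem pd_leaf (hx : x ∈ U) (r : ℝ) (a : Fin 2) : pd a (leaf κ X N r) x =
    ∑ b, (Real.cosh (κ * r) • (1 : Matrix (Fin 2) (Fin 2) ℝ) +
      (Real.sinh (κ * r) / κ) • (gram N X x * (gram X X x)⁻¹)) a b • pd b X x := by
  have e : leaf κ X N r = fun y => Real.cosh (κ * r) • X y + (Real.sinh (κ * r) / κ) • N y := rfl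
  rw [e, pd_add ((h.diff hx).fun_const_smul _) ((h.normal_diff hx).fun_const_smul _),
    pd_const_smul _ (h.diff hx), pd_const_smul _ (h.normal_diff hx), h.pd_normal hx]
  fin_cases a <;> simp [Fin.sum_univ_two] <;> module

theorem pd_leafNormal (hx : x ∈ U) (r : ℝ) (a : Fin 2) : pd a (leafNormal κ X N r) x =
    ∑ b, ((κ * Real.sinh (κ * r)) • (1 : Matrix (Fin 2) (Fin 2) ℝ) +
      Real.cosh (κ * r) • (gram N X x * (gram X X x)⁻¹)) a b • pd b X x := by
  have e : leafNormal κ X N r =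
    fun y => (κ * Real.sinh (κ * r)) • X y + Real.cosh (κ * r) • N y := rfl
  rw [e, pd_add ((h.diff hx).fun_const_smul _) ((h.normal_diff hx).fun_const_smul _),
    pd_const_smul _ (h.diff hx), pd_const_smul _ (h.normal_diff hx), h.pd_normal hx]
  fin_cases a <;> simp [Fin.sum_univ_two] <;> module

theorem gram_leaf (hx : x ∈ U) (r : ℝ) : gram (leaf κ X N r) (leaf κ X N r) x =
    (Real.cosh (κ * r) • (1 : Matrix (Fin 2) (Fin 2) ℝ) +
      (Real.sinh (κ * r) / κ) • (gram N X x * (gram X X x)⁻¹)) * gram X X x *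
    (Real.cosh (κ * r) • (1 : Matrix (Fin 2) (Fin 2) ℝ) +
      (Real.sinh (κ * r) / κ) • (gram N X x * (gram X X x)⁻¹)).transpose := by
  conv_lhs => rw [gram]
  simp only [h.pd_leaf hx]
  rw [gramMatrix_sum_smul]
  rfl

theorem gram_leafNormal (hx : x ∈ U) (r : ℝ) : gram (leafNormal κ X N r) (leaf κ X N r) x =
    ((κ * Real.sinh (κ * r)) • (1 : Matrix (Fin 2) (Fin 2) ℝ) +
      Real.cosh (κ * r) • (gram N X x * (gram X X x)⁻¹)) * gram X X x *
    (Real.cosh (κ * r) • (1 : Matrix (Fin 2) (Fin 2) ℝ) +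
      (Real.sinh (κ * r) / κ) • (gram N X x * (gram X X x)⁻¹)).transpose := by
  conv_lhs => rw [gram]
  simp only [h.pd_leaf hx, h.pd_leafNormal hx]
  rw [gramMatrix_sum_smul]
  rfl

omit h in
theorem det_smul_one_add_smul (A : Matrix (Fin 2) (Fin 2) ℝ) (s t : ℝ) :
    (s • (1 : Matrix (Fin 2) (Fin 2) ℝ) + t • A).det = s ^ 2 + s * t * A.trace + t ^ 2 * A.det := by
  simp [Matrix.det_fin_two, Matrix.trace_fin_two]
  ring

omit h in
theorem det_shape : (gram N X x * (gram X X x)⁻¹).det =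
    (gram N X x).det / (gram X X x).det := by
  rw [Matrix.det_mul, Matrix.det_nonsing_inv, Ring.inverse_eq_inv', div_eq_mul_inv]

theorem det_gram_leaf (hx : x ∈ U) (r : ℝ) : (gram (leaf κ X N r) (leaf κ X N r) x).det =
    expansion κ (gram N X x * (gram X X x)⁻¹).trace ((gram N X x).det / (gram X X x).det) r ^ 2
      * (gram X X x).det := by
  rw [h.gram_leaf hx, Matrix.det_mul, Matrix.det_mul, Matrix.det_transpose,
    det_smul_one_add_smul, det_shape, expansion]
  ring

theorem det_gram_leafNormal (hx : x ∈ U) (r : ℝ) :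
    (gram (leafNormal κ X N r) (leaf κ X N r) x).det =
    extrinsicFactor κ (gram N X x * (gram X X x)⁻¹).trace
      ((gram N X x).det / (gram X X x).det) r *
    expansion κ (gram N X x * (gram X X x)⁻¹).trace ((gram N X x).det / (gram X X x).det) r
      * (gram X X x).det := by
  rw [h.gram_leafNormal hx, Matrix.det_mul, Matrix.det_mul, Matrix.det_transpose,
    det_smul_one_add_smul, det_smul_one_add_smul, det_shape, expansion, extrinsicFactor]
  ring

/-- A parallel surface is again immersed as long as its area element does not degenerate. -/
theorem leaf {r : ℝ} (hr : ∀ x ∈ U, expansion κ (gram N X x * (gram X X x)⁻¹).trace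
    ((gram N X x).det / (gram X X x).det) r ≠ 0) :
    IsParamSurface κ U (leaf κ X N r) (leafNormal κ X N r) where
  pos := h.pos
  isOpen := h.isOpen
  smooth x hx := ((h.smooth x hx).const_smul _).add ((h.normal_smooth x hx).const_smul _)
  normal_smooth x hx := ((h.smooth x hx).const_smul _).add ((h.normal_smooth x hx).const_smul _)
  mem x hx := leaf_mem_hyperboloid h.pos (h.mem x hx) (h.unit x hx) (h.tangent x hx) r
  unit x hx := by
    have hcs := Real.cosh_sq (κ * r)
    have hXX : lorentz (X x) (X x) = -(1 / κ ^ 2) := (h.mem x hx).1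
    have := h.pos.ne'
    simp only [leafNormal, lorentz_add_left, lorentz_add_right, lorentz_smul_left,
      lorentz_smul_right, hXX, h.unit x hx, h.tangent x hx, lorentz_comm (X x) (N x)]
    field_simp
    linear_combination hcs
  tangent x hx := by
    have hXX : lorentz (X x) (X x) = -(1 / κ ^ 2) := (h.mem x hx).1
    have := h.pos.ne'
    simp only [leafNormal, QuasiLocal.leaf, lorentz_add_left, lorentz_add_right, lorentz_smul_left,
      lorentz_smul_right, hXX, h.unit x hx, h.tangent x hx, lorentz_comm (X x) (N x)]
    field_simp
    ring
  orthogonal x hx a := by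
    rw [h.pd_leaf hx]
    simp only [leafNormal, Fin.sum_univ_two, lorentz_add_left, lorentz_add_right,
      lorentz_smul_left, lorentz_smul_right, lorentz_comm (X x), h.lorentz_pd hx,
      h.orthogonal x hx]
    ring
  det_pos x hx := by
    rw [h.det_gram_leaf hx]
    have := h.det_pos x hx
    have := hr x hx
    positivity

/-- The mean curvature of a parallel surface is the logarithmic derivative of its area element. -/
theorem trace_leaf (hx : x ∈ U) {r : ℝ} (hr : expansion κ (gram N X x * (gram X X x)⁻¹).trace
    ((gram N X x).det / (gram X X x).det) r ≠ 0) :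
    ∑ a, ∑ b, (gram (QuasiLocal.leaf κ X N r) (QuasiLocal.leaf κ X N r) x)⁻¹ a b *
      gram (leafNormal κ X N r) (QuasiLocal.leaf κ X N r) x a b =
    expansionDeriv κ (gram N X x * (gram X X x)⁻¹).trace ((gram N X x).det / (gram X X x).det) r /
    expansion κ (gram N X x * (gram X X x)⁻¹).trace ((gram N X x).det / (gram X X x).det) r := by
  have hκ := h.pos.ne'
  have hG := h.det_pos x hx
  have hsym : (gram X X x).transpose = gram X X x := by ext i j; exact gram_comm j i
  have e1 : ∀ A B : Matrix (Fin 2) (Fin 2) ℝ,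
      ∑ a, ∑ b, A a b * B a b = (A * B.transpose).trace := by
    intro A B
    simp [Matrix.trace_fin_two, Matrix.mul_apply, Fin.sum_univ_two]
  rw [e1, h.gram_leaf hx, h.gram_leafNormal hx]
  have hdet := det_smul_one_add_smul (gram N X x * (gram X X x)⁻¹) (Real.cosh (κ * r))
    (Real.sinh (κ * r) / κ)
  rw [← det_shape] at hr ⊢
  have hexp : expansion κ (gram N X x * (gram X X x)⁻¹).trace
      (gram N X x * (gram X X x)⁻¹).det r = (Real.cosh (κ * r) • (1 : Matrix (Fin 2) (Fin 2) ℝ) +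
      (Real.sinh (κ * r) / κ) • (gram N X x * (gram X X x)⁻¹)).det := by
    rw [hdet, expansion]; ring
  generalize hA : gram N X x * (gram X X x)⁻¹ = A at *
  rw [hexp] at hr ⊢
  set M := Real.cosh (κ * r) • (1 : Matrix (Fin 2) (Fin 2) ℝ) + (Real.sinh (κ * r) / κ) • A with hM
  have e2 : (M * gram X X x * M.transpose)⁻¹ * (((κ * Real.sinh (κ * r)) • 1 +
      Real.cosh (κ * r) • A) * gram X X x * M.transpose).transpose =
      M⁻¹.transpose * ((κ * Real.sinh (κ * r)) • 1 + Real.cosh (κ * r) • A).transpose := by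
    have hMu : IsUnit M.det := hr.isUnit
    have hMu' : IsUnit M.transpose.det := by rwa [Matrix.det_transpose]
    have hGu : IsUnit (gram X X x).det := hG.ne'.isUnit
    rw [Matrix.mul_inv_rev, Matrix.mul_inv_rev, Matrix.transpose_mul, Matrix.transpose_mul, hsym,
      Matrix.transpose_transpose, Matrix.mul_assoc, Matrix.mul_assoc,
      Matrix.nonsing_inv_mul_cancel_left _ _ hMu,
      Matrix.nonsing_inv_mul_cancel_left _ _ hGu, Matrix.transpose_nonsing_inv]
  rw [e2, ← Matrix.transpose_mul, Matrix.trace_transpose, Matrix.inv_def, Ring.inverse_eq_inv',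
    Matrix.mul_smul, Matrix.trace_smul, smul_eq_mul, eq_div_iff hr, mul_comm, ← mul_assoc,
    mul_inv_cancel₀ hr, one_mul, hM]
  simp [expansionDeriv, Matrix.trace_fin_two, Matrix.mul_apply, Fin.sum_univ_two,
    Matrix.adjugate_fin_two, Matrix.det_fin_two]
  field_simp
  ring

end IsParamSurface

/-! ### The Laplace operator -/

/-- The gradient of `f` on the surface `X`, as a vector of Minkowski space. -/
noncomputable def gradVec (X : Plane → Mink) (f : Plane → ℝ) (x : Plane) : Mink :=
  ∑ c, (∑ d, (gram X X x)⁻¹ c d * pd d f x) • pd c X x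

theorem pd_inv {a : Fin 2} {f : Plane → ℝ} {x : Plane} (hf : DifferentiableAt ℝ f x)
    (h0 : f x ≠ 0) : pd a (fun y => (f y)⁻¹) x = -(pd a f x) / f x ^ 2 := by
  have := (hasDerivAt_inv h0).comp_hasFDerivAt x hf.hasFDerivAt
  have e : (fun y => (f y)⁻¹) = Inv.inv ∘ f := rfl
  rw [pd, e, this.fderiv]
  simp [pd]
  ring

theorem pd_sqrt {a : Fin 2} {f : Plane → ℝ} {x : Plane} (hf : DifferentiableAt ℝ f x)
    (h0 : 0 < f x) : pd a (fun y => √(f y)) x = pd a f x / (2 * √(f x)) := by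
  have := (hf.hasFDerivAt.sqrt h0.ne')
  rw [pd, this.fderiv]
  simp [pd]
  ring

namespace IsParamSurface

variable {κ : ℝ} {U : Set Plane} {X N : Plane → Mink} (h : IsParamSurface κ U X N) {x : Plane}
include h

/-- The Laplace operator in terms of the second derivatives and the Christoffel symbols. -/
theorem laplaceBeltrami_eq (hx : x ∈ U) {f : Plane → ℝ} (hf : ContDiffAt ℝ 2 f x) :
    laplaceBeltrami (gram X X) f x = ∑ a, ∑ b, (gram X X x)⁻¹ a b *
      (pd a (pd b f) x - ∑ d, (∑ c, (gram X X x)⁻¹ d c * pd c f x) *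
        lorentz (pd a (pd b X) x) (pd d X x)) := by
  have hfd : ∀ b, DifferentiableAt ℝ (pd b f) x := fun b =>
    (contDiffAt_pd (m := 1) hf (by norm_num)).differentiableAt (by norm_num)
  have hg := fun a b => (h.gram_contDiffAt hx a b).differentiableAt (n := ∞) (by simp)
  have hpos := h.det_pos x hx
  -- the density times the inverse metric is the adjugate divided by the density
  have hcong : ∀ a, (fun y => √(gram X X y).det * ∑ b, (gram X X y)⁻¹ a b * pd b f y) =ᶠ[𝓝 x]
      fun y => (√(gram X X y).det)⁻¹ * ∑ b, (gram X X y).adjugate a b * pd b f y := by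
    intro a
    filter_upwards [h.isOpen.mem_nhds hx] with y hy
    have hp := h.det_pos y hy
    have h1 : √(gram X X y).det * √(gram X X y).det = (gram X X y).det := Real.mul_self_sqrt hp.le
    have h2 : √(gram X X y).det ≠ 0 := (Real.sqrt_pos.2 hp).ne'
    simp only [Matrix.inv_def, Ring.inverse_eq_inv', Matrix.smul_apply, smul_eq_mul,
      Finset.mul_sum]
    refine Finset.sum_congr rfl fun b _ => ?_
    generalize √(gram X X y).det = w at h1 h2
    rw [← h1]
    field_simp
  simp only [laplaceBeltrami, pd_congr (hcong _)]
  have c1 : ∀ y, gram X X y 1 0 = gram X X y 0 1 := fun y => gram_comm 1 0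
  have hdet : (fun y => (gram X X y).det) =
      fun y => gram X X y 0 0 * gram X X y 1 1 - gram X X y 0 1 * gram X X y 0 1 := by
    funext y; rw [Matrix.det_fin_two, c1]
  have hdd : DifferentiableAt ℝ (fun y => (gram X X y).det) x := by
    rw [hdet]; exact ((hg 0 0).mul (hg 1 1)).sub ((hg 0 1).mul (hg 0 1))
  have hs : DifferentiableAt ℝ (fun y => √(gram X X y).det) x := hdd.sqrt hpos.ne'
  have hs0 : √(gram X X x).det ≠ 0 := (Real.sqrt_pos.2 hpos).ne'
  have pdet : ∀ a, pd a (fun y => (gram X X y).det) x = pd a (fun y => gram X X y 0 0) x *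
      gram X X x 1 1 + gram X X x 0 0 * pd a (fun y => gram X X y 1 1) x
      - 2 * gram X X x 0 1 * pd a (fun y => gram X X y 0 1) x := by
    intro a
    rw [hdet, pd_sub ((hg 0 0).fun_mul (hg 1 1)) ((hg 0 1).fun_mul (hg 0 1)),
      pd_mul (hg _ _) (hg _ _),
      pd_mul (hg _ _) (hg _ _)]
    ring
  have hi : DifferentiableAt ℝ (fun y => (√(gram X X y).det)⁻¹) x := hs.inv hs0
  have hsq : √(gram X X x).det ^ 2 = (gram X X x).det := Real.sq_sqrt hpos.le
  simp only [Fin.sum_univ_two, Matrix.adjugate_fin_two, Matrix.of_apply, Matrix.cons_val',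
    Matrix.cons_val_zero, Matrix.cons_val_one, Matrix.cons_val_fin_one, c1, neg_mul]
  rw [pd_mul hi (((hg _ _).fun_mul (hfd _)).fun_add ((hg _ _).fun_mul (hfd _)).fun_neg),
    pd_mul hi (((hg _ _).fun_mul (hfd _)).fun_neg.fun_add ((hg _ _).fun_mul (hfd _)))]
  have n1 : ∀ (a : Fin 2) (g : Plane → ℝ), pd a (fun y => -g y) x = -pd a g x := by
    intro a g; simp [pd]
  rw [pd_add ((hg _ _).fun_mul (hfd _)) ((hg _ _).fun_mul (hfd _)).fun_neg,
    pd_add ((hg _ _).fun_mul (hfd _)).fun_neg ((hg _ _).fun_mul (hfd _)), n1, n1,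
    pd_mul (hg _ _) (hfd _), pd_mul (hg _ _) (hfd _), pd_mul (hg _ _) (hfd _),
    pd_mul (hg _ _) (hfd _), pd_inv hs hs0, pd_inv hs hs0, pd_sqrt hdd hpos, pd_sqrt hdd hpos,
    pdet, pdet]
  simp only [h.pd_gram hx]
  have hsq' : √(gram X X x).det ^ 2 =
      gram X X x 0 0 * gram X X x 1 1 - gram X X x 0 1 * gram X X x 0 1 := by
    rw [hsq, Matrix.det_fin_two, c1]
  rw [h.pd_pd_comm hx 1 0]
  generalize √(gram X X x).det = w at *
  simp only [Matrix.inv_def, Ring.inverse_eq_inv', Matrix.smul_apply, smul_eq_mul,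
    Matrix.adjugate_fin_two, Matrix.of_apply, Matrix.cons_val',
    Matrix.cons_val_zero, Matrix.cons_val_one, Matrix.cons_val_fin_one, c1, ← hsq]
  generalize pd 0 (pd 1 f) x = f01
  generalize pd 1 (pd 0 f) x = f10
  generalize pd 0 (pd 0 f) x = f00
  generalize pd 1 (pd 1 f) x = f11
  generalize pd 1 f x = f1
  generalize pd 0 f x = f0
  generalize pd 0 (pd 1 X) x = X01
  generalize pd 0 (pd 0 X) x = X00
  generalize pd 1 (pd 1 X) x = X11
  generalize pd 1 X x = X1
  generalize pd 0 X x = X0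
  generalize gram X X x 0 0 = g0 at *
  generalize gram X X x 0 1 = g1 at *
  generalize gram X X x 1 1 = g2 at *
  have hw : g0 * g2 = w ^ 2 + g1 ^ 2 := by rw [hsq']; ring
  field_simp
  linear_combination (-2 * lorentz X01 X1 * f0 - 2 * lorentz X01 X0 * f1 +
    2 * lorentz X00 X1 * f1 + 2 * f0 * lorentz X11 X0) * hw

theorem pd_sub_lorentz_gradVec (hx : x ∈ U) {f : Plane → ℝ} (hf : DifferentiableAt ℝ f x)
    (b : Fin 2) (v : Mink) :
    pd b (fun y => f y - lorentz (X y) v) x = pd b f x - lorentz (pd b X x) v := by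
  rw [pd_sub hf ((contDiffAt_lorentz (h.smooth x hx) contDiffAt_const).differentiableAt (by simp)),
    pd_lorentz (h.diff hx) (differentiableAt_const _)]
  simp [pd, lorentz]

/-- The Laplacian of `f` is the trace of the second derivatives of `f - ⟨X, ∇f⟩`, where `∇f` is
frozen at the given point. This function is critical there, so that its second derivatives change
like a tensor under changes of coordinates. -/
theorem laplaceBeltrami_eq_hessian (hx : x ∈ U) {f : Plane → ℝ} (hf : ContDiffAt ℝ 2 f x) :
    laplaceBeltrami (gram X X) f x = ∑ a, ∑ b, (gram X X x)⁻¹ a b *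
      pd a (pd b fun y => f y - lorentz (X y) (gradVec X f x)) x := by
  rw [h.laplaceBeltrami_eq hx hf]
  refine Finset.sum_congr rfl fun a _ => Finset.sum_congr rfl fun b _ => ?_
  set v := gradVec X f x with hv
  have e : (pd b fun y => f y - lorentz (X y) v) =ᶠ[𝓝 x]
      fun y => pd b f y - lorentz (pd b X y) v := by
    filter_upwards [h.isOpen.mem_nhds hx, hf.eventually (by simp)] with y hy hfy
    exact h.pd_sub_lorentz_gradVec hy (hfy.differentiableAt (by simp)) b v
  have hd := (h.smooth_pd hx b).differentiableAt (n := ∞) (by simp)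
  rw [pd_congr e, pd_sub ((contDiffAt_pd (m := 1) hf (by norm_num)).differentiableAt (by simp))
    ((contDiffAt_lorentz (h.smooth_pd hx b) contDiffAt_const).differentiableAt (by simp)),
    pd_lorentz hd (differentiableAt_const _)]
  have e0 : pd a (fun _ : Plane => v) x = 0 := by simp [pd]
  rw [e0, hv, gradVec]
  simp only [Fin.sum_univ_two, lorentz_add_right, lorentz_smul_right]
  simp [lorentz]

theorem pd_sub_lorentz_gradVec_eq_zero (hx : x ∈ U) {f : Plane → ℝ} (hf : ContDiffAt ℝ 2 f x)
    (b : Fin 2) : pd b (fun y => f y - lorentz (X y) (gradVec X f x)) x = 0 := by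
  rw [h.pd_sub_lorentz_gradVec hx (hf.differentiableAt (by simp)), gradVec]
  have hG : gram X X x * (gram X X x)⁻¹ = 1 :=
    Matrix.mul_nonsing_inv _ (h.det_pos x hx).ne'.isUnit
  have e1 : (gram X X x).mulVec ((gram X X x)⁻¹.mulVec fun d => pd d f x) b = pd b f x := by
    rw [Matrix.mulVec_mulVec, hG, Matrix.one_mulVec]
  rw [sub_eq_zero, ← e1]
  simp only [Matrix.mulVec, dotProduct, Fin.sum_univ_two, lorentz_add_right, lorentz_smul_right,
    gram_apply]
  ring

end IsParamSurface

/-! ### Changes of coordinates -/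

/-- The Jacobian matrix of a change of coordinates. -/
noncomputable def jacobian (τ : Plane → Plane) (y : Plane) : Matrix (Fin 2) (Fin 2) ℝ :=
  Matrix.of fun a b => pd a τ y b

theorem pd_of_comp {V : Type*} [NormedAddCommGroup V] [NormedSpace ℝ V] {f f' : Plane → V}
    {τ : Plane → Plane} {y : Plane} (hf : DifferentiableAt ℝ f (τ y)) (hτ : DifferentiableAt ℝ τ y)
    (e : f' =ᶠ[𝓝 y] fun z => f (τ z)) (a : Fin 2) :
    pd a f' y = ∑ b, jacobian τ y a b • pd b f (τ y) := by
  rw [pd_congr e, pd_comp hf hτ]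
  rfl

theorem gram_of_comp {X Y X' Y' : Plane → Mink} {τ : Plane → Plane} {y : Plane}
    (hX : DifferentiableAt ℝ X (τ y)) (hY : DifferentiableAt ℝ Y (τ y))
    (hτ : DifferentiableAt ℝ τ y)
    (eX : X' =ᶠ[𝓝 y] fun z => X (τ z)) (eY : Y' =ᶠ[𝓝 y] fun z => Y (τ z)) :
    gram X' Y' y = jacobian τ y * gram X Y (τ y) * (jacobian τ y).transpose := by
  rw [gram]
  simp only [pd_of_comp hX hτ eX, pd_of_comp hY hτ eY]
  exact gramMatrix_sum_smul _ _ _ _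

/-- The second derivatives of a function at a critical point change like a tensor. -/
theorem pd_pd_comp_of_critical {φ : Plane → ℝ} {τ : Plane → Plane} {y : Plane}
    (hφ : ContDiffAt ℝ 2 φ (τ y)) (hτ : ContDiffAt ℝ 2 τ y) (h0 : ∀ c, pd c φ (τ y) = 0)
    (a b : Fin 2) : pd a (pd b fun z => φ (τ z)) y =
      ∑ c, ∑ d, jacobian τ y b c * jacobian τ y a d * pd d (pd c φ) (τ y) := by
  have e : (pd b fun z => φ (τ z)) =ᶠ[𝓝 y] fun z => ∑ c, (pd b τ z) c * pd c φ (τ z) := by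
    have h1 : ∀ᶠ z in 𝓝 y, ContDiffAt ℝ 2 φ (τ z) :=
      hτ.continuousAt.eventually (hφ.eventually (by simp))
    filter_upwards [hτ.eventually (by simp), h1] with z hz hz'
    exact pd_comp (hz'.differentiableAt (by simp)) (hz.differentiableAt (by simp))
  have d1 : ∀ c, DifferentiableAt ℝ (fun z => (pd b τ z) c) y := fun c => by
    have := (contDiffAt_pd (a := b) (m := 1) hτ (by norm_num)).differentiableAt (by simp)
    exact (differentiableAt_euclidean.1 this) c
  have d2 : ∀ c, DifferentiableAt ℝ (pd c φ) (τ y) := fun c =>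
    (contDiffAt_pd (m := 1) hφ (by norm_num)).differentiableAt (by simp)
  have dτ := hτ.differentiableAt (by simp)
  have d3 : ∀ c, DifferentiableAt ℝ (fun z => pd c φ (τ z)) y := fun c => (d2 c).comp y dτ
  rw [pd_congr e, pd_sum (f := fun c z => (pd b τ z) c * pd c φ (τ z))
    fun c _ => (d1 c).fun_mul (d3 c)]
  refine Finset.sum_congr rfl fun c _ => ?_
  rw [pd_mul (d1 c) (d3 c), h0, mul_zero, zero_add, pd_comp (d2 c) dτ, Finset.mul_sum]
  refine Finset.sum_congr rfl fun d _ => ?_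
  simp only [jacobian, Matrix.of_apply, smul_eq_mul]
  ring

/-- The inverse metric changes contravariantly. -/
theorem transpose_mul_inv_mul {J G G' : Matrix (Fin 2) (Fin 2) ℝ} (hG' : G'.det ≠ 0)
    (e : G' = J * G * J.transpose) : J.transpose * G'⁻¹ * J = G⁻¹ := by
  have hJ : IsUnit J.det := by
    rw [isUnit_iff_ne_zero]; rintro h
    simp [e, h] at hG'
  have hJ' : IsUnit J.transpose.det := by rwa [Matrix.det_transpose]
  rw [e, Matrix.mul_inv_rev, Matrix.mul_inv_rev, ← Matrix.mul_assoc,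
    Matrix.mul_nonsing_inv _ hJ', Matrix.one_mul, Matrix.mul_assoc, Matrix.nonsing_inv_mul _ hJ,
    Matrix.mul_one]

namespace IsParamSurface

variable {κ : ℝ} {U U' : Set Plane} {X N X' N' : Plane → Mink}

/-- The Laplace operator does not depend on the coordinates. -/
theorem laplaceBeltrami_comp (h : IsParamSurface κ U X N) (h' : IsParamSurface κ U' X' N')
    {τ : Plane → Plane} {y : Plane} (hy : y ∈ U') (hτy : τ y ∈ U) (hτ : ContDiffAt ℝ 2 τ y)
    (eX : X' =ᶠ[𝓝 y] fun z => X (τ z)) {f f' : Plane → ℝ} (hf : ContDiffAt ℝ 2 f (τ y))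
    (ef : f' =ᶠ[𝓝 y] fun z => f (τ z)) :
    laplaceBeltrami (gram X' X') f' y = laplaceBeltrami (gram X X) f (τ y) := by
  have dτ := hτ.differentiableAt (by simp)
  have hf' : ContDiffAt ℝ 2 f' y := (hf.comp y hτ).congr_of_eventuallyEq ef
  have hP := transpose_mul_inv_mul (h'.det_pos _ hy).ne'
    (gram_of_comp (h.diff hτy) (h.diff hτy) dτ eX eX)
  have hP' : ∀ c d, ∑ a, ∑ b, jacobian τ y a c * (gram X' X' y)⁻¹ a b * jacobian τ y b d =
      (gram X X (τ y))⁻¹ c d := by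
    intro c d
    rw [← hP]
    simp [Matrix.mul_apply, Fin.sum_univ_two]
    ring
  have hgrad : gradVec X' f' y = gradVec X f (τ y) := by
    simp only [gradVec, pd_of_comp (h.diff hτy) dτ eX,
      pd_of_comp (hf.differentiableAt (by simp)) dτ ef, ← hP', Fin.sum_univ_two]
    module
  rw [h.laplaceBeltrami_eq_hessian hτy hf, h'.laplaceBeltrami_eq_hessian hy hf', hgrad]
  have eφ : ∀ v : Mink, (fun z => f' z - lorentz (X' z) v) =ᶠ[𝓝 y]
      fun z => (fun w => f w - lorentz (X w) v) (τ z) := by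
    intro v
    filter_upwards [eX, ef] with z h1 h2
    rw [h1, h2]
  have epd : ∀ (b : Fin 2) (v : Mink), pd b (fun z => f' z - lorentz (X' z) v) =ᶠ[𝓝 y]
      pd b (fun z => (fun w => f w - lorentz (X w) v) (τ z)) := by
    intro b v
    filter_upwards [(eφ v).eventuallyEq_nhds] with z hz using pd_congr hz
  have hφ : ∀ v : Mink, ContDiffAt ℝ 2 (fun w => f w - lorentz (X w) v) (τ y) := fun v =>
    hf.sub (contDiffAt_lorentz ((h.smooth _ hτy).of_le two_le_infty) contDiffAt_const)
  simp only [pd_congr (epd _ _), pd_pd_comp_of_critical (hφ _) hτ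
    (h.pd_sub_lorentz_gradVec_eq_zero hτy hf), ← hP', Fin.sum_univ_two]
  ring

end IsParamSurface

/-! ### The Laplace operator at an extremum -/

/-- The second derivative of a function of one variable is nonnegative at a local minimum. -/
theorem deriv_deriv_nonneg_of_isLocalMin {g : ℝ → ℝ} {t : ℝ} (hg : ContinuousAt g t)
    (h : IsLocalMin g t) : 0 ≤ deriv (deriv g) t := by
  by_contra! hneg
  have hmax := isLocalMax_of_deriv_deriv_neg hneg h.deriv_eq_zero hg
  have hc : g =ᶠ[𝓝 t] fun _ => g t := by
    filter_upwards [h, hmax] with s h1 h2 using le_antisymm h2 h1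
  have hc' : deriv g =ᶠ[𝓝 t] fun _ => 0 := by
    filter_upwards [hc.eventuallyEq_nhds] with s hs
    rw [hs.deriv_eq]; simp
  rw [hc'.deriv_eq] at hneg
  simp at hneg

theorem hessian_nonneg_of_isLocalMin {f : Plane → ℝ} {x : Plane} (hf : ContDiffAt ℝ 2 f x)
    (h : IsLocalMin f x) (v : Plane) : 0 ≤ ∑ a, ∑ b, v a * v b * pd a (pd b f) x := by
  have hl : ∀ t : ℝ, HasDerivAt (fun s : ℝ => x + s • v) v t := fun t => by
    simpa using ((hasDerivAt_id t).smul_const v).const_add x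
  have hc : ContinuousAt (fun s : ℝ => x + s • v) 0 := (hl 0).continuousAt
  have hx0 : x + (0 : ℝ) • v = x := by simp
  have hmin : IsLocalMin (fun s : ℝ => f (x + s • v)) 0 := by
    have : Tendsto (fun s : ℝ => x + s • v) (𝓝 0) (𝓝 x) := by
      have := hc.tendsto; rwa [hx0] at this
    have := this.eventually h
    filter_upwards [this] with s hs
    simpa using hs
  have hd : deriv (fun s : ℝ => f (x + s • v)) =ᶠ[𝓝 0]
      fun s => ∑ b, v b * pd b f (x + s • v) := by
    have : ∀ᶠ s in 𝓝 (0 : ℝ), ContDiffAt ℝ 2 f (x + s • v) := by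
      refine hc.eventually (p := fun z => ContDiffAt ℝ 2 f z) ?_
      simp only [hx0]; exact hf.eventually (by simp)
    filter_upwards [this] with s hs
    have := ((hs.differentiableAt (by simp)).hasFDerivAt.comp_hasDerivAt s (hl s)).deriv
    rw [show (fun s : ℝ => f (x + s • v)) = f ∘ fun s : ℝ => x + s • v from rfl, this,
      fderiv_eq_sum_pd]
    rfl
  have hd2 : ∀ b, HasDerivAt (fun s : ℝ => pd b f (x + s • v)) (∑ a, v a * pd a (pd b f) x) 0 := by
    intro b
    have d2 := (contDiffAt_pd (a := b) (m := 1) hf (by norm_num)).differentiableAt (by simp)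
    have d2' : HasFDerivAt (pd b f) (fderiv ℝ (pd b f) x) (x + (0 : ℝ) • v) := by
      rw [hx0]; exact d2.hasFDerivAt
    have := d2'.comp_hasDerivAt 0 (hl 0)
    rw [fderiv_eq_sum_pd] at this
    exact this
  have := deriv_deriv_nonneg_of_isLocalMin (g := fun s : ℝ => f (x + s • v)) ?_ hmin
  · rw [hd.deriv_eq, (HasDerivAt.fun_sum fun b _ => (hd2 b).const_mul (v b)).deriv] at this
    simp only [Fin.sum_univ_two] at this ⊢
    linarith
  · refine ContinuousAt.comp (f := fun s : ℝ => x + s • v) ?_ hc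
    simp only [hx0]; exact hf.continuousAt

theorem IsParamSurface.laplaceBeltrami_nonneg_of_isLocalMin {κ : ℝ} {U : Set Plane}
    {X N : Plane → Mink} (h : IsParamSurface κ U X N) {x : Plane} (hx : x ∈ U) {f : Plane → ℝ}
    (hf : ContDiffAt ℝ 2 f x) (hmin : IsLocalMin f x) : 0 ≤ laplaceBeltrami (gram X X) f x := by
  have h0 : ∀ c, pd c f x = 0 := fun c => by simp [pd, hmin.fderiv_eq_zero]
  rw [h.laplaceBeltrami_eq hx hf]
  simp only [h0, mul_zero, Finset.sum_const_zero, zero_mul, sub_zero]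
  have hsym := pd_comm (a := 0) (b := 1) hf
  have hdet := h.det_pos x hx
  -- the metric is positive definite since it has a positive determinant and a positive entry
  have hg : 0 < gram X X x 1 1 := by
    refine lorentz_self_pos h.pos (h.mem x hx) (h.lorentz_pd hx 1) fun hz => ?_
    rw [Matrix.det_fin_two, gram_apply, gram_apply, gram_apply, gram_apply, hz] at hdet
    simp [lorentz] at hdet
  have h1 := hessian_nonneg_of_isLocalMin hf hmin (!₂[gram X X x 1 1, -gram X X x 0 1])
  have h2 := hessian_nonneg_of_isLocalMin hf hmin (!₂[0, 1])
  have c1 := IsParamSurface.gram_comm (X := X) (x := x) 1 0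
  rw [Matrix.det_fin_two] at hdet
  simp only [Matrix.inv_def, Ring.inverse_eq_inv', Matrix.smul_apply, smul_eq_mul,
    Matrix.adjugate_fin_two, Matrix.of_apply, Matrix.cons_val',
    Matrix.cons_val_zero, Matrix.cons_val_one, Matrix.cons_val_fin_one, c1, Fin.sum_univ_two,
    Matrix.det_fin_two] at h1 h2 hdet ⊢
  rw [← hsym] at h1 h2 ⊢
  generalize pd 0 (pd 0 f) x = f00 at *
  generalize pd 0 (pd 1 f) x = f01 at *
  generalize pd 1 (pd 1 f) x = f11 at *
  generalize gram X X x 0 0 = g0 at *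
  generalize gram X X x 0 1 = g1 at *
  generalize gram X X x 1 1 = g2 at *
  have h2' : 0 ≤ f11 := by linarith
  have key : 0 ≤ g2 * (g2 * f00 - 2 * g1 * f01 + g0 * f11) := by
    have := mul_nonneg hdet.le h2'
    nlinarith
  have := nonneg_of_mul_nonneg_right key hg
  have hi : 0 ≤ (g0 * g2 - g1 * g1)⁻¹ := inv_nonneg.2 hdet.le
  have := mul_nonneg hi this
  linarith

/-! ### Convex surfaces in the preferred charts -/

/-- The trace of the shape operator of the surface `X` with normal `N`. -/
noncomputable def shapeTrace (X N : Plane → Mink) (x : Plane) : ℝ :=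
  (gram N X x * (gram X X x)⁻¹).trace

/-- The determinant of the shape operator of the surface `X` with normal `N`. -/
noncomputable def shapeDet (X N : Plane → Mink) (x : Plane) : ℝ :=
  (gram N X x).det / (gram X X x).det

theorem shape_of_comp {κ : ℝ} {U U' : Set Plane} {X N X' N' : Plane → Mink}
    (h : IsParamSurface κ U X N) (h' : IsParamSurface κ U' X' N') {τ : Plane → Plane} {y : Plane}
    (hy : y ∈ U') (hτy : τ y ∈ U) (hτ : DifferentiableAt ℝ τ y)
    (eX : X' =ᶠ[𝓝 y] fun z => X (τ z)) (eN : N' =ᶠ[𝓝 y] fun z => N (τ z)) :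
    shapeTrace X' N' y = shapeTrace X N (τ y) ∧ shapeDet X' N' y = shapeDet X N (τ y) := by
  have e1 := gram_of_comp (h.diff hτy) (h.diff hτy) hτ eX eX
  have e2 := gram_of_comp (h.normal_diff hτy) (h.diff hτy) hτ eN eX
  have hd := (h'.det_pos y hy).ne'
  have hP := transpose_mul_inv_mul hd e1
  have hJ : (jacobian τ y).det ≠ 0 := by
    rintro h0
    simp [e1, h0] at hd
  constructor
  · rw [shapeTrace, shapeTrace, ← hP, e2, Matrix.mul_assoc, Matrix.mul_assoc,
      Matrix.trace_mul_comm]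
    simp only [Matrix.mul_assoc]
  · rw [shapeDet, shapeDet, e1, e2]
    simp only [Matrix.det_mul, Matrix.det_transpose]
    field_simp

theorem IsParamSurface.continuousAt_shape {κ : ℝ} {U : Set Plane} {X N : Plane → Mink}
    (h : IsParamSurface κ U X N) {x : Plane} (hx : x ∈ U) :
    ContinuousAt (shapeTrace X N) x ∧ ContinuousAt (shapeDet X N) x := by
  have h1 := fun a b => (h.gram_contDiffAt hx a b).continuousAt
  have h2 := fun a b => (h.gram_inv_contDiffAt hx a b).continuousAt
  have h3 : ∀ a b, ContinuousAt (fun y => gram N X y a b) x := fun a b =>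
    (contDiffAt_lorentz (contDiffAt_pd (m := ∞) (h.normal_smooth x hx) (by simp))
      (h.smooth_pd hx b)).continuousAt
  have h4 := (h.det_pos x hx).ne'
  constructor
  · unfold shapeTrace
    simp only [Matrix.trace_fin_two, Matrix.mul_apply, Fin.sum_univ_two]
    fun_prop
  · unfold shapeDet
    simp only [Matrix.det_fin_two] at h4 ⊢
    refine ContinuousAt.div ?_ ?_ h4 <;> fun_prop

section Surface

variable {S : Type*} [TopologicalSpace S] [ChartedSpace Plane S] [IsManifold (𝓡 2) ∞ S]
  {κ : ℝ} {F₀ N : S → Mink}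

theorem contDiffAt_comp_chart_symm {V : Type*} [NormedAddCommGroup V] [NormedSpace ℝ V]
    {n : ℕ∞ω} (hn : n ≤ ∞) {f : S → V} (p : S) {x : Plane} (hx : x ∈ (chartAt Plane p).target)
    (hf : ContMDiffAt (𝓡 2) 𝓘(ℝ, V) n f ((chartAt Plane p).symm x)) :
    ContDiffAt ℝ n (f ∘ (chartAt Plane p).symm) x := by
  have h1 : ContMDiffAt (𝓡 2) (𝓡 2) n (chartAt Plane p).symm x :=
    ((contMDiffOn_chart_symm (I := 𝓡 2) (n := ∞) (x := p)).contMDiffAt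
      ((chartAt Plane p).open_target.mem_nhds hx)).of_le hn
  exact contMDiffAt_iff_contDiffAt.1 (hf.comp x h1)

theorem pd_comp_chart_symm {V : Type*} [NormedAddCommGroup V] [NormedSpace ℝ V]
    {f : S → V} (hf : ContMDiff (𝓡 2) 𝓘(ℝ, V) ∞ f) (p : S) {x : Plane}
    (hx : x ∈ (chartAt Plane p).target) (v : Plane) :
    fderiv ℝ (f ∘ (chartAt Plane p).symm) x v =
      mfderiv (𝓡 2) 𝓘(ℝ, V) f ((chartAt Plane p).symm x)
        (mfderiv (𝓡 2) (𝓡 2) (chartAt Plane p).symm x v) := by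
  rw [← mfderiv_eq_fderiv, mfderiv_comp (I' := 𝓡 2) x (hf.mdifferentiableAt (by simp))
    ((mdifferentiable_chart (I := 𝓡 2) p).mdifferentiableAt_symm hx)]
  rfl

/-- In the preferred charts a convex surface is a parametrized surface. -/
theorem IsConvexSurface.isParamSurface (hκ : 0 < κ) (hF : IsConvexSurface κ F₀ N) (p : S) :
    IsParamSurface κ (chartAt Plane p).target (F₀ ∘ (chartAt Plane p).symm)
      (N ∘ (chartAt Plane p).symm) := by
  have horth : ∀ x ∈ (chartAt Plane p).target, ∀ a, lorentz ((N ∘ (chartAt Plane p).symm) x)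
      (pd a (F₀ ∘ (chartAt Plane p).symm) x) = 0 := by
    intro x hx a
    rw [pd, pd_comp_chart_symm hF.smooth p hx]
    exact hF.normal_orthogonal _ _
  have hsm : ∀ x ∈ (chartAt Plane p).target,
      ContDiffAt ℝ ∞ (F₀ ∘ (chartAt Plane p).symm) x := fun x hx =>
    contDiffAt_comp_chart_symm le_rfl p hx hF.smooth.contMDiffAt
  refine ⟨hκ, (chartAt Plane p).open_target, hsm, fun x hx =>
    contDiffAt_comp_chart_symm le_rfl p hx hF.normal_smooth.contMDiffAt,
    fun x _ => hF.mem_hyperboloid _, fun x _ => hF.normal_unit _, fun x _ => hF.normal_tangent _,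
    horth, fun x hx => ?_⟩
  set X := F₀ ∘ (chartAt Plane p).symm with hX
  have hinj : Function.Injective (fderiv ℝ X x) := by
    have h1 := hF.immersion ((chartAt Plane p).symm x)
    have h2 := ((mdifferentiable_chart (I := 𝓡 2) p).symm).mfderiv_injective hx
    intro v w hvw
    rw [hX, pd_comp_chart_symm hF.smooth p hx, pd_comp_chart_symm hF.smooth p hx] at hvw
    exact h2 (h1 hvw)
  have hli : ∀ s t : ℝ, s • pd 0 X x + t • pd 1 X x = 0 → s = 0 ∧ t = 0 := by
    intro s t hst
    have h1 := fderiv_eq_sum_pd X x (!₂[s, t])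
    simp only [Fin.sum_univ_two] at h1
    have h2 : fderiv ℝ X x (!₂[s, t]) = fderiv ℝ X x 0 := by
      rw [h1, map_zero, ← hst]; rfl
    have h3 := hinj h2
    have e0 := congrArg (fun v : Plane => v 0) h3
    have e1 := congrArg (fun v : Plane => v 1) h3
    simpa using And.intro e0 e1
  have htan : ∀ a, lorentz (pd a X x) (X x) = 0 := by
    intro a
    have e : (fun y => lorentz (X y) (X y)) = fun _ => -(1 / κ ^ 2) :=
      funext fun y => (hF.mem_hyperboloid _).1
    have := congrArg (fun g => pd a g x) e
    simp only [pd_lorentz ((hsm x hx).differentiableAt (by simp))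
      ((hsm x hx).differentiableAt (by simp)), lorentz_comm (X x)] at this
    simp [pd] at this
    simp only [pd]
    linarith
  have hmem : X x ∈ hyperboloid κ := hF.mem_hyperboloid _
  have h0 : 0 < lorentz (pd 0 X x) (pd 0 X x) := by
    refine lorentz_self_pos hκ hmem (htan 0) fun hz => ?_
    have := hli 1 0 (by simp [hz])
    simp at this
  -- the component of the second coordinate vector orthogonal to the first one is spacelike
  have h1 : 0 < lorentz (lorentz (pd 0 X x) (pd 0 X x) • pd 1 X x +
      (-lorentz (pd 0 X x) (pd 1 X x)) • pd 0 X x)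
      (lorentz (pd 0 X x) (pd 0 X x) • pd 1 X x +
        (-lorentz (pd 0 X x) (pd 1 X x)) • pd 0 X x) := by
    refine lorentz_self_pos hκ hmem ?_ fun hz => ?_
    · rw [lorentz_add_left, lorentz_smul_left, lorentz_smul_left, htan, htan]; ring
    · rw [add_comm] at hz
      exact h0.ne' (hli _ _ hz).2
  simp only [lorentz_add_left, lorentz_add_right, lorentz_smul_left, lorentz_smul_right,
    lorentz_comm (pd 1 X x) (pd 0 X x)] at h1
  rw [Matrix.det_fin_two, gram_apply, gram_apply, gram_apply, gram_apply,
    lorentz_comm (pd 1 X x) (pd 0 X x)]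
  refine pos_of_mul_pos_right (a := lorentz (pd 0 X x) (pd 0 X x)) ?_ h0.le
  linarith

variable (F₀ N) in
/-- The mean curvature of the initial surface, as a function on `S`. -/
noncomputable def surfaceTrace (p : S) : ℝ :=
  shapeTrace (F₀ ∘ (chartAt Plane p).symm) (N ∘ (chartAt Plane p).symm) (chartAt Plane p p)

variable (F₀ N) in
/-- The extrinsic curvature of the initial surface (the product of its principal curvatures), as a
function on `S`. -/
noncomputable def surfaceDet (p : S) : ℝ :=
  shapeDet (F₀ ∘ (chartAt Plane p).symm) (N ∘ (chartAt Plane p).symm) (chartAt Plane p p)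

variable (S) in
/-- The change of coordinates between two preferred charts is smooth. -/
theorem contDiffAt_chart_transition (p q : S) {x : Plane} (hx : x ∈ (chartAt Plane q).target)
    (hxp : (chartAt Plane q).symm x ∈ (chartAt Plane p).source) :
    ContDiffAt ℝ ∞ (chartAt Plane p ∘ (chartAt Plane q).symm) x := by
  refine contDiffAt_comp_chart_symm le_rfl q hx ?_
  exact (contMDiffOn_chart (I := 𝓡 2) (n := ∞) (x := p)).contMDiffAt
    ((chartAt Plane p).open_source.mem_nhds hxp)

omit [IsManifold (𝓡 2) ∞ S] in
theorem comp_symm_eventuallyEq {V : Type*} (f : S → V) (p q : S) {x : Plane}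
    (hx : x ∈ (chartAt Plane q).target)
    (hxp : (chartAt Plane q).symm x ∈ (chartAt Plane p).source) :
    f ∘ (chartAt Plane q).symm =ᶠ[𝓝 x] fun z => (f ∘ (chartAt Plane p).symm)
      ((chartAt Plane p ∘ (chartAt Plane q).symm) z) := by
  have := ((chartAt Plane q).continuousAt_symm hx).eventually
    ((chartAt Plane p).open_source.mem_nhds hxp)
  filter_upwards [this] with z hz
  simp only [Function.comp_apply]
  rw [(chartAt Plane p).left_inv hz]

theorem surface_shape_eq (hκ : 0 < κ) (hF : IsConvexSurface κ F₀ N) (p : S) {q : S}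
    (hq : q ∈ (chartAt Plane p).source) :
    surfaceTrace F₀ N q = shapeTrace (F₀ ∘ (chartAt Plane p).symm) (N ∘ (chartAt Plane p).symm)
      (chartAt Plane p q) ∧
    surfaceDet F₀ N q = shapeDet (F₀ ∘ (chartAt Plane p).symm) (N ∘ (chartAt Plane p).symm)
      (chartAt Plane p q) := by
  have hx := mem_chart_target Plane q
  have e : (chartAt Plane q).symm (chartAt Plane q q) = q :=
    (chartAt Plane q).left_inv (mem_chart_source Plane q)
  have hxp : (chartAt Plane q).symm (chartAt Plane q q) ∈ (chartAt Plane p).source := by rwa [e]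
  have := shape_of_comp (hF.isParamSurface hκ p) (hF.isParamSurface hκ q) hx
    (τ := chartAt Plane p ∘ (chartAt Plane q).symm)
    ((chartAt Plane p).map_source hxp)
    ((contDiffAt_chart_transition S p q hx hxp).differentiableAt (by simp))
    (comp_symm_eventuallyEq F₀ p q hx hxp) (comp_symm_eventuallyEq N p q hx hxp)
  simpa only [surfaceTrace, surfaceDet, Function.comp_apply, e] using this

theorem continuous_surfaceTrace (hκ : 0 < κ) (hF : IsConvexSurface κ F₀ N) :
    Continuous (surfaceTrace F₀ N) := by
  rw [continuous_iff_continuousAt]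
  intro p
  have h1 := ((hF.isParamSurface hκ p).continuousAt_shape (mem_chart_target Plane p)).1
  refine (h1.comp ((chartAt Plane p).continuousAt (mem_chart_source Plane p))).congr ?_
  filter_upwards [chart_source_mem_nhds Plane p] with q hq
  exact (surface_shape_eq hκ hF p hq).1.symm

theorem continuous_surfaceDet (hκ : 0 < κ) (hF : IsConvexSurface κ F₀ N) :
    Continuous (surfaceDet F₀ N) := by
  rw [continuous_iff_continuousAt]
  intro p
  have h1 := ((hF.isParamSurface hκ p).continuousAt_shape (mem_chart_target Plane p)).2
  refine (h1.comp ((chartAt Plane p).continuousAt (mem_chart_source Plane p))).congr ?_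
  filter_upwards [chart_source_mem_nhds Plane p] with q hq
  exact (surface_shape_eq hκ hF p hq).2.symm

omit [TopologicalSpace S] [ChartedSpace Plane S] [IsManifold (𝓡 2) ∞ S] in
theorem leaf_zero : leaf κ F₀ N 0 = F₀ := by
  funext p; simp [leaf]

omit [TopologicalSpace S] [ChartedSpace Plane S] [IsManifold (𝓡 2) ∞ S] in
theorem leafNormal_zero : leafNormal κ F₀ N 0 = N := by
  funext p; simp [leafNormal]

theorem surfaceDet_pos (hκ : 0 < κ) (hF : IsConvexSurface κ F₀ N) (p : S) :
    0 < surfaceDet F₀ N p := by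
  have h1 := hF.convex p
  have h2 := (hF.isParamSurface hκ p).det_pos _ (mem_chart_target Plane p)
  rw [surfaceDet, shapeDet]
  refine div_pos ?_ h2
  have := h1.det_pos
  simp only [secondForm, leaf_zero, leafNormal_zero] at this
  exact this

theorem surfaceTrace_pos (hκ : 0 < κ) (hF : IsConvexSurface κ F₀ N) (p : S) :
    0 < surfaceTrace F₀ N p := by
  have h1 := hF.convex p
  have hX := hF.isParamSurface hκ p
  have hx := mem_chart_target Plane p
  have h2 := hX.det_pos _ hx
  simp only [secondForm, leaf_zero, leafNormal_zero] at h1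
  change (gram (N ∘ (chartAt Plane p).symm) (F₀ ∘ (chartAt Plane p).symm)
    (chartAt Plane p p)).PosDef at h1
  have hB0 := h1.det_pos
  have hB1 := h1.diag_pos (i := 0)
  have c2 := hX.second_comm hx 1 0
  have c1 := IsParamSurface.gram_comm (X := F₀ ∘ (chartAt Plane p).symm)
    (x := chartAt Plane p p) 1 0
  have hg : 0 < gram (F₀ ∘ (chartAt Plane p).symm) (F₀ ∘ (chartAt Plane p).symm)
      (chartAt Plane p p) 0 0 := by
    refine lorentz_self_pos hκ (hX.mem _ hx) (hX.lorentz_pd hx 0) fun hz => ?_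
    rw [Matrix.det_fin_two, gram_apply, gram_apply, gram_apply, gram_apply, hz] at h2
    simp [lorentz] at h2
  rw [surfaceTrace, shapeTrace]
  rw [Matrix.det_fin_two] at h2 hB0
  simp only [Matrix.inv_def, Ring.inverse_eq_inv', Matrix.smul_apply, smul_eq_mul,
    Matrix.adjugate_fin_two, Matrix.of_apply, Matrix.cons_val',
    Matrix.cons_val_zero, Matrix.cons_val_one, Matrix.cons_val_fin_one, Fin.sum_univ_two,
    Matrix.trace_fin_two, Matrix.mul_apply, Matrix.det_fin_two]
  rw [c1] at h2 ⊢
  rw [c2] at hB0 ⊢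
  generalize gram (F₀ ∘ (chartAt Plane p).symm) (F₀ ∘ (chartAt Plane p).symm)
      (chartAt Plane p p) = G at *
  generalize gram (N ∘ (chartAt Plane p).symm) (F₀ ∘ (chartAt Plane p).symm)
      (chartAt Plane p p) = B at *
  have key : 0 < B 0 0 * (B 0 0 * G 1 1 - 2 * B 0 1 * G 0 1 + B 1 1 * G 0 0) * G 0 0 := by
    have e : B 0 0 * (B 0 0 * G 1 1 - 2 * B 0 1 * G 0 1 + B 1 1 * G 0 0) * G 0 0 =
        (B 0 0 * G 0 1 - B 0 1 * G 0 0) ^ 2 + B 0 0 ^ 2 * (G 0 0 * G 1 1 - G 0 1 * G 0 1)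
        + (B 0 0 * B 1 1 - B 0 1 * B 0 1) * G 0 0 ^ 2 := by ring
    rw [e]; positivity
  have key2 := pos_of_mul_pos_right (pos_of_mul_pos_left key hg.le) hB1.le
  have := mul_pos (inv_pos.2 h2) key2
  linarith

/-- The area element of `Σ_r` relative to that of the initial surface. -/
noncomputable def areaFactor (κ : ℝ) (F₀ N : S → Mink) (r : ℝ) (p : S) : ℝ :=
  expansion κ (surfaceTrace F₀ N p) (surfaceDet F₀ N p) r

theorem expansion_pos {κ H K r : ℝ} (hκ : 0 < κ) (hH : 0 ≤ H) (hK : 0 ≤ K) (hr : 0 ≤ r) :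
    0 < expansion κ H K r := by
  have hs : 0 ≤ Real.sinh (κ * r) := Real.sinh_nonneg_iff.2 (by positivity)
  have hc := Real.cosh_pos (κ * r)
  rw [expansion]; positivity

theorem areaFactor_pos (hκ : 0 < κ) (hF : IsConvexSurface κ F₀ N) {r : ℝ} (hr : 0 ≤ r) (p : S) :
    0 < areaFactor κ F₀ N r p :=
  expansion_pos hκ (surfaceTrace_pos hκ hF p).le (surfaceDet_pos hκ hF p).le hr

theorem continuous_areaFactor (hκ : 0 < κ) (hF : IsConvexSurface κ F₀ N) (r : ℝ) :
    Continuous (areaFactor κ F₀ N r) := by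
  unfold areaFactor expansion
  have := continuous_surfaceTrace hκ hF
  have := continuous_surfaceDet hκ hF
  fun_prop

theorem shapeTrace_chart_eq (hκ : 0 < κ) (hF : IsConvexSurface κ F₀ N) (p : S) {x : Plane}
    (hx : x ∈ (chartAt Plane p).target) :
    shapeTrace (F₀ ∘ (chartAt Plane p).symm) (N ∘ (chartAt Plane p).symm) x =
      surfaceTrace F₀ N ((chartAt Plane p).symm x) ∧
    shapeDet (F₀ ∘ (chartAt Plane p).symm) (N ∘ (chartAt Plane p).symm) x =
      surfaceDet F₀ N ((chartAt Plane p).symm x) := by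
  have := surface_shape_eq hκ hF p ((chartAt Plane p).map_target hx)
  rw [(chartAt Plane p).right_inv hx] at this
  exact ⟨this.1.symm, this.2.symm⟩

theorem expansion_chart_eq (hκ : 0 < κ) (hF : IsConvexSurface κ F₀ N) (p : S) {x : Plane}
    (hx : x ∈ (chartAt Plane p).target) (r : ℝ) :
    expansion κ (gram (N ∘ (chartAt Plane p).symm) (F₀ ∘ (chartAt Plane p).symm) x *
      (gram (F₀ ∘ (chartAt Plane p).symm) (F₀ ∘ (chartAt Plane p).symm) x)⁻¹).trace
      ((gram (N ∘ (chartAt Plane p).symm) (F₀ ∘ (chartAt Plane p).symm) x).det /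
        (gram (F₀ ∘ (chartAt Plane p).symm) (F₀ ∘ (chartAt Plane p).symm) x).det) r =
      areaFactor κ F₀ N r ((chartAt Plane p).symm x) := by
  have := shapeTrace_chart_eq hκ hF p hx
  rw [areaFactor, ← this.1, ← this.2]
  rfl

theorem IsConvexSurface.leaf_isParamSurface (hκ : 0 < κ) (hF : IsConvexSurface κ F₀ N) {r : ℝ}
    (hr : 0 ≤ r) (p : S) :
    IsParamSurface κ (chartAt Plane p).target (leaf κ F₀ N r ∘ (chartAt Plane p).symm)
      (leafNormal κ F₀ N r ∘ (chartAt Plane p).symm) := by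
  refine (hF.isParamSurface hκ p).leaf (r := r) fun x hx => ?_
  rw [expansion_chart_eq hκ hF p hx]
  exact (areaFactor_pos hκ hF hr _).ne'

theorem sqrt_det_metric (hκ : 0 < κ) (hF : IsConvexSurface κ F₀ N) {r : ℝ}
    (hr : 0 ≤ r) (p : S) {x : Plane} (hx : x ∈ (chartAt Plane p).target) :
    √(metric κ F₀ N r p x).det =
      areaFactor κ F₀ N r ((chartAt Plane p).symm x) * √(metric κ F₀ N 0 p x).det := by
  have h1 := (hF.isParamSurface hκ p).det_gram_leaf hx r
  rw [expansion_chart_eq hκ hF p hx] at h1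
  have e0 : metric κ F₀ N 0 p x =
      gram (F₀ ∘ (chartAt Plane p).symm) (F₀ ∘ (chartAt Plane p).symm) x := by
    have : metric κ F₀ N 0 p x = gram (leaf κ F₀ N 0 ∘ (chartAt Plane p).symm)
      (leaf κ F₀ N 0 ∘ (chartAt Plane p).symm) x := rfl
    rw [this, leaf_zero]
  have e1 : metric κ F₀ N r p x = gram (leaf κ (F₀ ∘ (chartAt Plane p).symm)
    (N ∘ (chartAt Plane p).symm) r) (leaf κ (F₀ ∘ (chartAt Plane p).symm)
    (N ∘ (chartAt Plane p).symm) r) x := rfl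
  rw [e0, e1, h1, Real.sqrt_mul (sq_nonneg _), Real.sqrt_sq (areaFactor_pos hκ hF hr _).le]

/-- The mean curvature of the leaves is the logarithmic derivative of the area element. -/
theorem meanCurv_eq (hκ : 0 < κ) (hF : IsConvexSurface κ F₀ N) {r : ℝ} (hr : 0 ≤ r) (p : S) :
    meanCurv κ F₀ N r p = expansionDeriv κ (surfaceTrace F₀ N p) (surfaceDet F₀ N p) r /
      areaFactor κ F₀ N r p :=
  (hF.isParamSurface hκ p).trace_leaf (mem_chart_target Plane p)
    (areaFactor_pos hκ hF hr p).ne'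

/-- The Gauss equation for the leaves. -/
theorem leafScalarCurv_eq (hκ : 0 < κ) (hF : IsConvexSurface κ F₀ N) {r : ℝ} (hr : 0 ≤ r) (p : S) :
    leafScalarCurv κ F₀ N r p = -(2 * κ ^ 2) +
      2 * (extrinsicFactor κ (surfaceTrace F₀ N p) (surfaceDet F₀ N p) r /
        areaFactor κ F₀ N r p) := by
  have hx := mem_chart_target Plane p
  have h := (hF.leaf_isParamSurface hκ hr p).scalarCurv_eq hx
  have hX := hF.isParamSurface hκ p
  have h1 := hX.det_gram_leaf hx r
  have h2 := hX.det_gram_leafNormal hx r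
  have h3 := hX.det_pos _ hx
  have h4 := areaFactor_pos hκ hF hr p
  have e : leafScalarCurv κ F₀ N r p = scalarCurv (gram (leaf κ F₀ N r ∘ (chartAt Plane p).symm)
    (leaf κ F₀ N r ∘ (chartAt Plane p).symm)) (chartAt Plane p p) := rfl
  rw [e, h]
  change -(2 * κ ^ 2) + 2 * ((gram (leafNormal κ (F₀ ∘ (chartAt Plane p).symm)
    (N ∘ (chartAt Plane p).symm) r) (leaf κ (F₀ ∘ (chartAt Plane p).symm)
    (N ∘ (chartAt Plane p).symm) r) (chartAt Plane p p)).det / (gram (leaf κ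
    (F₀ ∘ (chartAt Plane p).symm) (N ∘ (chartAt Plane p).symm) r) (leaf κ
    (F₀ ∘ (chartAt Plane p).symm) (N ∘ (chartAt Plane p).symm) r) (chartAt Plane p p)).det) = _
  rw [h1, h2]
  change -(2 * κ ^ 2) + 2 * (extrinsicFactor κ (surfaceTrace F₀ N p) (surfaceDet F₀ N p) r *
    areaFactor κ F₀ N r p * _ / (areaFactor κ F₀ N r p ^ 2 * _)) = _
  congr 2
  field_simp

/-- The Laplace operator of a leaf can be computed in any of the preferred charts. -/
theorem leafLaplacian_eq (hκ : 0 < κ) (hF : IsConvexSurface κ F₀ N) {r : ℝ} (hr : 0 ≤ r) (p : S)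
    {q : S} (hq : q ∈ (chartAt Plane p).source) {f : S → ℝ}
    (hf : ContMDiffAt (𝓡 2) 𝓘(ℝ, ℝ) 2 f q) :
    leafLaplacian κ F₀ N r f q = laplaceBeltrami (metric κ F₀ N r p)
      (f ∘ (chartAt Plane p).symm) (chartAt Plane p q) := by
  have hx := mem_chart_target Plane q
  have e : (chartAt Plane q).symm (chartAt Plane q q) = q :=
    (chartAt Plane q).left_inv (mem_chart_source Plane q)
  have hxp : (chartAt Plane q).symm (chartAt Plane q q) ∈ (chartAt Plane p).source := by rwa [e]
  have hτ : (chartAt Plane p ∘ (chartAt Plane q).symm) (chartAt Plane q q) = chartAt Plane p q := by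
    rw [Function.comp_apply, e]
  have hfp : ContDiffAt ℝ 2 (f ∘ (chartAt Plane p).symm)
      ((chartAt Plane p ∘ (chartAt Plane q).symm) (chartAt Plane q q)) := by
    rw [hτ]
    refine contDiffAt_comp_chart_symm two_le_infty p ((chartAt Plane p).map_source hq) ?_
    rwa [(chartAt Plane p).left_inv hq]
  have := (hF.leaf_isParamSurface hκ hr p).laplaceBeltrami_comp
    (hF.leaf_isParamSurface hκ hr q) (τ := chartAt Plane p ∘ (chartAt Plane q).symm) hx
    ((chartAt Plane p).map_source hxp)
    ((contDiffAt_chart_transition S p q hx hxp).of_le two_le_infty)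
    (comp_symm_eventuallyEq _ p q hx hxp) hfp (comp_symm_eventuallyEq f p q hx hxp)
  rw [hτ] at this
  exact this

theorem leafLaplacian_nonneg_of_isLocalMin (hκ : 0 < κ) (hF : IsConvexSurface κ F₀ N) {r : ℝ}
    (hr : 0 ≤ r) {p : S} {f : S → ℝ} (hf : ContMDiffAt (𝓡 2) 𝓘(ℝ, ℝ) 2 f p)
    (hmin : IsLocalMin f p) : 0 ≤ leafLaplacian κ F₀ N r f p := by
  have hx := mem_chart_target Plane p
  have e : (chartAt Plane p).symm (chartAt Plane p p) = p :=
    (chartAt Plane p).left_inv (mem_chart_source Plane p)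
  refine (hF.leaf_isParamSurface hκ hr p).laplaceBeltrami_nonneg_of_isLocalMin hx
    (contDiffAt_comp_chart_symm two_le_infty p hx (by rwa [e])) ?_
  have h1 := ((chartAt Plane p).continuousAt_symm hx).tendsto
  rw [e] at h1
  filter_upwards [h1.eventually hmin] with z hz
  simpa only [Function.comp_apply, e] using hz

end Surface

/-! ### The area measure -/

theorem det_fderiv_eq_det_jacobian (τ : Plane → Plane) (y : Plane) :
    (fderiv ℝ τ y).det = (jacobian τ y).det := by
  rw [ContinuousLinearMap.det, ← LinearMap.det_toMatrix (EuclideanSpace.basisFun (Fin 2) ℝ).toBasis,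
    ← Matrix.det_transpose]
  congr 1

section Area

variable {S : Type*} [TopologicalSpace S] [ChartedSpace Plane S] [IsManifold (𝓡 2) ∞ S]
  {κ : ℝ} {F₀ N : S → Mink}

theorem det_metric_pos (hκ : 0 < κ) (hF : IsConvexSurface κ F₀ N) {r : ℝ} (hr : 0 ≤ r) (p : S)
    {x : Plane} (hx : x ∈ (chartAt Plane p).target) : 0 < (metric κ F₀ N r p x).det :=
  (hF.leaf_isParamSurface hκ hr p).det_pos x hx

theorem contDiffAt_sqrt_det_metric (hκ : 0 < κ) (hF : IsConvexSurface κ F₀ N) {r : ℝ} (hr : 0 ≤ r)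
    (p : S) {x : Plane} (hx : x ∈ (chartAt Plane p).target) :
    ContDiffAt ℝ ∞ (fun y => √(metric κ F₀ N r p y).det) x := by
  have h1 := (hF.leaf_isParamSurface hκ hr p).gram_contDiffAt hx
  refine ContDiffAt.sqrt ?_ (det_metric_pos hκ hF hr p hx).ne'
  simp only [Matrix.det_fin_two]
  exact ((h1 0 0).mul (h1 1 1)).sub ((h1 0 1).mul (h1 1 0))

theorem continuousOn_sqrt_det_metric (hκ : 0 < κ) (hF : IsConvexSurface κ F₀ N) {r : ℝ}
    (hr : 0 ≤ r) (p : S) :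
    ContinuousOn (fun y => √(metric κ F₀ N r p y).det) (chartAt Plane p).target := fun _ hx =>
  (contDiffAt_sqrt_det_metric hκ hF hr p hx).continuousAt.continuousWithinAt

theorem aemeasurable_sqrt_det_metric (hκ : 0 < κ) (hF : IsConvexSurface κ F₀ N) {r : ℝ}
    (hr : 0 ≤ r) (p : S) :
    AEMeasurable (fun x => ENNReal.ofReal √(metric κ F₀ N r p x).det)
      ((volume : Measure Plane).restrict (chartAt Plane p).target) :=
  ((continuousOn_sqrt_det_metric hκ hF hr p).aemeasurable
    (chartAt Plane p).open_target.measurableSet).ennreal_ofReal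

variable [MeasurableSpace S] [BorelSpace S]

omit [IsManifold (𝓡 2) ∞ S] in
theorem aemeasurable_chart_symm (p : S) : AEMeasurable (chartAt Plane p).symm
    ((volume : Measure Plane).restrict (chartAt Plane p).target) :=
  (chartAt Plane p).continuousOn_symm.aemeasurable (chartAt Plane p).open_target.measurableSet

theorem lintegral_chartArea (hκ : 0 < κ) (hF : IsConvexSurface κ F₀ N) {r : ℝ} (hr : 0 ≤ r) (p : S)
    {g : S → ENNReal} (hg : Measurable g) :
    ∫⁻ q, g q ∂chartArea κ F₀ N r p = ∫⁻ x in (chartAt Plane p).target,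
      ENNReal.ofReal √(metric κ F₀ N r p x).det * g ((chartAt Plane p).symm x) := by
  rw [chartArea, lintegral_map' hg.aemeasurable
    ((aemeasurable_chart_symm p).mono_ac (withDensity_absolutelyContinuous _ _)),
    lintegral_withDensity_eq_lintegral_mul₀ (aemeasurable_sqrt_det_metric hκ hF hr p)
      (g := fun x => g ((chartAt Plane p).symm x))
      (hg.comp_aemeasurable (aemeasurable_chart_symm p))]
  rfl

omit [MeasurableSpace S] [BorelSpace S] in
/-- The coordinate area elements agree on overlaps. -/
theorem lintegral_overlap (hκ : 0 < κ) (hF : IsConvexSurface κ F₀ N) {r : ℝ} (hr : 0 ≤ r) (p q : S)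
    (g : S → ENNReal) :
    ∫⁻ x in (chartAt Plane p).target ∩ (chartAt Plane p).symm ⁻¹' (chartAt Plane q).source,
      ENNReal.ofReal √(metric κ F₀ N r p x).det * g ((chartAt Plane p).symm x) =
    ∫⁻ x in (chartAt Plane q).target ∩ (chartAt Plane q).symm ⁻¹' (chartAt Plane p).source,
      ENNReal.ofReal √(metric κ F₀ N r q x).det * g ((chartAt Plane q).symm x) := by
  set e := (chartAt Plane q).symm.trans (chartAt Plane p) with he
  have hs : e.source = (chartAt Plane q).target ∩
      (chartAt Plane q).symm ⁻¹' (chartAt Plane p).source := by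
    simp [he]
  have ht : e.target = (chartAt Plane p).target ∩
      (chartAt Plane p).symm ⁻¹' (chartAt Plane q).source := by
    simp [he]
  rw [← hs, ← ht, ← e.image_source_eq_target]
  have hfd : ∀ x ∈ e.source, ContDiffAt ℝ ∞ e x := fun x hx => by
    rw [hs] at hx
    exact contDiffAt_chart_transition S p q hx.1 hx.2
  rw [lintegral_image_eq_lintegral_abs_det_fderiv_mul volume e.open_source.measurableSet
    (fun x hx => ((hfd x hx).differentiableAt (by simp)).hasFDerivAt.hasFDerivWithinAt) e.injOn]
  refine setLIntegral_congr_fun e.open_source.measurableSet fun x hx => ?_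
  have hx' := hx
  rw [hs] at hx'
  have hex : e x ∈ (chartAt Plane p).target := (chartAt Plane p).map_source hx'.2
  have hsymm : (chartAt Plane p).symm (e x) = (chartAt Plane q).symm x :=
    (chartAt Plane p).left_inv hx'.2
  have h := hF.leaf_isParamSurface hκ hr p
  have hG := gram_of_comp (h.diff hex) (h.diff hex) ((hfd x hx).differentiableAt (by simp))
    (comp_symm_eventuallyEq (leaf κ F₀ N r) p q hx'.1 hx'.2)
    (comp_symm_eventuallyEq (leaf κ F₀ N r) p q hx'.1 hx'.2)
  have hdet : (metric κ F₀ N r q x).det =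
      (jacobian e x).det ^ 2 * (metric κ F₀ N r p (e x)).det := by
    change (gram _ _ x).det = _
    rw [hG, Matrix.det_mul, Matrix.det_mul, Matrix.det_transpose]
    change _ = _ * (gram _ _ (e x)).det
    ring
  rw [hsymm, det_fderiv_eq_det_jacobian, ← mul_assoc, ← ENNReal.ofReal_mul (abs_nonneg _), hdet,
    Real.sqrt_mul (sq_nonneg _), Real.sqrt_sq_eq_abs]

variable [T2Space S] [CompactSpace S]

omit [MeasurableSpace S] [BorelSpace S] in
variable (S) in
theorem exists_finset_chartPartition :
    ∃ T : Finset S, ∀ p ∉ T, ∀ q, chartPartition S p q = 0 := by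
  have := (chartPartition S).locallyFinite.finite_nonempty_of_compact
  refine ⟨this.toFinset, fun p hp q => ?_⟩
  by_contra h
  exact hp (this.mem_toFinset.2 ⟨q, h⟩)

omit [MeasurableSpace S] [BorelSpace S] in
variable (S) in
theorem exists_finset_sum_chartPartition :
    ∃ T : Finset S, (∀ p ∉ T, ∀ q, chartPartition S p q = 0) ∧
      ∀ q, ∑ p ∈ T, chartPartition S p q = 1 := by
  obtain ⟨T, hT⟩ := exists_finset_chartPartition S
  refine ⟨T, hT, fun q => ?_⟩
  rw [← (chartPartition S).sum_eq_one (mem_univ q), finsum_eq_sum_of_support_subset]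
  intro p hp
  by_contra h
  exact hp (hT p h q)

theorem measurable_chartPartition (p : S) :
    Measurable fun q => ENNReal.ofReal (chartPartition S p q) :=
  ((chartPartition S p).2.continuous.measurable).ennreal_ofReal

omit [MeasurableSpace S] [BorelSpace S] in
theorem chartPartition_eq_zero {p q : S} (hq : q ∉ (chartAt Plane p).source) :
    chartPartition S p q = 0 := by
  by_contra h
  exact hq (chartPartition_isSubordinate S p (subset_tsupport _ h))

theorem lintegral_areaMeasure (hκ : 0 < κ) (hF : IsConvexSurface κ F₀ N) {r : ℝ} (hr : 0 ≤ r)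
    {g : S → ENNReal} (hg : Measurable g) :
    ∫⁻ q, g q ∂areaMeasure κ F₀ N r = ∑' p : S, ∫⁻ x in (chartAt Plane p).target,
      ENNReal.ofReal √(metric κ F₀ N r p x).det *
        (ENNReal.ofReal (chartPartition S p ((chartAt Plane p).symm x)) *
          g ((chartAt Plane p).symm x)) := by
  rw [areaMeasure, lintegral_sum_measure]
  refine tsum_congr fun p => ?_
  rw [lintegral_withDensity_eq_lintegral_mul _ (measurable_chartPartition p) hg,
    lintegral_chartArea hκ hF hr p ((measurable_chartPartition p).mul hg)]
  rfl

/-- On the domain of a chart the area measure is the coordinate area measure. -/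
theorem areaMeasure_restrict (hκ : 0 < κ) (hF : IsConvexSurface κ F₀ N) {r : ℝ} (hr : 0 ≤ r)
    (q : S) :
    (areaMeasure κ F₀ N r).restrict (chartAt Plane q).source = chartArea κ F₀ N r q := by
  refine Measure.ext_of_lintegral _ fun g hg => ?_
  have hsq := (chartAt Plane q).open_source.measurableSet
  obtain ⟨T, hT, hT1⟩ := exists_finset_sum_chartPartition S
  rw [← lintegral_indicator hsq, lintegral_areaMeasure hκ hF hr (hg.indicator hsq)]
  have hm : ∀ p, Measurable fun s => ENNReal.ofReal (chartPartition S p s) * g s := fun p =>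
    (measurable_chartPartition p).mul hg
  have key : ∀ p, ∫⁻ x in (chartAt Plane p).target, ENNReal.ofReal √(metric κ F₀ N r p x).det *
        (ENNReal.ofReal (chartPartition S p ((chartAt Plane p).symm x)) *
          (chartAt Plane q).source.indicator g ((chartAt Plane p).symm x)) =
      ∫⁻ s, ENNReal.ofReal (chartPartition S p s) * g s ∂chartArea κ F₀ N r q := by
    intro p
    rw [lintegral_chartArea hκ hF hr q (hm p)]
    have h1 := lintegral_overlap hκ hF hr p q
      (fun s => ENNReal.ofReal (chartPartition S p s) * g s)
    have mp := ((chartAt Plane p).isOpen_inter_preimage_symm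
      (chartAt Plane q).open_source).measurableSet
    have mq := ((chartAt Plane q).isOpen_inter_preimage_symm
      (chartAt Plane p).open_source).measurableSet
    have e1 : ∀ x ∈ (chartAt Plane p).target,
        ENNReal.ofReal √(metric κ F₀ N r p x).det *
        (ENNReal.ofReal (chartPartition S p ((chartAt Plane p).symm x)) *
          (chartAt Plane q).source.indicator g ((chartAt Plane p).symm x)) =
        ((chartAt Plane p).symm ⁻¹' (chartAt Plane q).source).indicator (fun x =>
          ENNReal.ofReal √(metric κ F₀ N r p x).det *
        (ENNReal.ofReal (chartPartition S p ((chartAt Plane p).symm x)) *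
          g ((chartAt Plane p).symm x))) x := by
      intro x _
      by_cases hx : (chartAt Plane p).symm x ∈ (chartAt Plane q).source
      · rw [indicator_of_mem hx, indicator_of_mem (by exact hx)]
      · rw [indicator_of_notMem hx, indicator_of_notMem (by exact hx)]; simp
    have e2 : ∀ x ∈ (chartAt Plane q).target,
        ENNReal.ofReal √(metric κ F₀ N r q x).det *
        (ENNReal.ofReal (chartPartition S p ((chartAt Plane q).symm x)) *
          g ((chartAt Plane q).symm x)) =
        ((chartAt Plane q).symm ⁻¹' (chartAt Plane p).source).indicator (fun x =>
          ENNReal.ofReal √(metric κ F₀ N r q x).det *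
        (ENNReal.ofReal (chartPartition S p ((chartAt Plane q).symm x)) *
          g ((chartAt Plane q).symm x))) x := by
      intro x _
      by_cases hx : (chartAt Plane q).symm x ∈ (chartAt Plane p).source
      · rw [indicator_of_mem (by exact hx)]
      · rw [indicator_of_notMem (by exact hx), chartPartition_eq_zero hx]; simp
    have restr : ∀ {A B : Set Plane} (_ : MeasurableSet A) (_ : MeasurableSet (A ∩ B))
        (f : Plane → ENNReal), ∫⁻ x in A, B.indicator f x = ∫⁻ x in A ∩ B, f x := by
      intro A B hA hAB f
      rw [← lintegral_indicator hA, ← lintegral_indicator hAB]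
      congr 1; funext x
      rw [indicator_indicator]
    rw [setLIntegral_congr_fun (chartAt Plane p).open_target.measurableSet e1,
      restr (chartAt Plane p).open_target.measurableSet mp, h1]
    rw [← restr (chartAt Plane q).open_target.measurableSet mq]
    exact (setLIntegral_congr_fun (chartAt Plane q).open_target.measurableSet e2).symm
  simp only [key]
  rw [tsum_eq_sum (s := T), ← lintegral_finsetSum _ fun p _ => hm p]
  · refine lintegral_congr fun s => ?_
    rw [← Finset.sum_mul, ← ENNReal.ofReal_sum_of_nonneg
      fun p _ => (chartPartition S).nonneg p s, hT1, ENNReal.ofReal_one, one_mul]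
  · intro p hp
    simp [hT p hp]

/-- The area measure of a leaf has the density `areaFactor` relative to the initial surface. -/
theorem areaMeasure_eq_withDensity (hκ : 0 < κ) (hF : IsConvexSurface κ F₀ N) {r : ℝ}
    (hr : 0 ≤ r) : areaMeasure κ F₀ N r =
      (areaMeasure κ F₀ N 0).withDensity fun q => ENNReal.ofReal (areaFactor κ F₀ N r q) := by
  refine Measure.ext_of_lintegral _ fun g hg => ?_
  have hm : Measurable fun q => ENNReal.ofReal (areaFactor κ F₀ N r q) :=
    (continuous_areaFactor hκ hF r).measurable.ennreal_ofReal
  rw [lintegral_withDensity_eq_lintegral_mul _ hm hg, lintegral_areaMeasure hκ hF hr hg,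
    lintegral_areaMeasure hκ hF le_rfl (hm.mul hg)]
  refine tsum_congr fun p => setLIntegral_congr_fun (chartAt Plane p).open_target.measurableSet
    fun x hx => ?_
  simp only [Pi.mul_apply]
  rw [sqrt_det_metric hκ hF hr p hx, ENNReal.ofReal_mul (areaFactor_pos hκ hF hr _).le]
  ring

theorem isFiniteMeasure_areaMeasure_zero (hκ : 0 < κ) (hF : IsConvexSurface κ F₀ N) :
    IsFiniteMeasure (areaMeasure κ F₀ N 0) := by
  constructor
  obtain ⟨T, hT⟩ := exists_finset_chartPartition S
  rw [← lintegral_one, lintegral_areaMeasure (g := fun _ => 1) hκ hF le_rfl measurable_const,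
    tsum_eq_sum (s := T)]
  swap
  · intro p hp
    simp [hT p hp]
  refine ENNReal.sum_lt_top.2 fun p _ => ?_
  -- the chart image of the support of the partition function is compact
  set K := chartAt Plane p '' tsupport (chartPartition S p) with hK
  have hsub : tsupport (chartPartition S p) ⊆ (chartAt Plane p).source :=
    chartPartition_isSubordinate S p
  have hKc : IsCompact K := (isClosed_tsupport _).isCompact.image_of_continuousOn
    ((chartAt Plane p).continuousOn.mono hsub)
  have hKt : K ⊆ (chartAt Plane p).target := by
    rintro _ ⟨q, hq, rfl⟩
    exact (chartAt Plane p).map_source (hsub hq)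
  calc ∫⁻ x in (chartAt Plane p).target, ENNReal.ofReal √(metric κ F₀ N 0 p x).det *
        (ENNReal.ofReal (chartPartition S p ((chartAt Plane p).symm x)) * 1)
      ≤ ∫⁻ x in (chartAt Plane p).target,
        K.indicator (fun x => ENNReal.ofReal √(metric κ F₀ N 0 p x).det) x := by
        refine setLIntegral_mono' (chartAt Plane p).open_target.measurableSet fun x hx => ?_
        by_cases hxK : x ∈ K
        · rw [indicator_of_mem hxK, mul_one]
          refine mul_le_of_le_one_right zero_le ?_
          rw [ENNReal.ofReal_le_one]
          exact (chartPartition S).le_one p _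
        · have : chartPartition S p ((chartAt Plane p).symm x) = 0 := by
            by_contra h
            exact hxK ⟨_, subset_tsupport _ h, (chartAt Plane p).right_inv hx⟩
          simp [this]
    _ ≤ ∫⁻ x, K.indicator (fun x => ENNReal.ofReal √(metric κ F₀ N 0 p x).det) x :=
        setLIntegral_le_lintegral _ _
    _ = ∫⁻ x in K, ENNReal.ofReal √(metric κ F₀ N 0 p x).det :=
        lintegral_indicator hKc.measurableSet _
    _ < ⊤ := by
        have := ((continuousOn_sqrt_det_metric hκ hF le_rfl p).mono hKt).integrableOn_compact
          (μ := volume) hKc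
        refine lt_of_le_of_lt (lintegral_mono fun x => ?_) this.2
        rw [← ofReal_norm]
        exact ENNReal.ofReal_le_ofReal (le_abs_self _)

theorem isFiniteMeasure_areaMeasure (hκ : 0 < κ) (hF : IsConvexSurface κ F₀ N) {r : ℝ}
    (hr : 0 ≤ r) : IsFiniteMeasure (areaMeasure κ F₀ N r) := by
  have := isFiniteMeasure_areaMeasure_zero hκ hF
  rw [areaMeasure_eq_withDensity hκ hF hr]
  refine isFiniteMeasure_withDensity_ofReal ?_
  exact ((continuous_areaFactor hκ hF r).integrable_of_hasCompactSupport
    (HasCompactSupport.of_compactSpace _)).2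

theorem integral_areaMeasure (hκ : 0 < κ) (hF : IsConvexSurface κ F₀ N) {r : ℝ} (hr : 0 ≤ r)
    (g : S → ℝ) : ∫ q, g q ∂areaMeasure κ F₀ N r =
      ∫ q, areaFactor κ F₀ N r q * g q ∂areaMeasure κ F₀ N 0 := by
  rw [areaMeasure_eq_withDensity hκ hF hr, integral_withDensity_eq_integral_toReal_smul
    (continuous_areaFactor hκ hF r).measurable.ennreal_ofReal (by simp)]
  refine integral_congr_ae (ae_of_all _ fun q => ?_)
  simp only [smul_eq_mul]
  rw [ENNReal.toReal_ofReal (areaFactor_pos hκ hF hr q).le]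

theorem integral_eq_integral_chart (hκ : 0 < κ) (hF : IsConvexSurface κ F₀ N) {r : ℝ} (hr : 0 ≤ r)
    (p : S) {g : S → ℝ} (hg : Continuous g) (hg0 : ∀ q ∉ (chartAt Plane p).source, g q = 0) :
    ∫ q, g q ∂areaMeasure κ F₀ N r = ∫ x in (chartAt Plane p).target,
      √(metric κ F₀ N r p x).det * g ((chartAt Plane p).symm x) := by
  rw [← setIntegral_eq_integral_of_forall_compl_eq_zero hg0, areaMeasure_restrict hκ hF hr,
    chartArea, integral_map ((aemeasurable_chart_symm p).mono_ac
      (withDensity_absolutelyContinuous _ _)) hg.aestronglyMeasurable,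
    integral_withDensity_eq_integral_toReal_smul₀ (aemeasurable_sqrt_det_metric hκ hF hr p)
      (by simp)]
  refine integral_congr_ae (ae_of_all _ fun q => ?_)
  simp only [smul_eq_mul]
  rw [ENNReal.toReal_ofReal (Real.sqrt_nonneg _)]

end Area

/-! ### Green's identity -/

/-- The integral of a coordinate derivative of a compactly supported function vanishes. -/
theorem integral_pd_eq_zero {f : Plane → ℝ} (hf : ContDiff ℝ 1 f) (hc : HasCompactSupport f)
    (a : Fin 2) : ∫ x, pd a f x = 0 := by
  have hcont : Continuous (pd a f) := by
    have := hf.continuous_fderiv (by simp)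
    unfold pd; fun_prop
  have hcs : HasCompactSupport (pd a f) :=
    (hc.fderiv (𝕜 := ℝ)).comp_left (g := fun L : Plane →L[ℝ] ℝ => L (EuclideanSpace.single a 1)) rfl
  have hint : Integrable (fun x => fderiv ℝ f x (EuclideanSpace.single a 1)) :=
    hcont.integrable_of_hasCompactSupport hcs
  have := integral_mul_fderiv_eq_neg_fderiv_mul_of_integrable (μ := (volume : Measure Plane))
    (f := fun _ : Plane => (1 : ℝ)) (g := f) (v := EuclideanSpace.single a 1)
    (by simp) (by simpa using hint)
    (by simpa using hf.continuous.integrable_of_hasCompactSupport hc)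
    (fun _ _ => differentiableAt_const _) (fun x _ => hf.differentiable (by simp) x)
  simpa [pd] using this

/-- The components `√(det g) g^{ab} ∂_b f` of the gradient, as a vector density. -/
noncomputable def flux (G : Plane → Matrix (Fin 2) (Fin 2) ℝ) (f : Plane → ℝ) (a : Fin 2)
    (x : Plane) : ℝ :=
  √(G x).det * ∑ b, (G x)⁻¹ a b * pd b f x

namespace IsParamSurface

variable {κ : ℝ} {U : Set Plane} {X N : Plane → Mink} (h : IsParamSurface κ U X N) {x : Plane}
include h

theorem sqrt_det_mul_laplaceBeltrami (hx : x ∈ U) (f : Plane → ℝ) :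
    √(gram X X x).det * laplaceBeltrami (gram X X) f x = ∑ a, pd a (flux (gram X X) f a) x := by
  have := (Real.sqrt_pos.2 (h.det_pos x hx)).ne'
  rw [laplaceBeltrami]
  field_simp
  rfl

theorem contDiffAt_flux (hx : x ∈ U) {f : Plane → ℝ} (hf : ContDiffAt ℝ 2 f x) (a : Fin 2) :
    ContDiffAt ℝ 1 (flux (gram X X) f a) x := by
  have one_le : (1 : ℕ∞ω) ≤ ∞ := le_trans (by norm_num) two_le_infty
  have h1 := h.gram_contDiffAt hx
  refine ContDiffAt.mul ?_ (ContDiffAt.sum fun b _ => ?_)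
  · refine ContDiffAt.sqrt ?_ (h.det_pos x hx).ne'
    simp only [Matrix.det_fin_two]
    exact (((h1 0 0).mul (h1 1 1)).sub ((h1 0 1).mul (h1 1 0))).of_le one_le
  · exact ((h.gram_inv_contDiffAt hx a b).of_le one_le).mul (contDiffAt_pd hf (by norm_num))

theorem gram_inv_comm (hx : x ∈ U) (a b : Fin 2) :
    (gram X X x)⁻¹ a b = (gram X X x)⁻¹ b a := by
  have _ := h.det_pos x hx
  have : (gram X X x).transpose = gram X X x := by ext i j; exact gram_comm j i
  conv_lhs => rw [← this, ← Matrix.transpose_nonsing_inv, Matrix.transpose_apply]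

/-- The integrand of Green's second identity is a divergence. -/
theorem green_divergence (hx : x ∈ U) {v w : Plane → ℝ} (hv : ContDiffAt ℝ 2 v x)
    (hw : ContDiffAt ℝ 2 w x) : √(gram X X x).det * (w x * laplaceBeltrami (gram X X) v x -
      v x * laplaceBeltrami (gram X X) w x) =
    ∑ a, pd a (fun y => w y * flux (gram X X) v a y - v y * flux (gram X X) w a y) x := by
  have d1 := fun a => (h.contDiffAt_flux hx hv a).differentiableAt (by simp)
  have d2 := fun a => (h.contDiffAt_flux hx hw a).differentiableAt (by simp)
  have dv := hv.differentiableAt (by simp)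
  have dw := hw.differentiableAt (by simp)
  have e1 := h.sqrt_det_mul_laplaceBeltrami hx v
  have e2 := h.sqrt_det_mul_laplaceBeltrami hx w
  have e3 : ∑ a, (pd a w x * flux (gram X X) v a x - pd a v x * flux (gram X X) w a x) = 0 := by
    simp only [flux, Fin.sum_univ_two]
    rw [h.gram_inv_comm hx 1 0]
    ring
  simp only [pd_sub (dw.fun_mul (d1 _)) (dv.fun_mul (d2 _)), pd_mul dw (d1 _), pd_mul dv (d2 _)]
  simp only [Fin.sum_univ_two] at e1 e2 e3 ⊢
  linear_combination w x * e1 - v x * e2 - e3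

theorem continuousAt_laplaceBeltrami (hx : x ∈ U) {f : Plane → ℝ} (hf : ContDiffAt ℝ 2 f x) :
    ContinuousAt (laplaceBeltrami (gram X X) f) x := by
  have e : laplaceBeltrami (gram X X) f =ᶠ[𝓝 x] fun y => (√(gram X X y).det)⁻¹ *
      ∑ a, pd a (flux (gram X X) f a) y := by
    filter_upwards [h.isOpen.mem_nhds hx] with y hy
    rw [← h.sqrt_det_mul_laplaceBeltrami hy,
      inv_mul_cancel_left₀ (Real.sqrt_pos.2 (h.det_pos y hy)).ne']
  refine ContinuousAt.congr ?_ e.symm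
  have h1 := fun a b => (h.gram_contDiffAt hx a b).continuousAt
  refine ContinuousAt.mul (ContinuousAt.inv₀ ?_ (Real.sqrt_pos.2 (h.det_pos x hx)).ne') ?_
  · simp only [Matrix.det_fin_two]
    fun_prop
  · refine tendsto_finsetSum _ fun a _ => ?_
    exact (contDiffAt_pd (m := 0) (h.contDiffAt_flux hx hf a) (by norm_num)).continuousAt

theorem laplaceBeltrami_sum (hx : x ∈ U) {ι : Type*} (T : Finset ι) {f : ι → Plane → ℝ}
    (hf : ∀ i ∈ T, ContDiffAt ℝ 2 (f i) x) :
    laplaceBeltrami (gram X X) (fun y => ∑ i ∈ T, f i y) x =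
      ∑ i ∈ T, laplaceBeltrami (gram X X) (f i) x := by
  classical
  have e : ∀ a, flux (gram X X) (fun y => ∑ i ∈ T, f i y) a =ᶠ[𝓝 x]
      fun y => ∑ i ∈ T, flux (gram X X) (f i) a y := by
    intro a
    have : ∀ᶠ y in 𝓝 x, ∀ i ∈ T, ContDiffAt ℝ 2 (f i) y :=
      (Finset.eventually_all T).2 fun i hi => (hf i hi).eventually (by simp)
    filter_upwards [this] with y hy
    have e1 : ∀ b, pd b (fun y => ∑ i ∈ T, f i y) y = ∑ i ∈ T, pd b (f i) y := fun b =>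
      pd_sum fun i hi => (hy i hi).differentiableAt (by simp)
    simp only [flux, e1, Finset.mul_sum]
    rw [Finset.sum_comm]
  have h0 := (Real.sqrt_pos.2 (h.det_pos x hx)).ne'
  refine mul_left_cancel₀ h0 ?_
  rw [h.sqrt_det_mul_laplaceBeltrami hx, Finset.mul_sum,
    Finset.sum_congr rfl fun i _ => h.sqrt_det_mul_laplaceBeltrami hx (f i), Finset.sum_comm]
  refine Finset.sum_congr rfl fun a _ => ?_
  rw [pd_congr (e a)]
  exact pd_sum fun i hi => (h.contDiffAt_flux hx (hf i hi) a).differentiableAt (by simp)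

end IsParamSurface

section Green

variable {S : Type*} [TopologicalSpace S] [ChartedSpace Plane S] [IsManifold (𝓡 2) ∞ S]
  {κ : ℝ} {F₀ N : S → Mink}

theorem contDiffAt_chart_symm_of_contMDiff {f : S → ℝ} (hf : ContMDiff (𝓡 2) 𝓘(ℝ, ℝ) 2 f) (p : S)
    {x : Plane} (hx : x ∈ (chartAt Plane p).target) :
    ContDiffAt ℝ 2 (f ∘ (chartAt Plane p).symm) x :=
  contDiffAt_comp_chart_symm two_le_infty p hx hf.contMDiffAt

theorem continuous_leafLaplacian (hκ : 0 < κ) (hF : IsConvexSurface κ F₀ N) {r : ℝ} (hr : 0 ≤ r)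
    {f : S → ℝ} (hf : ContMDiff (𝓡 2) 𝓘(ℝ, ℝ) 2 f) : Continuous (leafLaplacian κ F₀ N r f) := by
  rw [continuous_iff_continuousAt]
  intro p
  have hx := mem_chart_target Plane p
  have h1 := (hF.leaf_isParamSurface hκ hr p).continuousAt_laplaceBeltrami hx
    (contDiffAt_chart_symm_of_contMDiff hf p hx)
  refine (h1.comp ((chartAt Plane p).continuousAt (mem_chart_source Plane p))).congr ?_
  filter_upwards [chart_source_mem_nhds Plane p] with q hq
  exact (leafLaplacian_eq hκ hF hr p hq hf.contMDiffAt).symm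

theorem leafLaplacian_sum (hκ : 0 < κ) (hF : IsConvexSurface κ F₀ N) {r : ℝ} (hr : 0 ≤ r)
    {ι : Type*} (T : Finset ι) {f : ι → S → ℝ} (hf : ∀ i, ContMDiff (𝓡 2) 𝓘(ℝ, ℝ) 2 (f i)) (p : S) :
    leafLaplacian κ F₀ N r (fun q => ∑ i ∈ T, f i q) p = ∑ i ∈ T, leafLaplacian κ F₀ N r (f i) p :=
  (hF.leaf_isParamSurface hκ hr p).laplaceBeltrami_sum (mem_chart_target Plane p) T
    fun i _ => contDiffAt_chart_symm_of_contMDiff (hf i) p (mem_chart_target Plane p)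

theorem leafLaplacian_sub_one (hκ : 0 < κ) (hF : IsConvexSurface κ F₀ N) {r : ℝ} (hr : 0 ≤ r)
    (f : S → ℝ) (p : S) :
    leafLaplacian κ F₀ N r (fun q => f q - 1) p = leafLaplacian κ F₀ N r f p := by
  have hx := mem_chart_target Plane p
  have h := hF.leaf_isParamSurface hκ hr p
  have h0 := (Real.sqrt_pos.2 (h.det_pos _ hx)).ne'
  refine mul_left_cancel₀ h0 ?_
  refine (h.sqrt_det_mul_laplaceBeltrami hx _).trans
    (Eq.trans ?_ (h.sqrt_det_mul_laplaceBeltrami hx _).symm)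
  refine Finset.sum_congr rfl fun a _ => pd_congr ?_
  filter_upwards [h.isOpen.mem_nhds hx] with y hy
  have : ∀ b, pd b ((fun q => f q - 1) ∘ (chartAt Plane p).symm) y =
      pd b (f ∘ (chartAt Plane p).symm) y := by
    intro b
    have e : ((fun q => f q - 1) ∘ (chartAt Plane p).symm) =
      fun z => (f ∘ (chartAt Plane p).symm) z - 1 := rfl
    rw [e, pd, fderiv_sub_const, pd]
  simp only [flux, this]

omit [IsManifold (𝓡 2) ∞ S] in
theorem leafLaplacian_const_mul (r c : ℝ) (f : S → ℝ) (p : S) :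
    leafLaplacian κ F₀ N r (fun q => c * f q) p = c * leafLaplacian κ F₀ N r f p := by
  have h1 : ∀ (a : Fin 2) (g : Plane → ℝ) (y : Plane),
      pd a (fun z => c * g z) y = c * pd a g y := by
    intro a g y
    rcases eq_or_ne c 0 with rfl | hc
    · simp [pd]
    · have : Invertible c := invertibleOfNonzero hc
      have := fderiv_const_smul_of_invertible (𝕜 := ℝ) (f := g) (x := y) c
      change fderiv ℝ (c • g) y _ = _
      rw [this]; rfl
  have e : (fun q => c * f q) ∘ (chartAt Plane p).symm =
    fun z => c * (f ∘ (chartAt Plane p).symm) z := rfl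
  simp only [leafLaplacian, laplaceBeltrami, e, h1]
  simp only [mul_left_comm _ c, ← Finset.mul_sum, h1]

theorem leafLaplacian_nonpos_of_isLocalMax (hκ : 0 < κ) (hF : IsConvexSurface κ F₀ N) {r : ℝ}
    (hr : 0 ≤ r) {p : S} {f : S → ℝ} (hf : ContMDiffAt (𝓡 2) 𝓘(ℝ, ℝ) 2 f p)
    (hmax : IsLocalMax f p) : leafLaplacian κ F₀ N r f p ≤ 0 := by
  have := leafLaplacian_nonneg_of_isLocalMin hκ hF hr hf.neg hmax.neg
  have e := leafLaplacian_const_mul (κ := κ) (F₀ := F₀) (N := N) r (-1) f p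
  simp only [← neg_one_mul (f _), e] at this
  linarith

variable [MeasurableSpace S] [BorelSpace S] [T2Space S] [CompactSpace S]

/-- Green's second identity if one of the functions is supported in the domain of a chart. -/
theorem integral_green_of_tsupport_subset (hκ : 0 < κ) (hF : IsConvexSurface κ F₀ N) {r : ℝ}
    (hr : 0 ≤ r) (p : S) {v w : S → ℝ} (hv : ContMDiff (𝓡 2) 𝓘(ℝ, ℝ) 2 v)
    (hw : ContMDiff (𝓡 2) 𝓘(ℝ, ℝ) 2 w) (hsub : tsupport v ⊆ (chartAt Plane p).source) :
    ∫ q, (w q * leafLaplacian κ F₀ N r v q - v q * leafLaplacian κ F₀ N r w q)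
      ∂areaMeasure κ F₀ N r = 0 := by
  have h := hF.leaf_isParamSurface hκ hr p
  set φ := chartAt Plane p with hφ
  set G := metric κ F₀ N r p with hG
  have hLv : ∀ q ∉ φ.source, leafLaplacian κ F₀ N r v q = 0 := by
    intro q hq
    have hq' : q ∉ tsupport v := fun h => hq (hsub h)
    have hx := mem_chart_target Plane q
    have hq2 := hF.leaf_isParamSurface hκ hr q
    have h0 := (Real.sqrt_pos.2 (hq2.det_pos _ hx)).ne'
    refine mul_left_cancel₀ h0 ?_
    refine (hq2.sqrt_det_mul_laplaceBeltrami hx _).trans ?_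
    rw [mul_zero]
    refine Finset.sum_eq_zero fun a _ => ?_
    have ev : ∀ᶠ y in 𝓝 (chartAt Plane q q), (chartAt Plane q).symm y ∉ tsupport v := by
      have hc := ((chartAt Plane q).continuousAt_symm hx).tendsto
      rw [(chartAt Plane q).left_inv (mem_chart_source Plane q)] at hc
      exact hc.eventually ((isClosed_tsupport v).isOpen_compl.mem_nhds hq')
    have ev2 : v ∘ (chartAt Plane q).symm =ᶠ[𝓝 (chartAt Plane q q)] fun _ => 0 := by
      filter_upwards [ev] with y hy using image_eq_zero_of_notMem_tsupport (f := v) hy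
    have ev3 : flux (gram (leaf κ F₀ N r ∘ (chartAt Plane q).symm)
        (leaf κ F₀ N r ∘ (chartAt Plane q).symm)) (v ∘ (chartAt Plane q).symm) a
        =ᶠ[𝓝 (chartAt Plane q q)] fun _ => 0 := by
      filter_upwards [ev2.eventuallyEq_nhds] with y hy
      simp only [flux, pd_congr hy]
      simp [pd]
    rw [pd_congr ev3]
    simp [pd]
  have hv0 : ∀ q ∉ φ.source, v q = 0 := fun q hq =>
    image_eq_zero_of_notMem_tsupport fun h => hq (hsub h)
  rw [integral_eq_integral_chart hκ hF hr p
    (g := fun q => w q * leafLaplacian κ F₀ N r v q - v q * leafLaplacian κ F₀ N r w q)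
    ((hw.continuous.mul (continuous_leafLaplacian hκ hF hr hv)).sub
      (hv.continuous.mul (continuous_leafLaplacian hκ hF hr hw)))
    (fun q hq => by rw [hLv q hq, hv0 q hq]; ring)]
  -- the flux, extended by zero outside the chart
  set Y : Fin 2 → Plane → ℝ := fun a => φ.target.indicator fun y =>
    (w ∘ φ.symm) y * flux G (v ∘ φ.symm) a y - (v ∘ φ.symm) y * flux G (w ∘ φ.symm) a y with hY
  set K := φ '' tsupport v with hK
  have hKc : IsCompact K := (isClosed_tsupport _).isCompact.image_of_continuousOn
    (φ.continuousOn.mono hsub)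
  have hKt : K ⊆ φ.target := by
    rintro _ ⟨q, hq, rfl⟩
    exact φ.map_source (hsub hq)
  have hvK : ∀ y ∈ φ.target, y ∉ K → (v ∘ φ.symm) y = 0 := by
    intro y hy hyK
    by_contra h0
    exact hyK ⟨φ.symm y, subset_tsupport _ h0, φ.right_inv hy⟩
  have hY0 : ∀ a, ∀ y ∉ K, Y a y = 0 := by
    intro a y hyK
    by_cases hy : y ∈ φ.target
    · have ev : v ∘ φ.symm =ᶠ[𝓝 y] fun _ => 0 := by
        filter_upwards [φ.open_target.mem_nhds hy, hKc.isClosed.isOpen_compl.mem_nhds hyK]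
          with z hz hzK using hvK z hz hzK
      simp only [hY, indicator_of_mem hy, flux, pd_congr ev, hvK y hy hyK]
      simp [pd]
    · simp only [hY, indicator_of_notMem hy]
  have hYeq : ∀ a, ∀ y ∈ φ.target, Y a =ᶠ[𝓝 y] fun y =>
      (w ∘ φ.symm) y * flux G (v ∘ φ.symm) a y - (v ∘ φ.symm) y * flux G (w ∘ φ.symm) a y := by
    intro a y hy
    filter_upwards [φ.open_target.mem_nhds hy] with z hz
    simp only [hY, indicator_of_mem hz]
  have cv : ∀ y ∈ φ.target, ContDiffAt ℝ 2 (v ∘ φ.symm) y := fun y hy =>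
    contDiffAt_chart_symm_of_contMDiff hv p hy
  have cw : ∀ y ∈ φ.target, ContDiffAt ℝ 2 (w ∘ φ.symm) y := fun y hy =>
    contDiffAt_chart_symm_of_contMDiff hw p hy
  have hYc : ∀ a, ContDiff ℝ 1 (Y a) := by
    intro a
    rw [contDiff_iff_contDiffAt]
    intro y
    by_cases hy : y ∈ φ.target
    · refine ContDiffAt.congr_of_eventuallyEq ?_ (hYeq a y hy)
      exact (((cw y hy).of_le (by norm_num)).mul (h.contDiffAt_flux hy (cv y hy) a)).sub
        (((cv y hy).of_le (by norm_num)).mul (h.contDiffAt_flux hy (cw y hy) a))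
    · have : Y a =ᶠ[𝓝 y] fun _ => 0 := by
        filter_upwards [hKc.isClosed.isOpen_compl.mem_nhds fun hyK => hy (hKt hyK)] with z hz
          using hY0 a z hz
      exact contDiffAt_const.congr_of_eventuallyEq this
  have hYs : ∀ a, HasCompactSupport (Y a) := fun a => HasCompactSupport.intro hKc (hY0 a)
  have hpd0 : ∀ y ∉ φ.target, ∑ a, pd a (Y a) y = 0 := by
    intro y hy
    refine Finset.sum_eq_zero fun a _ => ?_
    have : Y a =ᶠ[𝓝 y] fun _ => 0 := by
      filter_upwards [hKc.isClosed.isOpen_compl.mem_nhds fun hyK => hy (hKt hyK)] with z hz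
        using hY0 a z hz
    rw [pd_congr this]; simp [pd]
  have hint : ∀ a, Integrable (pd a (Y a)) := by
    intro a
    have hcont : Continuous (pd a (Y a)) := by
      have := (hYc a).continuous_fderiv (by simp)
      unfold pd; fun_prop
    exact hcont.integrable_of_hasCompactSupport (((hYs a).fderiv (𝕜 := ℝ)).comp_left
      (g := fun L : Plane →L[ℝ] ℝ => L (EuclideanSpace.single a 1)) rfl)
  calc ∫ x in φ.target, √(G x).det * (w (φ.symm x) * leafLaplacian κ F₀ N r v (φ.symm x) -
        v (φ.symm x) * leafLaplacian κ F₀ N r w (φ.symm x))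
      = ∫ x in φ.target, ∑ a, pd a (Y a) x := by
        refine setIntegral_congr_fun φ.open_target.measurableSet fun x hx => ?_
        have hs := φ.map_target hx
        simp only [leafLaplacian_eq hκ hF hr p hs hv.contMDiffAt,
          leafLaplacian_eq hκ hF hr p hs hw.contMDiffAt, ← hφ, φ.right_inv hx]
        refine (h.green_divergence hx (cv x hx) (cw x hx)).trans ?_
        exact Finset.sum_congr rfl fun a _ => (pd_congr (hYeq a x hx)).symm
    _ = ∫ x, ∑ a, pd a (Y a) x := setIntegral_eq_integral_of_forall_compl_eq_zero hpd0
    _ = 0 := by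
        rw [integral_finsetSum _ fun a _ => hint a]
        exact Finset.sum_eq_zero fun a _ => integral_pd_eq_zero (hYc a) (hYs a) a

/-- Green's second identity on a leaf. -/
theorem integral_green (hκ : 0 < κ) (hF : IsConvexSurface κ F₀ N) {r : ℝ}
    (hr : 0 ≤ r) {v w : S → ℝ} (hv : ContMDiff (𝓡 2) 𝓘(ℝ, ℝ) 2 v)
    (hw : ContMDiff (𝓡 2) 𝓘(ℝ, ℝ) 2 w) :
    ∫ q, (w q * leafLaplacian κ F₀ N r v q - v q * leafLaplacian κ F₀ N r w q)
      ∂areaMeasure κ F₀ N r = 0 := by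
  have := isFiniteMeasure_areaMeasure hκ hF hr
  obtain ⟨T, -, hT1⟩ := exists_finset_sum_chartPartition S
  have hρ : ∀ p, ContMDiff (𝓡 2) 𝓘(ℝ, ℝ) 2 fun q => chartPartition S p q * v q := fun p =>
    ((chartPartition S p).2.of_le two_le_infty).mul hv
  have hsum : v = fun q => ∑ p ∈ T, chartPartition S p q * v q := by
    funext q
    rw [← Finset.sum_mul, hT1, one_mul]
  have e : ∀ q, w q * leafLaplacian κ F₀ N r v q - v q * leafLaplacian κ F₀ N r w q =
      ∑ p ∈ T, (w q * leafLaplacian κ F₀ N r (fun q => chartPartition S p q * v q) q -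
        chartPartition S p q * v q * leafLaplacian κ F₀ N r w q) := by
    intro q
    have h1 := leafLaplacian_sum hκ hF hr T hρ q
    rw [← hsum] at h1
    rw [Finset.sum_sub_distrib, ← Finset.mul_sum, ← Finset.sum_mul, ← h1, ← Finset.sum_mul, hT1,
      one_mul]
  simp only [e]
  rw [integral_finsetSum]
  · refine Finset.sum_eq_zero fun p _ => ?_
    refine integral_green_of_tsupport_subset hκ hF hr p (hρ p) hw ?_
    exact (tsupport_mul_subset_left).trans (chartPartition_isSubordinate S p)
  · intro p _
    refine Continuous.integrable_of_hasCompactSupport ?_ (HasCompactSupport.of_compactSpace _)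
    exact (hw.continuous.mul (continuous_leafLaplacian hκ hF hr (hρ p))).sub
      ((hρ p).continuous.mul (continuous_leafLaplacian hκ hF hr hw))

end Green

/-! ### First touching times -/

/-- A continuous family of functions on a compact space which is initially negative stays negative,
provided that its time derivative is negative at every point of a first zero. -/
theorem neg_of_first_touch {S : Type*} [TopologicalSpace S] [CompactSpace S] {f : S → ℝ → ℝ}
    {a b : ℝ} (hc : ContinuousOn (fun q : S × ℝ => f q.1 q.2) (univ ×ˢ Icc a b))
    (h0 : ∀ p, f p a < 0)
    (h : ∀ p, ∀ r ∈ Ioc a b, f p r = 0 → (∀ q, f q r ≤ 0) → ∃ d < 0, HasDerivAt (f p) d r) :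
    ∀ p, ∀ r ∈ Icc a b, f p r < 0 := by
  by_contra! hcon
  obtain ⟨p₁, r₁, hr₁, hf₁⟩ := hcon
  set A := Prod.snd '' ((univ ×ˢ Icc a b : Set (S × ℝ)) ∩
    (fun q : S × ℝ => f q.1 q.2) ⁻¹' Ici 0) with hA
  have hAc : IsCompact A := by
    have h1 : IsClosed ((univ ×ˢ Icc a b : Set (S × ℝ)) ∩
        (fun q : S × ℝ => f q.1 q.2) ⁻¹' Ici 0) :=
      hc.preimage_isClosed_of_isClosed (isClosed_univ.prod isClosed_Icc) isClosed_Ici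
    exact ((isCompact_univ.prod isCompact_Icc).of_isClosed_subset h1 inter_subset_left).image
      continuous_snd
  obtain ⟨t, ⟨⟨⟨p, t'⟩, ⟨⟨-, ht⟩, hft⟩, rfl⟩, hmin⟩⟩ :=
    hAc.exists_isLeast ⟨r₁, ⟨p₁, r₁⟩, ⟨⟨mem_univ _, hr₁⟩, hf₁⟩, rfl⟩
  simp only at ht hmin
  replace hft : 0 ≤ f p t' := hft
  have hlt : ∀ q, ∀ s ∈ Ico a t', f q s < 0 := by
    intro q s hs
    by_contra! hq
    have : t' ≤ s := hmin ⟨⟨q, s⟩, ⟨⟨mem_univ _, hs.1, hs.2.le.trans ht.2⟩, hq⟩, rfl⟩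
    exact absurd hs.2 this.not_gt
  have hat : a < t' := by
    rcases ht.1.lt_or_eq with h1 | h1
    · exact h1
    · rw [← h1] at hft
      exact absurd (h0 p) hft.not_gt
  have hev : ∀ᶠ s in 𝓝[<] t', s ∈ Ico a t' := Ico_mem_nhdsLT hat
  have hle : ∀ q, f q t' ≤ 0 := by
    intro q
    have h1 : ContinuousWithinAt (f q) (Icc a b) t' := by
      have := hc (q, t') ⟨mem_univ _, ht⟩
      exact this.comp (f := fun s => (q, s)) (by fun_prop) fun s hs => ⟨mem_univ _, hs⟩
    have h2 : Tendsto (f q) (𝓝[<] t') (𝓝 (f q t')) := by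
      refine h1.tendsto.mono_left ?_
      rw [nhdsWithin_le_iff]
      filter_upwards [hev] with s hs using ⟨hs.1, hs.2.le.trans ht.2⟩
    exact le_of_tendsto h2 (hev.mono fun s hs => (hlt q s hs).le)
  have hz : f p t' = 0 := le_antisymm (hle p) hft
  obtain ⟨d, hd, hder⟩ := h p t' ⟨hat, ht.2⟩ hz hle
  have h3 := hasDerivAt_iff_tendsto_slope.1 hder
  have h4 : Tendsto (slope (f p) t') (𝓝[<] t') (𝓝 d) :=
    h3.mono_left (nhdsWithin_mono _ fun s hs => ne_of_lt hs)
  have h5 : 0 ≤ d := ge_of_tendsto h4 (hev.mono fun s hs => by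
    rw [slope_def_field, hz, sub_zero]
    exact div_nonneg_of_nonpos (hlt p s hs).le (by linarith [hs.2]))
  linarith

/-- The version of `neg_of_first_touch` backwards in time. -/
theorem neg_of_last_touch {S : Type*} [TopologicalSpace S] [CompactSpace S] {f : S → ℝ → ℝ}
    {a b : ℝ} (hc : ContinuousOn (fun q : S × ℝ => f q.1 q.2) (univ ×ˢ Icc a b))
    (h0 : ∀ p, f p b < 0)
    (h : ∀ p, ∀ r ∈ Ico a b, f p r = 0 → (∀ q, f q r ≤ 0) → ∃ d > 0, HasDerivAt (f p) d r) :
    ∀ p, ∀ r ∈ Icc a b, f p r < 0 := by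
  have key := neg_of_first_touch (f := fun p s => f p (-s)) (a := -b) (b := -a) ?_
    (by simpa using h0) ?_
  · intro p r hr
    simpa using key p (-r) ⟨by linarith [hr.2], by linarith [hr.1]⟩
  · exact hc.comp (f := fun q : S × ℝ => (q.1, -q.2)) (by fun_prop) fun q hq =>
      ⟨mem_univ _, by linarith [hq.2.2], by linarith [hq.2.1]⟩
  · intro p r hr hz hle
    obtain ⟨d, hd, hder⟩ := h p (-r) ⟨by linarith [hr.2], by linarith [hr.1]⟩ hz hle
    refine ⟨-d, by linarith, ?_⟩
    have := hder.scomp r (hasDerivAt_neg r)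
    simpa [Function.comp_def] using this

/-! ### Functions on the foliation -/

section Time

variable {S : Type*} [TopologicalSpace S] [ChartedSpace Plane S]

/-- The regularity of a classical solution: continuous for `r ≥ 0` and `C²` for `r > 0`. -/
structure IsClassical (f : S → ℝ → ℝ) : Prop where
  continuousOn : ContinuousOn (fun q : S × ℝ => f q.1 q.2) (univ ×ˢ Ici 0)
  contMDiffOn : ContMDiffOn ((𝓡 2).prod 𝓘(ℝ, ℝ)) 𝓘(ℝ, ℝ) 2
    (fun q : S × ℝ => f q.1 q.2) (univ ×ˢ Ioi 0)

namespace IsClassical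

variable {f : S → ℝ → ℝ} (hf : IsClassical f)
include hf

theorem contMDiffAt (p : S) {r : ℝ} (hr : 0 < r) :
    ContMDiffAt ((𝓡 2).prod 𝓘(ℝ, ℝ)) 𝓘(ℝ, ℝ) 2 (fun q : S × ℝ => f q.1 q.2) (p, r) :=
  hf.contMDiffOn.contMDiffAt (prod_mem_nhds univ_mem (Ioi_mem_nhds hr))

theorem contMDiff_slice {r : ℝ} (hr : 0 < r) :
    ContMDiff (𝓡 2) 𝓘(ℝ, ℝ) 2 fun q => f q r := fun p =>
  (hf.contMDiffAt p hr).comp (f := fun q : S => (q, r)) p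
    (contMDiffAt_id.prodMk contMDiffAt_const)

theorem hasDerivAt (p : S) {r : ℝ} (hr : 0 < r) : HasDerivAt (f p) (deriv (f p) r) r := by
  have h1 : ContMDiffAt 𝓘(ℝ, ℝ) 𝓘(ℝ, ℝ) 2 (fun s => f p s) r :=
    (hf.contMDiffAt p hr).comp (f := fun s : ℝ => (p, s)) r
      (contMDiffAt_const.prodMk contMDiffAt_id)
  exact ((contMDiffAt_iff_contDiffAt.1 h1).differentiableAt (by simp)).hasDerivAt

theorem continuous_slice {r : ℝ} (hr : 0 ≤ r) : Continuous fun q => f q r := by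
  rw [← continuousOn_univ]
  exact hf.continuousOn.comp (f := fun q : S => (q, r)) (by fun_prop) fun q _ => ⟨mem_univ _, hr⟩

theorem continuousOn_deriv [IsManifold (𝓡 2) ∞ S] :
    ContinuousOn (fun q : S × ℝ => deriv (f q.1) q.2) (univ ×ˢ Ioi 0) := by
  rintro ⟨p, r⟩ ⟨-, hr⟩
  replace hr : 0 < r := hr
  refine ContinuousAt.continuousWithinAt ?_
  -- in a chart the time derivative is a component of the Fréchet derivative
  set φ := chartAt Plane p with hφ
  have hps := mem_chart_source Plane p
  set g : Plane × ℝ → ℝ := fun z => f (φ.symm z.1) z.2 with hg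
  have hgc : ContDiffAt ℝ 2 g (φ p, r) := by
    have h1 : ContMDiffAt (𝓡 2) (𝓡 2) 2 φ.symm (φ p) :=
      ((contMDiffOn_chart_symm (I := 𝓡 2) (n := ∞) (x := p)).contMDiffAt
        (φ.open_target.mem_nhds (φ.map_source hps))).of_le two_le_infty
    have h2 : ContMDiffAt 𝓘(ℝ, Plane × ℝ) ((𝓡 2).prod 𝓘(ℝ, ℝ)) 2
        (fun z : Plane × ℝ => (φ.symm z.1, z.2)) (φ p, r) :=
      (ContMDiffAt.comp (φ p, r) (f := fun z : Plane × ℝ => z.1) h1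
        contDiff_fst.contMDiff.contMDiffAt).prodMk contDiff_snd.contMDiff.contMDiffAt
    have h3 : ContMDiffAt ((𝓡 2).prod 𝓘(ℝ, ℝ)) 𝓘(ℝ, ℝ) 2 (fun q : S × ℝ => f q.1 q.2)
        ((fun z : Plane × ℝ => (φ.symm z.1, z.2)) (φ p, r)) := by
      simp only [φ.left_inv hps]
      exact hf.contMDiffAt p hr
    exact contMDiffAt_iff_contDiffAt.1 (h3.comp (φ p, r) h2)
  have hcont : ContinuousAt (fun z => fderiv ℝ g z (0, 1)) (φ p, r) :=
    ((hgc.fderiv_right (m := 1) (by norm_num)).continuousAt).clm_apply continuousAt_const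
  have hmap : ContinuousAt (fun q : S × ℝ => (φ q.1, q.2)) (p, r) :=
    ((φ.continuousAt hps).comp (f := fun q : S × ℝ => q.1) continuousAt_fst).prodMk continuousAt_snd
  have hd : ∀ᶠ q : S × ℝ in 𝓝 (p, r), DifferentiableAt ℝ g (φ q.1, q.2) :=
    hmap.eventually ((hgc.eventually (by simp)).mono fun z hz => hz.differentiableAt (by simp))
  refine (ContinuousAt.comp (f := fun q : S × ℝ => (φ q.1, q.2)) hcont hmap).congr ?_
  have hsrc : ∀ᶠ q : S × ℝ in 𝓝 (p, r), q.1 ∈ φ.source :=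
    continuousAt_fst.eventually (φ.open_source.mem_nhds hps)
  filter_upwards [hd, hsrc] with q hq hqs
  have e : f q.1 = fun s => g (φ q.1, s) := by
    funext s; simp only [hg, φ.left_inv hqs]
  have h4 : HasDerivAt (fun s : ℝ => (φ q.1, s)) (0, 1) q.2 :=
    (hasDerivAt_const _ _).prodMk (hasDerivAt_id _)
  have := hq.hasFDerivAt.comp_hasDerivAt q.2 h4
  rw [e]
  exact this.deriv.symm

end IsClassical

end Time

/-! ### Integrals over a compact space depending on a parameter -/

section Parameter

variable {S : Type*} [TopologicalSpace S] [CompactSpace S] [MeasurableSpace S] [BorelSpace S]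
  {μ : Measure S} [IsFiniteMeasure μ] {E E' : S → ℝ → ℝ}

theorem integrable_of_continuous {g : S → ℝ} (hg : Continuous g) : Integrable g μ :=
  hg.integrable_of_hasCompactSupport (HasCompactSupport.of_compactSpace _)

theorem continuousOn_integral (hE : ContinuousOn (fun q : S × ℝ => E q.1 q.2) (univ ×ˢ Ici 0)) :
    ContinuousOn (fun r => ∫ p, E p r ∂μ) (Ici 0) := by
  have h1 : Continuous (Function.uncurry fun (r : ℝ) (p : S) => E p (max r 0)) := by
    rw [← continuousOn_univ]
    exact hE.comp (f := fun z : ℝ × S => (z.2, max z.1 0)) (by fun_prop)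
      fun z _ => ⟨mem_univ _, show (0 : ℝ) ≤ max z.1 0 from le_max_right _ _⟩
  have h2 := continuous_parametric_integral_of_continuous (μ := μ) h1 isCompact_univ
  refine h2.continuousOn.congr fun r hr => ?_
  simp only [Measure.restrict_univ, max_eq_left (show (0 : ℝ) ≤ r from hr)]

theorem hasDerivAt_integral (hE : ContinuousOn (fun q : S × ℝ => E q.1 q.2) (univ ×ˢ Ioi 0))
    (hE' : ContinuousOn (fun q : S × ℝ => E' q.1 q.2) (univ ×ˢ Ioi 0))
    (hd : ∀ p, ∀ r > 0, HasDerivAt (E p) (E' p r) r) {r : ℝ} (hr : 0 < r) :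
    HasDerivAt (fun s => ∫ p, E p s ∂μ) (∫ p, E' p r ∂μ) r := by
  have hsl : ∀ {F : S → ℝ → ℝ}, ContinuousOn (fun q : S × ℝ => F q.1 q.2) (univ ×ˢ Ioi 0) →
      ∀ s > 0, Continuous fun p => F p s := by
    intro F hF s hs
    rw [← continuousOn_univ]
    exact hF.comp (f := fun q : S => (q, s)) (by fun_prop) fun q _ => ⟨mem_univ _, hs⟩
  have hpos : ∀ s ∈ Icc (r / 2) (2 * r), 0 < s := fun s hs => by linarith [hs.1]
  obtain ⟨C, hC⟩ := (isCompact_univ.prod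
    (isCompact_Icc (a := r / 2) (b := 2 * r))).exists_bound_of_continuousOn
    (hE'.mono (prod_mono le_rfl fun s hs => hpos s hs))
  have hnhds : Icc (r / 2) (2 * r) ∈ 𝓝 r := Icc_mem_nhds (by linarith) (by linarith)
  refine (hasDerivAt_integral_of_dominated_loc_of_deriv_le (bound := fun _ => C)
    (F := fun s p => E p s) (F' := fun s p => E' p s) (s := Icc (r / 2) (2 * r)) hnhds ?_
    (integrable_of_continuous (hsl hE r hr)) (hsl hE' r hr).aestronglyMeasurable ?_
    (integrable_const _) ?_).2
  · filter_upwards [Ioi_mem_nhds hr] with s hs using (hsl hE s hs).aestronglyMeasurable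
  · exact ae_of_all _ fun p s hs => hC (p, s) ⟨mem_univ _, hs⟩
  · exact ae_of_all _ fun p s hs => hd p s (hpos s hs)

end Parameter

/-! ### Growth of the area element -/

/-- The second derivative of `expansion` with respect to the distance. -/
noncomputable def expansionDeriv2 (κ H K r : ℝ) : ℝ :=
  2 * κ ^ 2 * expansion κ H K r + 2 * extrinsicFactor κ H K r

section Expansion

variable {κ H K r : ℝ}

theorem hasDerivAt_cosh_mul (κ r : ℝ) :
    HasDerivAt (fun s => Real.cosh (κ * s)) (κ * Real.sinh (κ * r)) r := by
  have := ((hasDerivAt_id r).const_mul κ).cosh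
  simpa [mul_comm] using this

theorem hasDerivAt_sinh_mul (κ r : ℝ) :
    HasDerivAt (fun s => Real.sinh (κ * s)) (κ * Real.cosh (κ * r)) r := by
  have := ((hasDerivAt_id r).const_mul κ).sinh
  simpa [mul_comm] using this

theorem hasDerivAt_expansionDeriv (hκ : 0 < κ) (H K r : ℝ) :
    HasDerivAt (expansionDeriv κ H K) (expansionDeriv2 κ H K r) r := by
  have hc := hasDerivAt_cosh_mul κ r
  have hs := hasDerivAt_sinh_mul κ r
  have := (((hc.mul hs).const_mul (2 * κ)).add (((hc.pow 2).add (hs.pow 2)).mul_const H)).add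
    ((((hc.mul hs).const_mul 2).div_const κ).mul_const K)
  refine (this.congr_deriv ?_)
  rw [expansionDeriv2, expansion, extrinsicFactor]
  field_simp
  ring

/-- The estimates of the hyperbolic functions that enter the bounds of the area element. -/
theorem cosh_sub_sinh_bounds (hκ : 0 < κ) (hr : 0 ≤ r) :
    Real.cosh (κ * r) - Real.sinh (κ * r) = Real.exp (-(κ * r)) ∧
    0 ≤ Real.sinh (κ * r) ∧ Real.sinh (κ * r) ≤ Real.cosh (κ * r) ∧
    Real.cosh (κ * r) ≤ Real.exp (κ * r) ∧ Real.exp (κ * r) / 2 ≤ Real.cosh (κ * r) ∧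
    Real.exp (-(κ * r)) ≤ 1 ∧ Real.exp (κ * r) * Real.exp (-(κ * r)) = 1 := by
  have h0 : 0 ≤ κ * r := by positivity
  have h1 := Real.cosh_sub_sinh (κ * r)
  have h2 := Real.cosh_add_sinh (κ * r)
  have h3 := Real.sinh_nonneg_iff.2 h0
  have h4 := Real.exp_pos (-(κ * r))
  refine ⟨h1, h3, by linarith, by linarith, by linarith, Real.exp_le_one_iff.2 (by linarith), ?_⟩
  rw [← Real.exp_add]; simp

theorem abs_expansionDeriv_sub_le (hκ : 0 < κ) (hH : 0 ≤ H) (hK : 0 ≤ K) (hr : 0 ≤ r) :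
    |expansionDeriv κ H K r - 2 * κ * expansion κ H K r| ≤ 2 * κ + H + 2 * (K / κ) := by
  obtain ⟨h1, h2, h3, h4, -, h6, h7⟩ := cosh_sub_sinh_bounds hκ hr
  set c := Real.cosh (κ * r)
  set s := Real.sinh (κ * r)
  set e := Real.exp (-(κ * r))
  have he : 0 < e := Real.exp_pos _
  have key : expansionDeriv κ H K r - 2 * κ * expansion κ H K r =
      -(2 * κ) * (c * e) + e ^ 2 * H + 2 * (s * e) * (K / κ) := by
    have : s = c - e := by linarith
    rw [expansionDeriv, expansion]
    change 2 * κ * (c * s) + (c ^ 2 + s ^ 2) * H + 2 * (c * s) / κ * K -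
      2 * κ * (c ^ 2 + c * s / κ * H + s ^ 2 / κ ^ 2 * K) = _
    rw [this]
    field_simp
    ring
  have hce : c * e ≤ 1 := by rw [← h7]; exact mul_le_mul_of_nonneg_right h4 he.le
  have hse : s * e ≤ 1 := (mul_le_mul_of_nonneg_right h3 he.le).trans hce
  have hc0 : 0 ≤ c * e := by have := h2.trans h3; positivity
  have hs0 : 0 ≤ s * e := by positivity
  have he2 : e ^ 2 ≤ 1 := pow_le_one₀ he.le h6
  have hKκ : 0 ≤ K / κ := by positivity
  have a1 := mul_le_mul_of_nonneg_left hce hκ.le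
  have a2 := mul_le_mul_of_nonneg_right he2 hH
  have a3 := mul_le_mul_of_nonneg_right hse hKκ
  have b1 : 0 ≤ κ * (c * e) := by positivity
  have b2 : 0 ≤ e ^ 2 * H := by positivity
  have b3 : 0 ≤ s * e * (K / κ) := by positivity
  rw [key, abs_le]
  constructor <;> linarith

theorem expansionDeriv2_eq (hκ : 0 < κ) :
    expansionDeriv2 κ H K r = 4 * κ ^ 2 * expansion κ H K r + 2 * (K - κ ^ 2) := by
  have := Real.cosh_sq (κ * r)
  rw [expansionDeriv2, expansion, extrinsicFactor]
  field_simp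
  linear_combination (-2 * κ ^ 2 + 2 * K) * this

theorem exp_two_mul (κ r : ℝ) : Real.exp (2 * κ * r) = Real.exp (κ * r) ^ 2 := by
  rw [← Real.exp_nat_mul]; congr 1; push_cast; ring

theorem le_expansionDeriv (hκ : 0 < κ) (hH : 0 ≤ H) (hK : 0 ≤ K) (hr : 0 ≤ r) :
    H / 4 * Real.exp (2 * κ * r) ≤ expansionDeriv κ H K r := by
  obtain ⟨-, h2, h3, -, h5, -, -⟩ := cosh_sub_sinh_bounds hκ hr
  rw [exp_two_mul, expansionDeriv]
  have h6 : (Real.exp (κ * r) / 2) ^ 2 ≤ Real.cosh (κ * r) ^ 2 :=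
    pow_le_pow_left₀ (by positivity) h5 2
  have h7 := mul_le_mul_of_nonneg_right h6 hH
  have hc := h2.trans h3
  have b1 : 0 ≤ 2 * κ * (Real.cosh (κ * r) * Real.sinh (κ * r)) := by positivity
  have b2 : 0 ≤ 2 * (Real.cosh (κ * r) * Real.sinh (κ * r)) / κ * K := by positivity
  have b3 : 0 ≤ Real.sinh (κ * r) ^ 2 * H := by positivity
  linarith

theorem expansion_le (hκ : 0 < κ) (hH : 0 ≤ H) (hK : 0 ≤ K) (hr : 0 ≤ r) :
    expansion κ H K r ≤ (1 + H / κ + K / κ ^ 2) * Real.exp (2 * κ * r) := by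
  obtain ⟨-, h2, h3, h4, -, -, -⟩ := cosh_sub_sinh_bounds hκ hr
  have hc := h2.trans h3
  rw [exp_two_mul, expansion]
  have c1 : Real.cosh (κ * r) ^ 2 ≤ Real.exp (κ * r) ^ 2 := pow_le_pow_left₀ hc h4 2
  have c2 : Real.cosh (κ * r) * Real.sinh (κ * r) ≤ Real.exp (κ * r) ^ 2 := by
    rw [sq]; exact mul_le_mul h4 (h3.trans h4) h2 (by positivity)
  have c3 : Real.sinh (κ * r) ^ 2 ≤ Real.exp (κ * r) ^ 2 := pow_le_pow_left₀ h2 (h3.trans h4) 2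
  have d2 := mul_le_mul_of_nonneg_right c2 (show 0 ≤ H / κ by positivity)
  have d3 := mul_le_mul_of_nonneg_right c3 (show 0 ≤ K / κ ^ 2 by positivity)
  calc _ = Real.cosh (κ * r) ^ 2 + Real.cosh (κ * r) * Real.sinh (κ * r) * (H / κ) +
      Real.sinh (κ * r) ^ 2 * (K / κ ^ 2) := by ring
    _ ≤ _ := by linarith

theorem extrinsicFactor_nonneg (hκ : 0 < κ) (hH : 0 ≤ H) (hK : 0 ≤ K) (hr : 0 ≤ r) :
    0 ≤ extrinsicFactor κ H K r := by
  obtain ⟨-, h2, h3, -, -, -, -⟩ := cosh_sub_sinh_bounds hκ hr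
  have hc := h2.trans h3
  rw [extrinsicFactor]; positivity

end Expansion

section Surface

variable {S : Type*} [TopologicalSpace S] [ChartedSpace Plane S] [IsManifold (𝓡 2) ∞ S]
  {κ : ℝ} {F₀ N : S → Mink}

/-- The `r`-derivative of `areaFactor`; it is the mean curvature of `Σ_r` times `areaFactor`. -/
noncomputable def areaFactorDeriv (κ : ℝ) (F₀ N : S → Mink) (r : ℝ) (p : S) : ℝ :=
  expansionDeriv κ (surfaceTrace F₀ N p) (surfaceDet F₀ N p) r

/-- The second `r`-derivative of `areaFactor`. -/
noncomputable def areaFactorDeriv2 (κ : ℝ) (F₀ N : S → Mink) (r : ℝ) (p : S) : ℝ :=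
  expansionDeriv2 κ (surfaceTrace F₀ N p) (surfaceDet F₀ N p) r

omit [IsManifold (𝓡 2) ∞ S] in
theorem hasDerivAt_areaFactorDeriv (hκ : 0 < κ) (r : ℝ) (p : S) :
    HasDerivAt (fun s => areaFactorDeriv κ F₀ N s p) (areaFactorDeriv2 κ F₀ N r p) r :=
  hasDerivAt_expansionDeriv hκ _ _ r

theorem continuous_areaFactors (hκ : 0 < κ) (hF : IsConvexSurface κ F₀ N) :
    Continuous (fun q : S × ℝ => areaFactor κ F₀ N q.2 q.1) ∧
    Continuous (fun q : S × ℝ => areaFactorDeriv κ F₀ N q.2 q.1) ∧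
    Continuous (fun q : S × ℝ => areaFactorDeriv2 κ F₀ N q.2 q.1) := by
  have := continuous_surfaceTrace hκ hF
  have := continuous_surfaceDet hκ hF
  refine ⟨?_, ?_, ?_⟩
  · unfold areaFactor expansion; fun_prop
  · unfold areaFactorDeriv expansionDeriv; fun_prop
  · unfold areaFactorDeriv2 expansionDeriv2 expansion extrinsicFactor; fun_prop

theorem areaFactorDeriv_pos (hκ : 0 < κ) (hF : IsConvexSurface κ F₀ N) {r : ℝ} (hr : 0 ≤ r)
    (p : S) : 0 < areaFactorDeriv κ F₀ N r p := by
  have h1 := surfaceTrace_pos hκ hF p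
  have := le_expansionDeriv hκ h1.le (surfaceDet_pos hκ hF p).le hr
  exact lt_of_lt_of_le (by positivity) this

theorem meanCurv_eq_div (hκ : 0 < κ) (hF : IsConvexSurface κ F₀ N) {r : ℝ} (hr : 0 ≤ r) (p : S) :
    meanCurv κ F₀ N r p = areaFactorDeriv κ F₀ N r p / areaFactor κ F₀ N r p :=
  meanCurv_eq hκ hF hr p

/-- The Gauss equation in terms of the area element. -/
theorem leafScalarCurv_mul (hκ : 0 < κ) (hF : IsConvexSurface κ F₀ N) {r : ℝ} (hr : 0 ≤ r) (p : S) :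
    areaFactor κ F₀ N r p * (leafScalarCurv κ F₀ N r p + 6 * κ ^ 2) =
      areaFactorDeriv2 κ F₀ N r p + 2 * κ ^ 2 * areaFactor κ F₀ N r p := by
  have h := (areaFactor_pos hκ hF hr p).ne'
  rw [leafScalarCurv_eq hκ hF hr, areaFactorDeriv2, expansionDeriv2]
  change _ = 2 * κ ^ 2 * areaFactor κ F₀ N r p + _ + _
  field_simp
  ring

theorem areaFactorDeriv2_add_pos (hκ : 0 < κ) (hF : IsConvexSurface κ F₀ N) {r : ℝ} (hr : 0 ≤ r)
    (p : S) : 0 < areaFactorDeriv2 κ F₀ N r p + 2 * κ ^ 2 * areaFactor κ F₀ N r p := by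
  have h1 := areaFactor_pos hκ hF hr p
  have h2 := extrinsicFactor_nonneg hκ (surfaceTrace_pos hκ hF p).le (surfaceDet_pos hκ hF p).le hr
  rw [areaFactorDeriv2, expansionDeriv2]
  change 0 < 2 * κ ^ 2 * areaFactor κ F₀ N r p + _ + _
  positivity

/-- The second derivative of the area element is at least `2 κ²` times the area element; the
difference is `areaFactor * (R^r + 2 κ²)`, that is, twice the extrinsic curvature of the leaf times
the area element. -/
theorem areaFactorDeriv2_sub_nonneg (hκ : 0 < κ) (hF : IsConvexSurface κ F₀ N) {r : ℝ}
    (hr : 0 ≤ r) (p : S) :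
    0 ≤ areaFactorDeriv2 κ F₀ N r p - 2 * κ ^ 2 * areaFactor κ F₀ N r p := by
  have h2 := extrinsicFactor_nonneg hκ (surfaceTrace_pos hκ hF p).le (surfaceDet_pos hκ hF p).le hr
  rw [areaFactorDeriv2, expansionDeriv2]
  change 0 ≤ 2 * κ ^ 2 * areaFactor κ F₀ N r p + _ - _
  linarith

variable [CompactSpace S]

/-- Uniform bounds for the area element: `areaFactor` and its derivative grow like `e^{2κr}`, the
mean curvature differs from `2κ` by `O(e^{-2κr})`, and so does the coefficient of the zeroth order
term in the linearized equation for `u` from `3κ`. -/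
theorem exists_areaFactor_bounds (hκ : 0 < κ) (hF : IsConvexSurface κ F₀ N) [Nonempty S] :
    ∃ C > 0, ∃ m > 0, ∀ p, ∀ r ≥ 0, areaFactor κ F₀ N r p ≤ C * Real.exp (2 * κ * r) ∧
      areaFactorDeriv κ F₀ N r p ≤ C * Real.exp (2 * κ * r) ∧
      m * Real.exp (2 * κ * r) ≤ areaFactorDeriv κ F₀ N r p ∧
      |areaFactorDeriv κ F₀ N r p - 2 * κ * areaFactor κ F₀ N r p| ≤ C ∧
      (3 * κ - C * Real.exp (-(2 * κ * r))) * areaFactorDeriv κ F₀ N r p <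
        areaFactorDeriv2 κ F₀ N r p + 2 * κ ^ 2 * areaFactor κ F₀ N r p := by
  obtain ⟨p₀, -, hp₀⟩ := isCompact_univ.exists_isMinOn univ_nonempty
    (continuous_surfaceTrace hκ hF).continuousOn
  obtain ⟨p₁, -, hp₁⟩ := isCompact_univ.exists_isMaxOn univ_nonempty
    (continuous_surfaceTrace hκ hF).continuousOn
  obtain ⟨p₂, -, hp₂⟩ := isCompact_univ.exists_isMaxOn univ_nonempty
    (continuous_surfaceDet hκ hF).continuousOn
  set h₀ := surfaceTrace F₀ N p₀ with hh₀
  set h₁ := surfaceTrace F₀ N p₁ with hh₁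
  set k₁ := surfaceDet F₀ N p₂ with hk₁
  have h₀pos : 0 < h₀ := surfaceTrace_pos hκ hF p₀
  have h₁pos : 0 < h₁ := surfaceTrace_pos hκ hF p₁
  have k₁pos : 0 < k₁ := surfaceDet_pos hκ hF p₂
  -- bounds for the area element, the error of the mean curvature, and the error in the last claim
  set A := 1 + h₁ / κ + k₁ / κ ^ 2 with hA
  set B := 2 * κ + h₁ + 2 * (k₁ / κ) with hB
  set E := (3 * κ * B + 2 * κ ^ 2 + 1) / (h₀ / 4) with hE
  have hApos : 0 < A := by positivity
  have hBpos : 0 < B := by positivity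
  have hEpos : 0 < E := by positivity
  refine ⟨A + B + 2 * κ * A + E, by positivity, h₀ / 4, by positivity, fun p r hr => ?_⟩
  have H0 : h₀ ≤ surfaceTrace F₀ N p := hp₀ (mem_univ p)
  have H1 : surfaceTrace F₀ N p ≤ h₁ := hp₁ (mem_univ p)
  have K1 : surfaceDet F₀ N p ≤ k₁ := hp₂ (mem_univ p)
  have hH := (surfaceTrace_pos hκ hF p).le
  have hK := (surfaceDet_pos hκ hF p).le
  have ex : 1 ≤ Real.exp (2 * κ * r) := Real.one_le_exp (by positivity)
  have ex' : Real.exp (2 * κ * r) * Real.exp (-(2 * κ * r)) = 1 := by rw [← Real.exp_add]; simp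
  have exn := Real.exp_pos (-(2 * κ * r))
  have f1 : areaFactor κ F₀ N r p ≤ A * Real.exp (2 * κ * r) := by
    refine (expansion_le hκ hH hK hr).trans (mul_le_mul_of_nonneg_right ?_ (by positivity))
    rw [hA]; gcongr
  have f2 : h₀ / 4 * Real.exp (2 * κ * r) ≤ areaFactorDeriv κ F₀ N r p := by
    refine le_trans ?_ (le_expansionDeriv hκ hH hK hr)
    gcongr
  have f3 : |areaFactorDeriv κ F₀ N r p - 2 * κ * areaFactor κ F₀ N r p| ≤ B := by
    refine (abs_expansionDeriv_sub_le hκ hH hK hr).trans ?_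
    rw [hB]; gcongr
  have f4 : areaFactorDeriv2 κ F₀ N r p =
      4 * κ ^ 2 * areaFactor κ F₀ N r p + 2 * (surfaceDet F₀ N p - κ ^ 2) := expansionDeriv2_eq hκ
  refine ⟨f1.trans ?_, ?_, f2, f3.trans ?_, ?_⟩
  · gcongr
    have : 0 ≤ 2 * κ * A := by positivity
    linarith
  · have g1 := (abs_le.1 f3).2
    have g2 := mul_le_mul_of_nonneg_left f1 (show 0 ≤ 2 * κ by positivity)
    have g3 : B ≤ B * Real.exp (2 * κ * r) := le_mul_of_one_le_right hBpos.le ex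
    have g4 : 0 ≤ (A + E) * Real.exp (2 * κ * r) := by positivity
    linarith
  · have : 0 ≤ 2 * κ * A := by positivity
    linarith
  · rw [f4]
    have g1 := (abs_le.1 f3).2
    have g1' := mul_le_mul_of_nonneg_left g1 hκ.le
    -- the error term is dominated by `E e^{-2κr}` times the derivative of the area element
    have g2 : 3 * κ * B + 2 * κ ^ 2 + 1 ≤
        E * Real.exp (-(2 * κ * r)) * areaFactorDeriv κ F₀ N r p := by
      have e1 : 3 * κ * B + 2 * κ ^ 2 + 1 =
          E * Real.exp (-(2 * κ * r)) * (h₀ / 4 * Real.exp (2 * κ * r)) := by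
        have : E * Real.exp (-(2 * κ * r)) * (h₀ / 4 * Real.exp (2 * κ * r)) =
          E * (h₀ / 4) * (Real.exp (2 * κ * r) * Real.exp (-(2 * κ * r))) := by ring
        rw [this, ex', mul_one, hE, div_mul_cancel₀ _ (by positivity)]
      rw [e1]
      exact mul_le_mul_of_nonneg_left f2 (by positivity)
    have g3 : 0 ≤ (A + B + 2 * κ * A) * Real.exp (-(2 * κ * r)) * areaFactorDeriv κ F₀ N r p := by
      have := (areaFactorDeriv_pos hκ hF hr p).le
      positivity
    have hKp := surfaceDet_pos hκ hF p
    linarith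

end Surface

section Estimates

variable {S : Type*} [TopologicalSpace S] [ChartedSpace Plane S] [IsManifold (𝓡 2) ∞ S]
  {κ : ℝ} {F₀ N : S → Mink} {Hin : S → ℝ} {u : S → ℝ → ℝ}

/-! ### Estimates for the lapse -/

omit [IsManifold (𝓡 2) ∞ S] in
theorem IsLapse.isClassical (hu : IsLapse κ F₀ N Hin u) : IsClassical u :=
  ⟨hu.continuousOn, hu.contMDiffOn⟩

/-- The equation for the lapse in terms of the area element. -/
theorem IsLapse.equation' (hu : IsLapse κ F₀ N Hin u) (hκ : 0 < κ) (hF : IsConvexSurface κ F₀ N)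
    (p : S) {r : ℝ} (hr : 0 < r) : 2 * areaFactorDeriv κ F₀ N r p * deriv (u p) r =
      2 * areaFactor κ F₀ N r p * u p r ^ 2 * leafLaplacian κ F₀ N r (fun q => u q r) p +
      (u p r - u p r ^ 3) * (areaFactorDeriv2 κ F₀ N r p + 2 * κ ^ 2 * areaFactor κ F₀ N r p) := by
  have h := hu.equation p r hr
  have h1 := (areaFactor_pos hκ hF hr.le p).ne'
  rw [meanCurv_eq_div hκ hF hr.le] at h
  rw [← leafScalarCurv_mul hκ hF hr.le]
  have h2 : areaFactorDeriv κ F₀ N r p =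
      areaFactor κ F₀ N r p * (areaFactorDeriv κ F₀ N r p / areaFactor κ F₀ N r p) := by
    field_simp
  rw [h2]
  linear_combination areaFactor κ F₀ N r p * h

variable [CompactSpace S]

/-- The lapse stays positive, since it is greater than a multiple of `e^{-r}`. -/
theorem IsLapse.pos (hu : IsLapse κ F₀ N Hin u) (hκ : 0 < κ) (hF : IsConvexSurface κ F₀ N)
    (hHin : ∀ p, 0 < Hin p) (p : S) {r : ℝ} (hr : 0 ≤ r) : 0 < u p r := by
  have hcl := hu.isClassical
  have hne : Nonempty S := ⟨p⟩
  have hpos0 : ∀ q, 0 < u q 0 := fun q => by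
    rw [hu.initial, meanCurv_eq_div hκ hF le_rfl]
    have := areaFactorDeriv_pos hκ hF le_rfl q
    have := areaFactor_pos hκ hF le_rfl q
    have := hHin q
    positivity
  obtain ⟨p₀, -, hp₀⟩ := isCompact_univ.exists_isMinOn univ_nonempty
    (hcl.continuous_slice le_rfl).continuousOn
  set m := min (u p₀ 0) 1 / 2 with hm
  have hm0 : 0 < m := by have := hpos0 p₀; positivity
  have hm1 : m < 1 := by have := min_le_right (u p₀ 0) 1; rw [hm]; linarith
  -- the barrier `m e^{-r}`
  have key := neg_of_first_touch (f := fun q s => m * Real.exp (-s) - u q s) (a := 0) (b := r)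
    ?_ ?_ ?_ p r ⟨hr, le_rfl⟩
  · have := mul_pos hm0 (Real.exp_pos (-r))
    linarith
  · refine ContinuousOn.sub (Continuous.continuousOn (by fun_prop)) ?_
    exact hcl.continuousOn.mono (prod_mono le_rfl fun s hs => hs.1)
  · intro q
    have h1 : u p₀ 0 ≤ u q 0 := hp₀ (mem_univ q)
    have h2 := min_le_left (u p₀ 0) 1
    have h3 := hpos0 p₀
    have : m < u p₀ 0 := by rw [hm]; linarith
    simp
    linarith
  · intro q s hs hz hle
    have hs0 : 0 < s := hs.1
    refine ⟨-(m * Real.exp (-s)) - deriv (u q) s, ?_, ?_⟩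
    · have huq : u q s = m * Real.exp (-s) := by linarith
      have hu0 : 0 < u q s := by rw [huq]; positivity
      have hu1 : u q s < 1 := by
        rw [huq]
        have : Real.exp (-s) < 1 := Real.exp_lt_one_iff.2 (by linarith)
        nlinarith
      have hmin : IsLocalMin (fun q => u q s) q :=
        Eventually.of_forall fun q' => by have := hle q'; simp only; linarith
      have hL := leafLaplacian_nonneg_of_isLocalMin hκ hF hs0.le
        (hcl.contMDiff_slice hs0).contMDiffAt hmin
      have heq := hu.equation' hκ hF q hs0
      have h1 := areaFactor_pos hκ hF hs0.le q
      have h2 := areaFactorDeriv_pos hκ hF hs0.le q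
      have h3 := areaFactorDeriv2_add_pos hκ hF hs0.le q
      have h4 : 0 ≤ u q s - u q s ^ 3 := by
        have : u q s - u q s ^ 3 = u q s * ((1 - u q s) * (1 + u q s)) := by ring
        rw [this]
        have := sub_pos.2 hu1
        positivity
      have h5 : 0 ≤ 2 * areaFactorDeriv κ F₀ N s q * deriv (u q) s := by
        rw [heq]; positivity
      have h6 : 0 ≤ deriv (u q) s := nonneg_of_mul_nonneg_right h5 (by positivity)
      rw [← huq]
      linarith
    · have h1 : HasDerivAt (fun s => m * Real.exp (-s)) (-(m * Real.exp (-s))) s := by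
        have := ((hasDerivAt_neg s).exp).const_mul m
        simpa using this
      exact h1.sub (hcl.hasDerivAt q hs0)

/-- A barrier for the deviation of the lapse from `1`. Its decay rate `3κ - C e^{-2κr}` is smaller
than the coefficient of the zeroth order term in the linearized equation for the lapse. -/
noncomputable def barrier (κ C r : ℝ) : ℝ :=
  Real.exp (-(3 * κ * r) - C / (2 * κ) * Real.exp (-(2 * κ * r)))

theorem barrier_pos (κ C r : ℝ) : 0 < barrier κ C r := Real.exp_pos _

theorem barrier_le {κ C : ℝ} (hκ : 0 < κ) (hC : 0 < C) (r : ℝ) :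
    barrier κ C r ≤ Real.exp (-(3 * κ * r)) := by
  refine Real.exp_le_exp.2 ?_
  have : 0 ≤ C / (2 * κ) * Real.exp (-(2 * κ * r)) := by positivity
  linarith

theorem hasDerivAt_barrier {κ : ℝ} (hκ : 0 < κ) (C r : ℝ) : HasDerivAt (barrier κ C)
    (-(3 * κ - C * Real.exp (-(2 * κ * r))) * barrier κ C r) r := by
  have h1 : HasDerivAt (fun s : ℝ => -(2 * κ * s)) (-(2 * κ)) r := by
    simpa using ((hasDerivAt_id r).const_mul (2 * κ)).fun_neg
  have h2 : HasDerivAt (fun s : ℝ => -(3 * κ * s)) (-(3 * κ)) r := by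
    simpa using ((hasDerivAt_id r).const_mul (3 * κ)).fun_neg
  have := (h2.sub (h1.exp.const_mul (C / (2 * κ)))).exp
  refine this.congr_deriv ?_
  rw [barrier]
  simp only [Pi.sub_apply]
  field_simp
  ring

theorem continuous_barrier (κ C : ℝ) : Continuous (barrier κ C) := by
  unfold barrier; fun_prop

theorem one_sub_one_div_le {x : ℝ} (hx : 0 < x) : 1 - 1 / x ≤ x - 1 := by
  have e : x - 1 - (1 - 1 / x) = (x - 1) ^ 2 / x := by field_simp
  have : 0 ≤ (x - 1) ^ 2 / x := by positivity
  linarith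

/-- The lapse converges to `1` like `e^{-3κr}`, by the maximum principle. -/
theorem IsLapse.exists_bound (hu : IsLapse κ F₀ N Hin u) (hκ : 0 < κ)
    (hF : IsConvexSurface κ F₀ N) (hHin : ∀ p, 0 < Hin p) [Nonempty S] :
    ∃ B > 0, ∀ p, ∀ r ≥ 0, |1 - 1 / u p r| ≤ B * Real.exp (-(3 * κ * r)) := by
  have hcl := hu.isClassical
  have hpos := fun p r hr => hu.pos hκ hF hHin p (r := r) hr
  obtain ⟨C, hC, m, hm, hb⟩ := exists_areaFactor_bounds hκ hF
  obtain ⟨B₁, hB₁⟩ := isCompact_univ.exists_bound_of_continuousOn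
    (hcl.continuous_slice le_rfl).continuousOn
  obtain ⟨B₂, hB₂⟩ := isCompact_univ.exists_bound_of_continuousOn
    (((hcl.continuous_slice le_rfl).pow 2).inv₀ fun p => by
      have := hpos p 0 le_rfl; simp only [Pi.pow_apply]; positivity).continuousOn
  set B := (|B₁| + |B₂| + 1) / barrier κ C 0 with hB
  have hB0 : 0 < B := by have := barrier_pos κ C 0; positivity
  have hBb : B * barrier κ C 0 = |B₁| + |B₂| + 1 := div_mul_cancel₀ _ (barrier_pos κ C 0).ne'
  refine ⟨B, hB0, fun p r hr => ?_⟩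
  have hbar := barrier_pos κ C
  have hcB : ContinuousOn (fun q : S × ℝ => B * barrier κ C q.2) (univ ×ˢ Icc 0 r) :=
    (continuous_const.mul ((continuous_barrier κ C).comp continuous_snd)).continuousOn
  have hcu : ContinuousOn (fun q : S × ℝ => u q.1 q.2) (univ ×ˢ Icc 0 r) :=
    hcl.continuousOn.mono (prod_mono le_rfl fun s hs => hs.1)
  have upper : u p r - 1 - B * barrier κ C r < 0 := by
    refine neg_of_first_touch (f := fun q s => u q s - 1 - B * barrier κ C s) (a := 0) (b := r)
      ((hcu.sub continuousOn_const).sub hcB) ?_ ?_ p r ⟨hr, le_rfl⟩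
    · intro q
      have h1 := hB₁ q (mem_univ q)
      rw [Real.norm_eq_abs] at h1
      simp only [hBb]
      linarith [le_abs_self (u q 0), le_abs_self B₁, abs_nonneg B₂]
    · intro q s hs hz hle
      have hs0 : 0 < s := hs.1
      refine ⟨_, ?_, ((hcl.hasDerivAt q hs0).sub_const 1).sub
        ((hasDerivAt_barrier hκ C s).const_mul B)⟩
      have hmax : IsLocalMax (fun q => u q s) q :=
        Eventually.of_forall fun q' => by have := hle q'; simp only; linarith
      have hL := leafLaplacian_nonpos_of_isLocalMax hκ hF hs0.le
        (hcl.contMDiff_slice hs0).contMDiffAt hmax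
      have heq := hu.equation' hκ hF q hs0
      have h1 := areaFactor_pos hκ hF hs0.le q
      have h2 := areaFactorDeriv_pos hκ hF hs0.le q
      have h3 := areaFactorDeriv2_add_pos hκ hF hs0.le q
      obtain ⟨-, -, -, -, h4⟩ := hb q s hs0.le
      have hv : u q s - 1 = B * barrier κ C s := by linarith
      have hv0 : 0 < B * barrier κ C s := mul_pos hB0 (hbar s)
      have hL' : 2 * areaFactor κ F₀ N s q * u q s ^ 2 *
          leafLaplacian κ F₀ N s (fun q => u q s) q ≤ 0 :=
        mul_nonpos_of_nonneg_of_nonpos (by positivity) hL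
      have h5 : u q s - u q s ^ 3 ≤ -(2 * (B * barrier κ C s)) := by
        rw [← hv] at hv0 ⊢
        have : u q s - u q s ^ 3 = -(2 * (u q s - 1)) -
          (u q s - 1) ^ 2 * (3 + (u q s - 1)) := by ring
        rw [this]
        have : 0 ≤ (u q s - 1) ^ 2 * (3 + (u q s - 1)) := by positivity
        linarith
      have h6 := mul_le_mul_of_nonneg_right h5 h3.le
      have h7 := mul_lt_mul_of_pos_left h4 hv0
      have h8 : areaFactorDeriv κ F₀ N s q * (deriv (u q) s - B *
          (-(3 * κ - C * Real.exp (-(2 * κ * s))) * barrier κ C s)) < 0 := by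
        linarith
      exact neg_of_mul_neg_right h8 h2.le
  -- in terms of `u⁻² - 1` the zeroth order term of the equation is linear
  have lower : (u p r ^ 2)⁻¹ - 1 - B * barrier κ C r < 0 := by
    refine neg_of_first_touch (f := fun q s => (u q s ^ 2)⁻¹ - 1 - B * barrier κ C s) (a := 0)
      (b := r) ((((hcu.pow 2).inv₀ fun q hq => ?_).sub continuousOn_const).sub hcB) ?_ ?_ p r
      ⟨hr, le_rfl⟩
    · have := hpos q.1 q.2 hq.2.1
      exact (pow_pos this 2).ne'
    · intro q
      have h1 := hB₂ q (mem_univ q)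
      rw [Real.norm_eq_abs] at h1
      have h2 : (u q 0 ^ 2)⁻¹ ≤ |B₂| := (le_abs_self _).trans (h1.trans (le_abs_self _))
      simp only [hBb]
      linarith [le_abs_self (u q 0 ^ 2)⁻¹, le_abs_self B₂, abs_nonneg B₁]
    · intro q s hs hz hle
      have hs0 : 0 < s := hs.1
      have huq := hpos q s hs0.le
      refine ⟨_, ?_, ((((hcl.hasDerivAt q hs0).pow 2).inv
        (by simp only [Pi.pow_apply]; positivity)).sub_const 1).sub
        ((hasDerivAt_barrier hκ C s).const_mul B)⟩
      have hmin : IsLocalMin (fun q => u q s) q := by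
        refine Eventually.of_forall fun q' => ?_
        have h1 := hle q'
        have h2 := hpos q' s hs0.le
        have h3 : (u q' s ^ 2)⁻¹ ≤ (u q s ^ 2)⁻¹ := by linarith
        rw [inv_le_inv₀ (by positivity) (by positivity)] at h3
        exact (pow_le_pow_iff_left₀ huq.le h2.le two_ne_zero).1 h3
      have hL := leafLaplacian_nonneg_of_isLocalMin hκ hF hs0.le
        (hcl.contMDiff_slice hs0).contMDiffAt hmin
      have heq := hu.equation' hκ hF q hs0
      have h1 := areaFactor_pos hκ hF hs0.le q
      have h2 := areaFactorDeriv_pos hκ hF hs0.le q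
      obtain ⟨-, -, -, -, h4⟩ := hb q s hs0.le
      have hv : (u q s ^ 2)⁻¹ - 1 = B * barrier κ C s := by linarith
      have hv0 : 0 < B * barrier κ C s := mul_pos hB0 (hbar s)
      have hL' : 0 ≤ 2 * areaFactor κ F₀ N s q * u q s ^ 2 *
          leafLaplacian κ F₀ N s (fun q => u q s) q := by positivity
      have h5 : u q s - u q s ^ 3 = u q s ^ 3 * (B * barrier κ C s) := by
        rw [← hv]; field_simp
      rw [h5] at heq
      have h7 := mul_lt_mul_of_pos_left h4 hv0
      -- the time derivative of `u⁻²` is `-2 u⁻³` times that of `u`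
      have h9 : u q s ^ 3 * (B * barrier κ C s) * (areaFactorDeriv2 κ F₀ N s q +
          2 * κ ^ 2 * areaFactor κ F₀ N s q) ≤
          2 * areaFactorDeriv κ F₀ N s q * deriv (u q) s := by linarith
      have h10 : (B * barrier κ C s) * (areaFactorDeriv2 κ F₀ N s q +
          2 * κ ^ 2 * areaFactor κ F₀ N s q) ≤
          areaFactorDeriv κ F₀ N s q * (2 * deriv (u q) s / u q s ^ 3) := by
        have h11 : 0 < u q s ^ 3 := by positivity
        have h12 : u q s ^ 3 * (areaFactorDeriv κ F₀ N s q * (2 * deriv (u q) s / u q s ^ 3)) =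
            2 * areaFactorDeriv κ F₀ N s q * deriv (u q) s := by field_simp
        refine le_of_mul_le_mul_left ?_ h11
        rw [h12]; linarith
      have h13 : -(↑2 * u q s ^ (2 - 1) * deriv (u q) s) / (u q s ^ 2) ^ 2 =
          -(2 * deriv (u q) s / u q s ^ 3) := by
        rw [show 2 - 1 = 1 from rfl, pow_one]
        field_simp
      have h8 : areaFactorDeriv κ F₀ N s q * (-(2 * deriv (u q) s / u q s ^ 3) - B *
          (-(3 * κ - C * Real.exp (-(2 * κ * s))) * barrier κ C s)) < 0 := by
        linarith
      have := neg_of_mul_neg_right h8 h2.le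
      rw [← h13] at this
      simpa using this
  have hup := hpos p r hr
  have hbl := mul_le_mul_of_nonneg_left (barrier_le hκ hC r) hB0.le
  rw [abs_le]
  constructor
  · rcases le_or_gt 1 (u p r) with h1 | h1
    · have : 1 / u p r ≤ 1 := (div_le_one hup).2 h1
      have := mul_pos hB0 (Real.exp_pos (-(3 * κ * r)))
      linarith
    · have h2 : 1 / u p r ≤ (u p r ^ 2)⁻¹ := by
        rw [one_div, inv_le_inv₀ hup (by positivity)]
        nlinarith
      linarith
  · rcases le_or_gt 1 (u p r) with h1 | h1
    · have h2 := one_sub_one_div_le hup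
      linarith
    · have : 1 ≤ 1 / u p r := (one_le_div hup).2 h1.le
      have := mul_pos hB0 (Real.exp_pos (-(3 * κ * r)))
      linarith

/-! ### Positivity of solutions of the backward equation -/

omit [IsManifold (𝓡 2) ∞ S] [CompactSpace S] in
theorem IsBackwardSolution.isClassical {data : S → ℝ} {W : S → ℝ → ℝ}
    (hW : IsBackwardSolution κ F₀ N u data W) : IsClassical W :=
  ⟨hW.continuousOn, hW.contMDiffOn⟩

/-- The growth rate of the barrier `exp (κ r + b e^{-2κr})` for the backward equation. -/
theorem hasDerivAt_exp_barrier (κ b r : ℝ) :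
    HasDerivAt (fun s => Real.exp (κ * s + b * Real.exp (-(2 * κ * s))))
      ((κ - 2 * κ * b * Real.exp (-(2 * κ * r))) *
        Real.exp (κ * r + b * Real.exp (-(2 * κ * r)))) r := by
  have h1 : HasDerivAt (fun s : ℝ => -(2 * κ * s)) (-(2 * κ)) r := by
    simpa using ((hasDerivAt_id r).const_mul (2 * κ)).fun_neg
  have h2 : HasDerivAt (fun s : ℝ => κ * s) κ r := by
    simpa using (hasDerivAt_id r).const_mul κ
  have := (h2.add (h1.exp.const_mul b)).exp
  refine this.congr_deriv ?_
  simp only [Pi.add_apply]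
  ring

/-- The maximum principle, backwards in time from infinity: nonnegative data at infinity give a
nonnegative solution. -/
theorem IsBackwardSolution.nonneg {data : S → ℝ} {W : S → ℝ → ℝ}
    (hW : IsBackwardSolution κ F₀ N u data W) (hu : IsLapse κ F₀ N Hin u) (hκ : 0 < κ)
    (hF : IsConvexSurface κ F₀ N) (hHin : ∀ p, 0 < Hin p) (hdata : ∀ p, 0 ≤ data p)
    (p : S) {r : ℝ} (hr : 0 < r) : 0 ≤ W p r := by
  have hne : Nonempty S := ⟨p⟩
  have hcl := hW.isClassical
  have hpos := fun p r hr => hu.pos hκ hF hHin p (r := r) hr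
  obtain ⟨C, hC, m, hm, hb⟩ := exists_areaFactor_bounds hκ hF
  obtain ⟨B, hB, hBu⟩ := hu.exists_bound hκ hF hHin
  -- after division by the mean curvature, the coefficient `2κ² u` of the zeroth order term is at
  -- least `κ - O(e^{-2κr})`, so that `exp (κ r + b e^{-2κr})` is a barrier
  set b := (2 * κ * B * C + C + 1) / (2 * m) with hbdef
  have hb0 : 0 < b := by positivity
  have hcoef : ∀ q, ∀ s > 0, (κ - 2 * κ * b * Real.exp (-(2 * κ * s))) *
      areaFactorDeriv κ F₀ N s q < 2 * κ ^ 2 * (u q s * areaFactor κ F₀ N s q) := by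
    intro q s hs
    obtain ⟨h1, -, h2, h3, -⟩ := hb q s hs.le
    have huq := hpos q s hs.le
    have hA := areaFactor_pos hκ hF hs.le q
    have e1 : Real.exp (2 * κ * s) * Real.exp (-(2 * κ * s)) = 1 := by rw [← Real.exp_add]; simp
    have h4 : -(B * Real.exp (-(2 * κ * s))) ≤ u q s - 1 := by
      rcases le_or_gt 1 (u q s) with h | h
      · have : 0 < B * Real.exp (-(2 * κ * s)) := by positivity
        linarith
      · have h5 := (abs_le.1 (hBu q s hs.le)).1
        have h6 := one_sub_one_div_le huq
        have h7 : Real.exp (-(3 * κ * s)) ≤ Real.exp (-(2 * κ * s)) := by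
          refine Real.exp_le_exp.2 ?_
          have := mul_pos hκ hs
          linarith
        have := mul_le_mul_of_nonneg_left h7 hB.le
        linarith
    have h8 : -(B * C) ≤ (u q s - 1) * areaFactor κ F₀ N s q := by
      have g1 := mul_le_mul_of_nonneg_right h4 hA.le
      have g2 := mul_le_mul_of_nonneg_left h1
        (show 0 ≤ B * Real.exp (-(2 * κ * s)) by positivity)
      have g3 : B * Real.exp (-(2 * κ * s)) * (C * Real.exp (2 * κ * s)) = B * C := by
        linear_combination B * C * e1
      linarith
    have h9 : 2 * κ * B * C + C + 1 ≤
        2 * b * Real.exp (-(2 * κ * s)) * areaFactorDeriv κ F₀ N s q := by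
      have g1 := mul_le_mul_of_nonneg_left h2
        (show 0 ≤ 2 * b * Real.exp (-(2 * κ * s)) by positivity)
      have g2 : 2 * b * Real.exp (-(2 * κ * s)) * (m * Real.exp (2 * κ * s)) =
          2 * κ * B * C + C + 1 := by
        have : 2 * b * m = 2 * κ * B * C + C + 1 := by
          rw [hbdef]; field_simp
        linear_combination 2 * b * m * e1 + this
      linarith
    have h10 := (abs_le.1 h3).2
    have h11 := mul_le_mul_of_nonneg_left h10 hκ.le
    have h12 := mul_le_mul_of_nonneg_left h9 hκ.le
    have h13 := mul_le_mul_of_nonneg_left h8 (show 0 ≤ 2 * κ ^ 2 by positivity)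
    linarith
  set ψ : ℝ → ℝ := fun s => Real.exp (κ * s + b * Real.exp (-(2 * κ * s))) with hψ
  have hψ0 : ∀ s, 0 < ψ s := fun s => Real.exp_pos _
  have key : ∀ δ > 0, -(W p r) - δ * ψ r < 0 := by
    intro δ hδ
    have hlim := (Metric.tendstoUniformly_iff.1 hW.limit δ hδ).and (eventually_ge_atTop r)
    obtain ⟨R, hR, hrR⟩ := hlim.exists
    refine neg_of_last_touch (f := fun q s => -(W q s) - δ * ψ s) (a := r) (b := R) ?_ ?_ ?_ p r
      ⟨le_rfl, hrR⟩
    · refine ContinuousOn.sub (hcl.continuousOn.mono (prod_mono le_rfl fun s hs => ?_)).neg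
        (Continuous.continuousOn (by fun_prop))
      exact hr.le.trans hs.1
    · intro q
      have h1 := hR q
      rw [Real.dist_eq] at h1
      have h2 := (abs_lt.1 h1).2
      have h3 := hdata q
      have e1 : Real.exp (κ * R) * Real.exp (-(κ * R)) = 1 := by rw [← Real.exp_add]; simp
      have h4 : Real.exp (κ * R) ≤ ψ R := by
        refine Real.exp_le_exp.2 ?_
        have : 0 ≤ b * Real.exp (-(2 * κ * R)) := by positivity
        linarith
      have h5 : -δ < Real.exp (-(κ * R)) * W q R := by linarith
      have h6 := mul_lt_mul_of_pos_left h5 (Real.exp_pos (κ * R))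
      have h7 := mul_le_mul_of_nonneg_left h4 hδ.le
      have h8 : Real.exp (κ * R) * (Real.exp (-(κ * R)) * W q R) = W q R := by
        rw [← mul_assoc, e1, one_mul]
      linarith
    · intro q s hs hz hle
      have hs0 : 0 < s := hr.trans_le hs.1
      refine ⟨_, ?_, (hcl.hasDerivAt q hs0).neg.sub ((hasDerivAt_exp_barrier κ b s).const_mul δ)⟩
      have hWq : W q s = -(δ * ψ s) := by linarith
      have hmin : IsLocalMin (fun q => W q s) q :=
        Eventually.of_forall fun q' => by have := hle q'; simp only; linarith
      have hL := leafLaplacian_nonneg_of_isLocalMin hκ hF hs0.le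
        (hcl.contMDiff_slice hs0).contMDiffAt hmin
      have heq := hW.equation q s hs0
      have h1 := areaFactor_pos hκ hF hs0.le q
      have h2 := areaFactorDeriv_pos hκ hF hs0.le q
      have huq := hpos q s hs0.le
      rw [meanCurv_eq_div hκ hF hs0.le] at heq
      have h3 : areaFactorDeriv κ F₀ N s q * deriv (W q) s = u q s * areaFactor κ F₀ N s q *
          (-leafLaplacian κ F₀ N s (fun q => W q s) q + 2 * κ ^ 2 * W q s) := by
        rw [← heq]; field_simp
      have h4 := mul_lt_mul_of_pos_left (hcoef q s hs0) (mul_pos hδ (hψ0 s))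
      have h5 : 0 ≤ u q s * areaFactor κ F₀ N s q *
          leafLaplacian κ F₀ N s (fun q => W q s) q := by positivity
      rw [hWq] at h3
      have h6 : 0 < areaFactorDeriv κ F₀ N s q * (-deriv (W q) s -
          δ * ((κ - 2 * κ * b * Real.exp (-(2 * κ * s))) * ψ s)) := by
        linarith
      exact pos_of_mul_pos_right h6 h2.le
  have h1 : Tendsto (fun δ : ℝ => -(W p r) - δ * ψ r) (𝓝[>] 0) (𝓝 (-(W p r) - 0 * ψ r)) :=
    ((Continuous.tendsto (by fun_prop) 0).mono_left nhdsWithin_le_nhds)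
  have h2 := le_of_tendsto h1 (eventually_mem_nhdsWithin.mono fun δ hδ => (key δ hδ).le)
  linarith

end Estimates

/-! ### The norm of a Killing spinor -/

/-- The squared norm of a Killing spinor is a linear function of the position vector. -/
theorem sum_norm_killingSpinor_sq {κ : ℝ} (hκ : κ ≠ 0) (a : Fin 2 → ℂ) (ρ θ ψ : ℝ) :
    ∑ i, ‖killingSpinor κ a ρ θ ψ i‖ ^ 2 = -κ * lorentz (polar κ ρ θ ψ) (zeta a) := by
  have hθ := Real.sin_sq_add_cos_sq (θ / 2)
  have hψ := Real.sin_sq_add_cos_sq (ψ / 2)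
  have e1 : Real.exp (κ * ρ / 2) * Real.exp (κ * ρ / 2) = Real.exp (κ * ρ) := by
    rw [← Real.exp_add]; ring_nf
  have e2 : Real.exp (-(κ * ρ / 2)) * Real.exp (-(κ * ρ / 2)) = Real.exp (-(κ * ρ)) := by
    rw [← Real.exp_add]; ring_nf
  have c1 : Real.cos θ = Real.cos (θ / 2) ^ 2 - Real.sin (θ / 2) ^ 2 := by
    rw [← Real.cos_two_mul']; ring_nf
  have s1 : Real.sin θ = 2 * Real.sin (θ / 2) * Real.cos (θ / 2) := by
    rw [← Real.sin_two_mul]; ring_nf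
  have c2 : Real.cos ψ = Real.cos (ψ / 2) ^ 2 - Real.sin (ψ / 2) ^ 2 := by
    rw [← Real.cos_two_mul']; ring_nf
  have s2 : Real.sin ψ = 2 * Real.sin (ψ / 2) * Real.cos (ψ / 2) := by
    rw [← Real.sin_two_mul]; ring_nf
  -- the exponentials and trigonometric functions of the half angles as real numbers
  have f1 : Complex.exp (κ * ρ / 2 + Complex.I * ψ / 2) =
      (Real.exp (κ * ρ / 2) : ℂ) * (Real.cos (ψ / 2) + Real.sin (ψ / 2) * Complex.I) := by
    rw [Complex.exp_add, show Complex.I * ψ / 2 = ((ψ / 2 : ℝ) : ℂ) * Complex.I by push_cast; ring,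
      Complex.exp_mul_I]
    push_cast; rfl
  have f2 : Complex.exp (κ * ρ / 2 - Complex.I * ψ / 2) =
      (Real.exp (κ * ρ / 2) : ℂ) * (Real.cos (ψ / 2) - Real.sin (ψ / 2) * Complex.I) := by
    rw [sub_eq_add_neg, Complex.exp_add,
      show -(Complex.I * ψ / 2) = ((-(ψ / 2) : ℝ) : ℂ) * Complex.I by push_cast; ring,
      Complex.exp_mul_I, ← Complex.ofReal_cos, ← Complex.ofReal_sin, Real.cos_neg, Real.sin_neg]
    push_cast; ring
  have f3 : Complex.exp (-(κ * ρ / 2) + Complex.I * ψ / 2) =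
      (Real.exp (-(κ * ρ / 2)) : ℂ) * (Real.cos (ψ / 2) + Real.sin (ψ / 2) * Complex.I) := by
    rw [Complex.exp_add, show Complex.I * ψ / 2 = ((ψ / 2 : ℝ) : ℂ) * Complex.I by push_cast; ring,
      Complex.exp_mul_I]
    push_cast; rfl
  have f4 : Complex.exp (-(κ * ρ / 2) - Complex.I * ψ / 2) =
      (Real.exp (-(κ * ρ / 2)) : ℂ) * (Real.cos (ψ / 2) - Real.sin (ψ / 2) * Complex.I) := by
    rw [sub_eq_add_neg, Complex.exp_add,
      show -(Complex.I * ψ / 2) = ((-(ψ / 2) : ℝ) : ℂ) * Complex.I by push_cast; ring,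
      Complex.exp_mul_I, ← Complex.ofReal_cos, ← Complex.ofReal_sin, Real.cos_neg, Real.sin_neg]
    push_cast; ring
  have f5 : Complex.cos ((θ : ℂ) / 2) = (Real.cos (θ / 2) : ℂ) := by push_cast; rfl
  have f6 : Complex.sin ((θ : ℂ) / 2) = (Real.sin (θ / 2) : ℂ) := by push_cast; rfl
  have r1 : -κ * lorentz (polar κ ρ θ ψ) (zeta a) =
      -(Real.sinh (κ * ρ) * Real.cos θ * zeta a 0 +
        Real.sinh (κ * ρ) * Real.sin θ * Real.cos ψ * zeta a 1 +
        Real.sinh (κ * ρ) * Real.sin θ * Real.sin ψ * zeta a 2 -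
        Real.cosh (κ * ρ) * zeta a 3) := by
    simp [lorentz, polar]; field_simp; ring
  rw [r1, Real.sinh_eq, Real.cosh_eq, ← e1, ← e2, c1, s1, c2, s2]
  simp only [Fin.sum_univ_two, killingSpinor, Matrix.mulVec, dotProduct, f1, f2, f3, f4, f5, f6,
    zeta, ← Complex.normSq_eq_norm_sq]
  generalize Real.exp (κ * ρ / 2) = A
  generalize Real.exp (-(κ * ρ / 2)) = B
  generalize Real.cos (θ / 2) = c at *
  generalize Real.sin (θ / 2) = s at *
  generalize Real.cos (ψ / 2) = C at *
  generalize Real.sin (ψ / 2) = T at *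
  simp [Complex.normSq_apply]
  linear_combination (A ^ 2 * (c ^ 2 * ((a 0).re ^ 2 + (a 0).im ^ 2) +
      s ^ 2 * ((a 1).re ^ 2 + (a 1).im ^ 2)) +
    B ^ 2 * (s ^ 2 * ((a 0).re ^ 2 + (a 0).im ^ 2) +
      c ^ 2 * ((a 1).re ^ 2 + (a 1).im ^ 2))) * hψ +
    (A ^ 2 + B ^ 2) / 2 * ((a 0).re ^ 2 + (a 0).im ^ 2 + (a 1).re ^ 2 + (a 1).im ^ 2) * hθ

theorem killingNormSq_eq {κ : ℝ} (hκ : 0 < κ) (a : Fin 2 → ℂ) {X : Mink}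
    (hX : X ∈ hyperboloid κ) : killingNormSq κ a X = -κ * lorentz X (zeta a) := by
  rw [killingNormSq, sum_norm_killingSpinor_sq hκ.ne', polar_eq hκ hX]

section Spinor

variable {S : Type*} [TopologicalSpace S] [ChartedSpace Plane S] {κ : ℝ} {F₀ N : S → Mink}

theorem leafKillingNormSq_eq (hκ : 0 < κ) (hF : IsConvexSurface κ F₀ N) (a : Fin 2 → ℂ) (p : S)
    (r : ℝ) : leafKillingNormSq κ F₀ N a p r = -κ * lorentz (leaf κ F₀ N r p) (zeta a) :=
  killingNormSq_eq hκ a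
    (leaf_mem_hyperboloid hκ (hF.mem_hyperboloid p) (hF.normal_unit p) (hF.normal_tangent p) r)

/-- The rescaled squared norm of the Killing spinor differs from its limit by `O(e^{-2κr})`. -/
theorem exp_mul_leafKillingNormSq (hκ : 0 < κ) (hF : IsConvexSurface κ F₀ N) (a : Fin 2 → ℂ)
    (p : S) (r : ℝ) : Real.exp (-(κ * r)) * leafKillingNormSq κ F₀ N a p r =
      -lorentz (lightConeMap κ F₀ N p) (zeta a) -
        Real.exp (-(2 * κ * r)) * (lorentz (κ • F₀ p - N p) (zeta a) / 2) := by
  have e2 : Real.exp (-(2 * κ * r)) = Real.exp (-(κ * r)) * Real.exp (-(κ * r)) := by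
    rw [← Real.exp_add]; ring_nf
  have e3 : Real.exp (-(κ * r)) * Real.exp (κ * r) = 1 := by
    rw [← Real.exp_add]; simp
  rw [leafKillingNormSq_eq hκ hF, leaf, lightConeMap, lorentz_add_left, lorentz_smul_left,
    lorentz_smul_left, lorentz_smul_left, lorentz_add_left, lorentz_sub_left, lorentz_smul_left,
    Real.cosh_eq, Real.sinh_eq, e2]
  field_simp
  linear_combination (-κ * lorentz (F₀ p) (zeta a) - lorentz (N p) (zeta a)) * e3

theorem continuous_lorentz_zeta (a : Fin 2 → ℂ) {Y : Type*} [TopologicalSpace Y] {f : Y → Mink}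
    (hf : Continuous f) : Continuous fun y => lorentz (f y) (zeta a) := by
  unfold lorentz
  fun_prop

theorem continuous_leafKillingNormSq (hκ : 0 < κ) (hF : IsConvexSurface κ F₀ N) (a : Fin 2 → ℂ)
    (r : ℝ) : Continuous fun p => leafKillingNormSq κ F₀ N a p r := by
  have h1 := hF.smooth.continuous
  have h2 := hF.normal_smooth.continuous
  simp only [leafKillingNormSq_eq hκ hF]
  refine continuous_const.mul (continuous_lorentz_zeta a ?_)
  unfold leaf
  fun_prop

theorem tendstoUniformly_leafKillingNormSq [CompactSpace S] (hκ : 0 < κ)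
    (hF : IsConvexSurface κ F₀ N) (a : Fin 2 → ℂ) :
    TendstoUniformly (fun r p => Real.exp (-(κ * r)) * leafKillingNormSq κ F₀ N a p r)
      (fun p => -lorentz (lightConeMap κ F₀ N p) (zeta a)) atTop := by
  have h1 := hF.smooth.continuous
  have h2 := hF.normal_smooth.continuous
  have hc : Continuous fun p => lorentz (κ • F₀ p - N p) (zeta a) / 2 :=
    (continuous_lorentz_zeta a (by fun_prop)).div_const 2
  obtain ⟨M, hM⟩ := isCompact_univ.exists_bound_of_continuousOn hc.continuousOn
  have h0 : Tendsto (fun r : ℝ => Real.exp (-(2 * κ * r)) * M) atTop (𝓝 (0 * M)) := by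
    refine (Real.tendsto_exp_neg_atTop_nhds_zero.comp ?_).mul_const M
    exact tendsto_id.const_mul_atTop (by positivity)
  rw [zero_mul] at h0
  refine Metric.tendstoUniformly_iff.2 fun ε hε => ?_
  filter_upwards [h0.eventually_lt_const hε] with r hr p
  rw [exp_mul_leafKillingNormSq hκ hF, dist_eq_norm, sub_sub_cancel, norm_mul,
    Real.norm_of_nonneg (Real.exp_pos _).le]
  exact (mul_le_mul_of_nonneg_left (hM p (mem_univ p)) (Real.exp_pos _).le).trans_lt hr

/-- The data at infinity are nonnegative, being limits of squared norms. -/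
theorem neg_lorentz_lightConeMap_zeta_nonneg [CompactSpace S] (hκ : 0 < κ)
    (hF : IsConvexSurface κ F₀ N) (a : Fin 2 → ℂ) (p : S) :
    0 ≤ -lorentz (lightConeMap κ F₀ N p) (zeta a) :=
  ge_of_tendsto' ((tendstoUniformly_leafKillingNormSq hκ hF a).tendsto_at p) fun r =>
    mul_nonneg (Real.exp_pos _).le <| by
      unfold leafKillingNormSq killingNormSq
      positivity

end Spinor

/-! ### Linear combinations of solutions of the backward equation -/

section Linear

variable {S : Type*} [TopologicalSpace S] [ChartedSpace Plane S]
  {κ : ℝ} {F₀ N : S → Mink} {u : S → ℝ → ℝ}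

/-- Linear combinations of solutions of the backward equation are solutions. -/
theorem IsBackwardSolution.sum [IsManifold (𝓡 2) ∞ S] (hκ : 0 < κ) (hF : IsConvexSurface κ F₀ N)
    {ι : Type*} [Fintype ι] (c : ι → ℝ) {data : ι → S → ℝ} {W : ι → S → ℝ → ℝ}
    (hW : ∀ i, IsBackwardSolution κ F₀ N u (data i) (W i)) :
    IsBackwardSolution κ F₀ N u (fun p => ∑ i, c i * data i p) fun p r => ∑ i, c i * W i p r where
  continuousOn := continuousOn_finsetSum _ fun i _ =>
    continuousOn_const.mul (hW i).continuousOn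
  contMDiffOn := contMDiffOn_finsetSum fun i _ => contMDiffOn_const.mul (hW i).contMDiffOn
  equation p r hr := by
    have h1 : HasDerivAt (fun s => ∑ i, c i * W i p s) (∑ i, c i * deriv (W i p) r) r :=
      HasDerivAt.fun_sum fun i _ => ((hW i).isClassical.hasDerivAt p hr).const_mul (c i)
    rw [h1.deriv, leafLaplacian_sum (f := fun i q => c i * W i q r) hκ hF hr.le _ fun i =>
      contMDiff_const.mul ((hW i).isClassical.contMDiff_slice hr)]
    simp only [leafLaplacian_const_mul, Finset.mul_sum, ← Finset.sum_neg_distrib,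
      ← Finset.sum_add_distrib]
    refine Finset.sum_congr rfl fun i _ => ?_
    linear_combination c i * (hW i).equation p r hr
  limit := by
    have h1 : ∀ T : Finset ι, TendstoUniformly
        (fun r p => Real.exp (-(κ * r)) * ∑ i ∈ T, c i * W i p r)
        (fun p => ∑ i ∈ T, c i * data i p) atTop := by
      intro T
      classical
      induction T using Finset.induction_on with
      | empty =>
        simp only [Finset.sum_empty, mul_zero]
        exact Metric.tendstoUniformly_iff.2 fun ε hε => by simp [hε]
      | insert i T hi ih =>
        have h2 : TendstoUniformly (fun r p => c i * (Real.exp (-(κ * r)) * W i p r))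
            (fun p => c i * data i p) atTop :=
          (uniformContinuous_const_smul (c i)).comp_tendstoUniformly (hW i).limit
        refine Metric.tendstoUniformly_iff.2 fun ε hε => ?_
        filter_upwards [Metric.tendstoUniformly_iff.1 (h2.add ih) ε hε] with r hr p
        have := hr p
        simp only [Pi.add_apply] at this
        rwa [Finset.sum_insert hi, Finset.sum_insert hi, mul_add, mul_left_comm]
    exact h1 Finset.univ

end Linear

/-! ### The mass -/

theorem exists_tendsto_of_antitoneOn_Ici {f : ℝ → ℝ} (hf : AntitoneOn f (Ici 0)) {c : ℝ}
    (hc : ∀ᶠ r in atTop, c ≤ f r) : ∃ L, Tendsto f atTop (𝓝 L) := by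
  have hanti : Antitone fun r => f (max r 0) := fun r s hrs =>
    hf (mem_Ici.2 (le_max_right r 0)) (mem_Ici.2 (le_max_right s 0)) (max_le_max_right 0 hrs)
  have hbdd : BddBelow (range fun r => f (max r 0)) := by
    refine ⟨c, ?_⟩
    rintro _ ⟨r, rfl⟩
    obtain ⟨s, hs, hrs⟩ := (hc.and (eventually_ge_atTop (max r 0))).exists
    exact hs.trans (hf (mem_Ici.2 (le_max_right r 0))
      (mem_Ici.2 ((le_max_right r 0).trans hrs)) hrs)
  refine ⟨_, (tendsto_atTop_ciInf hanti hbdd).congr' ?_⟩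
  filter_upwards [eventually_ge_atTop 0] with r hr
  rw [max_eq_left hr]

section Mass

variable {S : Type*} [TopologicalSpace S] [ChartedSpace Plane S] [IsManifold (𝓡 2) ∞ S] [T2Space S]
  [CompactSpace S] [MeasurableSpace S] [BorelSpace S]
  {κ : ℝ} {F₀ N : S → Mink} {Hin : S → ℝ} {u : S → ℝ → ℝ}

/-- The mass as an integral over the initial surface. -/
theorem mass_eq (hκ : 0 < κ) (hF : IsConvexSurface κ F₀ N) (w : S → ℝ → ℝ) {r : ℝ} (hr : 0 ≤ r) :
    mass κ F₀ N u w r = ∫ p, areaFactorDeriv κ F₀ N r p * (1 - 1 / u p r) * w p r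
      ∂areaMeasure κ F₀ N 0 := by
  rw [mass, integral_areaMeasure hκ hF hr]
  congr 1 with p
  have := (areaFactor_pos hκ hF hr p).ne'
  rw [massDensity, perturbedMeanCurv, meanCurv_eq_div hκ hF hr]
  field_simp

theorem IsLapse.integrable_massDensity (hu : IsLapse κ F₀ N Hin u) (hκ : 0 < κ)
    (hF : IsConvexSurface κ F₀ N) (hHin : ∀ p, 0 < Hin p) {w : S → ℝ → ℝ} {r : ℝ} (hr : 0 ≤ r)
    (hw : Continuous fun p => w p r) :
    Integrable (massDensity κ F₀ N u w r) (areaMeasure κ F₀ N r) := by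
  have := isFiniteMeasure_areaMeasure hκ hF hr
  obtain ⟨h1, h2, -⟩ := continuous_areaFactors hκ hF
  have h3 : Continuous (meanCurv κ F₀ N r) := by
    have e : meanCurv κ F₀ N r = fun p => areaFactorDeriv κ F₀ N r p / areaFactor κ F₀ N r p :=
      funext fun p => meanCurv_eq_div hκ hF hr p
    rw [e]
    exact (h2.comp (f := fun p : S => (p, r)) (by fun_prop)).div
      (h1.comp (f := fun p : S => (p, r)) (by fun_prop))
      fun p => (areaFactor_pos hκ hF hr p).ne'
  exact integrable_of_continuous ((h3.sub (h3.div (hu.isClassical.continuous_slice hr)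
    fun p => (hu.pos hκ hF hHin p hr).ne')).mul hw)

/-- The mass is controlled by the rescaled weight, since `H₀ - 𝓗` decays like `e^{-3κr}` and the
area of the leaves grows like `e^{2κr}`. -/
theorem IsLapse.exists_abs_mass_le [Nonempty S] (hu : IsLapse κ F₀ N Hin u) (hκ : 0 < κ)
    (hF : IsConvexSurface κ F₀ N) (hHin : ∀ p, 0 < Hin p) :
    ∃ K > 0, ∀ (w : S → ℝ → ℝ) (ε : ℝ), ∀ r ≥ 0,
      (∀ p, |Real.exp (-(κ * r)) * w p r| ≤ ε) → |mass κ F₀ N u w r| ≤ K * ε := by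
  obtain ⟨C, hC, m, -, hb⟩ := exists_areaFactor_bounds hκ hF
  obtain ⟨B, hB, hBu⟩ := hu.exists_bound hκ hF hHin
  have := isFiniteMeasure_areaMeasure_zero hκ hF
  refine ⟨C * B * ((areaMeasure κ F₀ N 0).real univ + 1), by positivity, fun w ε r hr hw => ?_⟩
  obtain ⟨p₀⟩ := ‹Nonempty S›
  have hε : 0 ≤ ε := (abs_nonneg _).trans (hw p₀)
  rw [mass_eq hκ hF w hr]
  have key : ∀ p, ‖areaFactorDeriv κ F₀ N r p * (1 - 1 / u p r) * w p r‖ ≤ C * B * ε := by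
    intro p
    have h1 := (hb p r hr).2.1
    have h2 := areaFactorDeriv_pos hκ hF hr p
    have h3 : Real.exp (2 * κ * r) * Real.exp (-(3 * κ * r)) = Real.exp (-(κ * r)) := by
      rw [← Real.exp_add]; ring_nf
    have h4 := hw p
    rw [abs_mul, abs_of_pos (Real.exp_pos _)] at h4
    rw [norm_mul, norm_mul, Real.norm_of_nonneg h2.le, Real.norm_eq_abs, Real.norm_eq_abs]
    calc areaFactorDeriv κ F₀ N r p * |1 - 1 / u p r| * |w p r|
        ≤ C * Real.exp (2 * κ * r) * (B * Real.exp (-(3 * κ * r))) * |w p r| := by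
          gcongr
          exact hBu p r hr
      _ = C * B * (Real.exp (-(κ * r)) * |w p r|) := by rw [← h3]; ring
      _ ≤ C * B * ε := by gcongr
  have := norm_integral_le_of_norm_le_const (μ := areaMeasure κ F₀ N 0) (ae_of_all _ key)
  rw [Real.norm_eq_abs] at this
  refine this.trans ?_
  have : 0 ≤ C * B * ε := by positivity
  linarith

/-- The monotonicity formula: after Green's formula has removed the second order terms, the
derivative of the mass is `-∫ (u - 1)² / (2u) (R^r + 2κ²) W` over `Σ_r`. -/
theorem hasDerivAt_mass (hu : IsLapse κ F₀ N Hin u) (hκ : 0 < κ)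
    (hF : IsConvexSurface κ F₀ N) (hHin : ∀ p, 0 < Hin p) {data : S → ℝ} {W : S → ℝ → ℝ}
    (hW : IsBackwardSolution κ F₀ N u data W) {r : ℝ} (hr : 0 < r) :
    HasDerivAt (fun s => ∫ p, areaFactorDeriv κ F₀ N s p * (1 - 1 / u p s) * W p s
        ∂areaMeasure κ F₀ N 0)
      (-∫ p, (u p r - 1) ^ 2 / (2 * u p r) * (areaFactorDeriv2 κ F₀ N r p -
        2 * κ ^ 2 * areaFactor κ F₀ N r p) * W p r ∂areaMeasure κ F₀ N 0) r := by
  have := isFiniteMeasure_areaMeasure_zero hκ hF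
  have hcu := hu.isClassical
  have hcW := hW.isClassical
  have hpos := fun p s (hs : s > 0) => hu.pos hκ hF hHin p (r := s) (le_of_lt hs)
  obtain ⟨hD, hD1, hD2⟩ := continuous_areaFactors hκ hF
  have hsub : (univ ×ˢ Ioi 0 : Set (S × ℝ)) ⊆ univ ×ˢ Ici 0 :=
    prod_mono le_rfl Ioi_subset_Ici_self
  have hu0 : ∀ q ∈ (univ ×ˢ Ioi 0 : Set (S × ℝ)), u q.1 q.2 ≠ 0 := fun q hq =>
    (hpos q.1 q.2 hq.2).ne'
  have cu := hcu.continuousOn.mono hsub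
  have cW := hcW.continuousOn.mono hsub
  have cdu := hcu.continuousOn_deriv
  have cdW := hcW.continuousOn_deriv
  have cv : ContinuousOn (fun q : S × ℝ => 1 - 1 / u q.1 q.2) (univ ×ˢ Ioi 0) :=
    continuousOn_const.sub (continuousOn_const.div cu hu0)
  have hd : ∀ p, ∀ s > 0, HasDerivAt
      (fun s => areaFactorDeriv κ F₀ N s p * (1 - 1 / u p s) * W p s)
      ((areaFactorDeriv2 κ F₀ N s p * (1 - 1 / u p s) +
        areaFactorDeriv κ F₀ N s p * (deriv (u p) s / u p s ^ 2)) * W p s +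
        areaFactorDeriv κ F₀ N s p * (1 - 1 / u p s) * deriv (W p) s) s := by
    intro p s hs
    have h1 : HasDerivAt (fun s => 1 - 1 / u p s) (deriv (u p) s / u p s ^ 2) s := by
      have := ((hcu.hasDerivAt p hs).fun_inv (hpos p s hs).ne').const_sub 1
      simp only [one_div]
      exact this.congr_deriv (by ring)
    exact ((hasDerivAt_areaFactorDeriv hκ s p).fun_mul h1).fun_mul (hcW.hasDerivAt p hs)
  refine (hasDerivAt_integral ((hD1.continuousOn.mul cv).mul cW)
    ((((hD2.continuousOn.mul cv).add
      (hD1.continuousOn.mul (cdu.div (cu.pow 2) fun q hq => pow_ne_zero 2 (hu0 q hq)))).mul cW).add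
      ((hD1.continuousOn.mul cv).mul cdW)) hd hr).congr_deriv ?_
  -- the equations for `u` and `W` turn the time derivatives into Laplacians; `W Δu - (u - 1) ΔW`
  -- is of the form required by Green's identity as `Δu = Δ(u - 1)`
  have hE : ∀ p, (areaFactorDeriv2 κ F₀ N r p * (1 - 1 / u p r) +
        areaFactorDeriv κ F₀ N r p * (deriv (u p) r / u p r ^ 2)) * W p r +
        areaFactorDeriv κ F₀ N r p * (1 - 1 / u p r) * deriv (W p) r =
      areaFactor κ F₀ N r p * (W p r * leafLaplacian κ F₀ N r (fun q => u q r - 1) p -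
        (u p r - 1) * leafLaplacian κ F₀ N r (fun q => W q r) p) -
      (u p r - 1) ^ 2 / (2 * u p r) * (areaFactorDeriv2 κ F₀ N r p -
        2 * κ ^ 2 * areaFactor κ F₀ N r p) * W p r := by
    intro p
    have h0 := (hpos p r hr).ne'
    have hA := (areaFactor_pos hκ hF hr.le p).ne'
    have h1 := hu.equation' hκ hF p hr
    have h2 := hW.equation p r hr
    rw [meanCurv_eq_div hκ hF hr.le] at h2
    have h3 : areaFactorDeriv κ F₀ N r p * deriv (W p) r = u p r * areaFactor κ F₀ N r p *
        (-leafLaplacian κ F₀ N r (fun q => W q r) p + 2 * κ ^ 2 * W p r) := by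
      rw [← h2]; field_simp
    rw [leafLaplacian_sub_one hκ hF hr.le]
    field_simp
    linear_combination W p r * h1 + 2 * u p r * (u p r - 1) * h3
  have cus := hcu.continuous_slice hr.le
  have cWs := hcW.continuous_slice hr.le
  have hDr := continuous_areaFactor hκ hF r
  have hD2r : Continuous fun p => areaFactorDeriv2 κ F₀ N r p :=
    hD2.comp (f := fun p : S => (p, r)) (by fun_prop)
  have hsu : ContMDiff (𝓡 2) 𝓘(ℝ, ℝ) 2 fun q => u q r - 1 :=
    (hcu.contMDiff_slice hr).sub contMDiff_const
  have hsW := hcW.contMDiff_slice hr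
  simp only [hE]
  rw [integral_sub, ← integral_areaMeasure hκ hF hr.le, integral_green hκ hF hr.le hsu hsW,
    zero_sub]
  · exact integrable_of_continuous (hDr.mul
      ((cWs.mul (continuous_leafLaplacian hκ hF hr.le hsu)).sub
      ((cus.sub continuous_const).mul (continuous_leafLaplacian hκ hF hr.le hsW))))
  · exact integrable_of_continuous (((((cus.sub continuous_const).pow 2).div
      (continuous_const.mul cus) fun p => mul_ne_zero two_ne_zero (hpos p r hr).ne').mul
      (hD2r.sub (continuous_const.mul hDr))).mul cWs)

theorem antitoneOn_mass (hu : IsLapse κ F₀ N Hin u) (hκ : 0 < κ)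
    (hF : IsConvexSurface κ F₀ N) (hHin : ∀ p, 0 < Hin p) {data : S → ℝ}
    (hdata : ∀ p, 0 ≤ data p) {W : S → ℝ → ℝ}
    (hW : IsBackwardSolution κ F₀ N u data W) : AntitoneOn (mass κ F₀ N u W) (Ici 0) := by
  have := isFiniteMeasure_areaMeasure_zero hκ hF
  obtain ⟨-, hD1, -⟩ := continuous_areaFactors hκ hF
  -- as an integral over the fixed initial surface the mass can be differentiated
  have h1 : AntitoneOn (fun s => ∫ p, areaFactorDeriv κ F₀ N s p * (1 - 1 / u p s) * W p s
      ∂areaMeasure κ F₀ N 0) (Ici 0) := by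
    refine antitoneOn_of_deriv_nonpos (convex_Ici 0) (continuousOn_integral
      ((hD1.continuousOn.mul (continuousOn_const.sub (continuousOn_const.div hu.continuousOn
        fun q hq => (hu.pos hκ hF hHin q.1 hq.2).ne'))).mul hW.continuousOn)) ?_ ?_
    · rw [interior_Ici]
      exact fun r hr =>
        (hasDerivAt_mass hu hκ hF hHin hW hr).differentiableAt.differentiableWithinAt
    · rw [interior_Ici]
      intro r hr
      replace hr : 0 < r := hr
      rw [(hasDerivAt_mass hu hκ hF hHin hW hr).deriv, neg_nonpos]
      refine integral_nonneg fun p => ?_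
      have h2 := hu.pos hκ hF hHin p hr.le
      have h3 := areaFactorDeriv2_sub_nonneg hκ hF hr.le p
      have h4 := hW.nonneg hu hκ hF hHin hdata p hr
      simp only [Pi.zero_apply]
      positivity
  exact h1.congr fun r hr => (mass_eq hκ hF W hr).symm

/-- The mass converges, and its limit depends on the weight only through the data at infinity. -/
theorem exists_tendsto_mass [Nonempty S] (hu : IsLapse κ F₀ N Hin u) (hκ : 0 < κ)
    (hF : IsConvexSurface κ F₀ N) (hHin : ∀ p, 0 < Hin p) {data : S → ℝ} (hc : Continuous data)
    (hdata : ∀ p, 0 ≤ data p) {W φ : S → ℝ → ℝ} (hW : IsBackwardSolution κ F₀ N u data W)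
    (hφc : ∀ r, Continuous fun p => φ p r)
    (hφ : TendstoUniformly (fun r p => Real.exp (-(κ * r)) * φ p r) data atTop) :
    ∃ L : ℝ, Tendsto (mass κ F₀ N u W) atTop (𝓝 L) ∧ Tendsto (mass κ F₀ N u φ) atTop (𝓝 L) := by
  obtain ⟨K, hK, hmass⟩ := hu.exists_abs_mass_le hκ hF hHin
  obtain ⟨M, hM⟩ := isCompact_univ.exists_bound_of_continuousOn hc.continuousOn
  have hlow : ∀ᶠ r in atTop, -(K * (M + 1)) ≤ mass κ F₀ N u W r := by
    filter_upwards [Metric.tendstoUniformly_iff.1 hW.limit 1 one_pos, eventually_ge_atTop 0]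
      with r hr hr0
    refine (abs_le.1 (hmass W (M + 1) r hr0 fun p => ?_)).1
    have h1 := hr p
    have h2 := hM p (mem_univ p)
    rw [Real.dist_eq, abs_sub_comm] at h1
    rw [Real.norm_eq_abs] at h2
    have h3 := abs_add_le (Real.exp (-(κ * r)) * W p r - data p) (data p)
    rw [sub_add_cancel] at h3
    linarith
  obtain ⟨L, hL⟩ := exists_tendsto_of_antitoneOn_Ici (antitoneOn_mass hu hκ hF hHin hdata hW) hlow
  refine ⟨L, hL, ?_⟩
  have hdiff : Tendsto (fun r => mass κ F₀ N u φ r - mass κ F₀ N u W r) atTop (𝓝 0) := by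
    refine Metric.tendsto_nhds.2 fun ε hε => ?_
    have hη : 0 < ε / (4 * K) := by positivity
    filter_upwards [Metric.tendstoUniformly_iff.1 hW.limit _ hη,
      Metric.tendstoUniformly_iff.1 hφ _ hη, eventually_ge_atTop 0] with r h1 h2 hr0
    have e : mass κ F₀ N u φ r - mass κ F₀ N u W r =
        mass κ F₀ N u (fun p s => φ p s - W p s) r := by
      rw [mass, mass, mass, ← integral_sub
        (hu.integrable_massDensity hκ hF hHin hr0 (hφc r))
        (hu.integrable_massDensity hκ hF hHin hr0 (hW.isClassical.continuous_slice hr0))]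
      congr 1 with p
      simp only [massDensity]
      ring
    have h3 := hmass (fun p s => φ p s - W p s) (ε / (2 * K)) r hr0 fun p => by
      have h1 := h1 p
      have h2 := h2 p
      rw [Real.dist_eq, abs_lt] at h1 h2
      have : ε / (2 * K) = ε / (4 * K) + ε / (4 * K) := by field_simp; norm_num
      rw [mul_sub, this, abs_le]
      constructor <;> linarith
    rw [Real.dist_eq, sub_zero, e]
    refine h3.trans_lt ?_
    have : K * (ε / (2 * K)) = ε / 2 := by field_simp
    linarith
  simpa using hdiff.add hL

end Mass

end QuasiLocal

open QuasiLocal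
theorem proposition5p1 {S : Type*} [TopologicalSpace S] [ChartedSpace Plane S]
    [IsManifold (𝓡 2) ∞ S] [T2Space S] [CompactSpace S] [ConnectedSpace S]
    [MeasurableSpace S] [BorelSpace S]
    (κ : ℝ) (hκ : 0 < κ) (F₀ N : S → Mink) (hF : IsConvexSurface κ F₀ N)
    (Hin : S → ℝ) (hHin : ∀ p, 0 < Hin p)
    (u : S → ℝ → ℝ) (hu : IsLapse κ F₀ N Hin u)
    (a : Fin 2 → ℂ) :
    -- the scalar equation
    (∀ W : S → ℝ → ℝ,
      IsBackwardSolution κ F₀ N u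
        (fun p => -lorentz (lightConeMap κ F₀ N p) (zeta a)) W →
      (∀ r ≥ 0,
        Integrable (massDensity κ F₀ N u W r) (areaMeasure κ F₀ N r) ∧
        Integrable (massDensity κ F₀ N u (leafKillingNormSq κ F₀ N a) r)
          (areaMeasure κ F₀ N r)) ∧
      AntitoneOn (mass κ F₀ N u W) (Ici 0) ∧
      ∃ L : ℝ, Tendsto (mass κ F₀ N u W) atTop (𝓝 L) ∧
        Tendsto (mass κ F₀ N u (leafKillingNormSq κ F₀ N a)) atTop (𝓝 L)) ∧
    -- the vector-valued equation
    (∀ V : S → ℝ → Mink,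
      (∀ i : Fin 4, IsBackwardSolution κ F₀ N u
        (fun p => -lightConeMap κ F₀ N p i) (fun p r => V p r i)) →
      (∀ r ≥ 0,
        Integrable (massDensity κ F₀ N u (fun p s => lorentz (V p s) (zeta a)) r)
          (areaMeasure κ F₀ N r)) ∧
      AntitoneOn (mass κ F₀ N u (fun p r => lorentz (V p r) (zeta a))) (Ici 0) ∧
      ∃ L : ℝ, Tendsto (mass κ F₀ N u (fun p r => lorentz (V p r) (zeta a))) atTop (𝓝 L) ∧
        Tendsto (mass κ F₀ N u (leafKillingNormSq κ F₀ N a)) atTop (𝓝 L)) := by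
  have hc : Continuous fun p => -lorentz (lightConeMap κ F₀ N p) (zeta a) := by
    have h1 := hF.smooth.continuous
    have h2 := hF.normal_smooth.continuous
    refine (continuous_lorentz_zeta a ?_).neg
    unfold lightConeMap
    fun_prop
  have hdata := neg_lorentz_lightConeMap_zeta_nonneg hκ hF a
  have hφc := continuous_leafKillingNormSq hκ hF a
  have hφ := tendstoUniformly_leafKillingNormSq hκ hF a
  refine ⟨fun W hW => ⟨fun r hr => ⟨?_, ?_⟩, antitoneOn_mass hu hκ hF hHin hdata hW,
    exists_tendsto_mass hu hκ hF hHin hc hdata hW hφc hφ⟩, fun V hV => ?_⟩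
  · exact hu.integrable_massDensity hκ hF hHin hr (hW.isClassical.continuous_slice hr)
  · exact hu.integrable_massDensity hκ hF hHin hr (hφc r)
  · have hW : IsBackwardSolution κ F₀ N u (fun p => -lorentz (lightConeMap κ F₀ N p) (zeta a))
        fun p r => lorentz (V p r) (zeta a) := by
      -- the last sign is that of the time component in the Lorentz product
      convert IsBackwardSolution.sum hκ hF ![zeta a 0, zeta a 1, zeta a 2, -zeta a 3] hV using 1
      · funext p
        simp [Fin.sum_univ_four, lorentz]
        ring
      · funext p r
        simp [Fin.sum_univ_four, lorentz]
        ring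
    exact ⟨fun r hr => hu.integrable_massDensity hκ hF hHin hr
      (hW.isClassical.continuous_slice hr), antitoneOn_mass hu hκ hF hHin hdata hW,
      exists_tendsto_mass hu hκ hF hHin hc hdata hW hφc hφ⟩
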